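/- For a prime $p$ let $\mathcal H_p=\mathbb C(\mathbb F_p)$ be the $p$-dimensional Hilbert space of complex-valued functions on $\mathbb F_p$, with inner product $\langle f,g\rangle=\sum_{t\in\mathbb F_p}f(t)\overline{g(t)}$. Fix real numbers $0<\varepsilon<1$ and $\mu>0$. Let $p$ tend to infinity through an infinite set $\mathcal P$ of primes, and for each $p\in\mathcal P$ let $\mathfrak D_p\subset\mathcal H_p$ be a finite set such that (i) $\mathfrak D_p$ is a disjoint union of orthonormal bases of $\mathcal H_p$; (ii) $\mathfrak D_p$ is $\mu$-coherent: $|\langle\varphi,\phi\rangle|\le\mu/\sqrt p$ for all distinct $\varphi,\phi\in\mathfrak D_p$; (iii) $|\mathfrak D_p|\gg p$, that is, $|\mathfrak D_p|/p\to\infty$ as $p\to\infty$. Let $n=n_p$ be $p^{1-\varepsilon}$ rounded (down or up) to an integer, and let $S$ be a subset of $\mathfrak D_p$ with $n$ elements, chosen uniformly at random. Let $\Theta_S:\mathbb C(S)\to\mathcal H_p$, $\Theta_S(f)=\sum_{\varphi\in S}f(\varphi)\varphi$, let $\mathbf G(S)=\Theta_S^*\Theta_S$ be the Gram operator, and let $$\mathbf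 E(S)=(p/n)^{1/2}\bigl(\mathbf G(S)-\mathrm{Id}_S\bigr).$$ Let $\rho_{\mathbf E(S)}=n^{-1}\sum_{i=1}^n\delta_{\lambda_i}$, where $\lambda_1,\dots,\lambda_n$ are the eigenvalues (with multiplicity) of the Hermitian operator $\mathbf E(S)$, and let $\rho_{SC}$ be the Wigner semicircle distribution, with density $(2\pi)^{-1}\sqrt{4-x^2}\cdot\mathbf 1_{[-2,2]}(x)$. Then, as $p\to\infty$ through $\mathcal P$, $\rho_{\mathbf E(S)}$ converges in probability to $\rho_{SC}$ with respect to weak convergence of measures: for every bounded continuous $f:\mathbb R\to\mathbb R$ and every $\eta>0$, $$P\Bigl(\Bigl|\int f\,d\rho_{\mathbf E(S)}-\int f\,d\rho_{SC}\Bigr|\ge\eta\Bigr)\longrightarrow 0 .$$ -/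

import Mathlib

open MeasureTheory Filter Topology
open scoped ENNReal BoundedContinuousFunction

noncomputable section

/-- The Hilbert space of signals, complex valued functions on the finite field with `p` elements. -/
abbrev Signal (p : ℕ) : Type := EuclideanSpace ℂ (ZMod p)

/-- A finite set of atoms is `μ`-coherent if distinct atoms have inner product
of absolute value at most `μ / √p`. -/
def IsCoherent {p : ℕ} [Fact p.Prime] (μ : ℝ) (D : Finset (Signal p)) : Prop :=
  ∀ φ ∈ D, ∀ ψ ∈ D, φ ≠ ψ → ‖inner ℂ φ ψ‖ ≤ μ / √(p : ℝ)

/-- The dictionary is a disjoint union of (finitely many) orthonormal bases of the space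
of signals. -/
def IsDisjointUnionOfBases {p : ℕ} [Fact p.Prime] (D : Finset (Signal p)) : Prop :=
  ∃ (m : ℕ) (B : Fin m → OrthonormalBasis (Fin p) ℂ (Signal p)),
    (Pairwise fun x y => Disjoint (Set.range (B x)) (Set.range (B y))) ∧
      (D : Set (Signal p)) = ⋃ x, Set.range (B x)

/-- The resolution `Θ_S : ℂ(S) → H`, `f ↦ ∑_{φ ∈ S} f(φ) φ`. For a subset `S` of a dictionary this
is the restriction of the resolution of the dictionary to the functions supported on `S`. -/
def resolution {p : ℕ} (S : Finset (Signal p)) : EuclideanSpace ℂ S →ₗ[ℂ] Signal p where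
  toFun f := ∑ φ : S, f φ • (φ : Signal p)
  map_add' f g := by simp [add_smul, Finset.sum_add_distrib]
  map_smul' c f := by simp [mul_smul, Finset.smul_sum]

/-- The Gram operator `G(S) = Θ_S^* ∘ Θ_S`. -/
def gramOp {p : ℕ} [Fact p.Prime] (S : Finset (Signal p)) :
    EuclideanSpace ℂ S →ₗ[ℂ] EuclideanSpace ℂ S :=
  LinearMap.adjoint (resolution S) ∘ₗ resolution S

/-- The normalized error `E(S) = (p / n)^{1/2} (G(S) - Id_S)`, where `n = |S|`. -/
def normalizedError {p : ℕ} [Fact p.Prime] (S : Finset (Signal p)) :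
    EuclideanSpace ℂ S →ₗ[ℂ] EuclideanSpace ℂ S :=
  ((√((p : ℝ) / (S.card : ℝ)) : ℝ) : ℂ) • (gramOp S - LinearMap.id)

theorem normalizedError_isSymmetric {p : ℕ} [Fact p.Prime] (S : Finset (Signal p)) :
    (normalizedError S).IsSymmetric := by
  intro f g
  simp [normalizedError, gramOp, inner_sub_left, inner_sub_right, inner_smul_left,
    inner_smul_right, LinearMap.adjoint_inner_left, LinearMap.adjoint_inner_right]

/-- The real eigenvalues of the Hermitian operator `E(S)`, with multiplicity. -/
def errorEigenvalues {p : ℕ} [Fact p.Prime] (S : Finset (Signal p)) : Fin S.card → ℝ :=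
  (normalizedError_isSymmetric S).eigenvalues (n := S.card) (by simp)

/-- The spectral distribution `ρ_{E(S)} = n⁻¹ ∑ δ_{λ_i}`. -/
def spectralDistribution {p : ℕ} [Fact p.Prime] (S : Finset (Signal p)) : Measure ℝ :=
  (S.card : ℝ≥0∞)⁻¹ • ∑ i, Measure.dirac (errorEigenvalues S i)

/-- The Wigner semicircle distribution on `[-2, 2]`. -/
def semicircle : Measure ℝ :=
  volume.withDensity fun x =>
    ENNReal.ofReal ((Set.Icc (-2 : ℝ) 2).indicator
      (fun x => (2 * Real.pi)⁻¹ * √(4 - x ^ 2)) x)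

open Classical in
/-- The probability that a subset `S` of `D` with `n` elements, chosen uniformly at random,
has the property `A`. -/
def subsetProb {p : ℕ} (D : Finset (Signal p)) (n : ℕ) (A : Finset (Signal p) → Prop) : ℝ :=
  (((D.powersetCard n).filter A).card : ℝ) / ((D.powersetCard n).card : ℝ)

end

/-! The proof avoids traces of powers. For a Hermitian matrix `A` on the random set `S`, here the
normalized error, let `P_m` be the matrix whose entry at `(a, b)` is the sum of the products of the
entries of `A` along the self-avoiding paths of length `m` from `a` to `b` (`pathSum`). One more
step in front of such a path leads to a new point, or back to its second point, or closes a longer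
cycle, so that (`sum_mul_pathSum_succ`)

  `A P_{m+1} = P_{m+2} + d P_m + (lassos) - (detours)`,

where `d` is the diagonal part of `A * A`. Up to the errors this is the recursion of the Chebyshev
polynomials `S_m` (rescaled, of the second kind), which are the orthogonal polynomials of the
semicircle law. Moreover `P_m` has trace `0` for `m ≥ 1`. Hence `P_m` behaves as `S_m(A)`, and
`tr S_m(A) ≈ 0` for all `m ≥ 1` characterizes the semicircle. The norms in which this approximation
makes sense are weak: an eigenbasis of `A` is fixed, and only the diagonal coefficients
`w m i = ⟨b_i, P_m b_i⟩` are compared with `S_m(λ_i)`. They satisfy the recursion with errors that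
are small on average, and their second moments are bounded. A compactness argument with truncated
polynomials shows that this suffices for weak convergence (`exists_forall_abs_mean_sub_lt`),
although the moments of the eigenvalues themselves are not controlled.

It remains to bound, in expectation over `S`, the squares of the Hilbert-Schmidt norms of `P_m`, of
the lassos and detours, and of `d - 1`. By Markov's inequality the theorem then follows; no
variances of traces are needed. The square of a Hilbert-Schmidt norm is a sum over closed walks that
follow a path forwards and a second one backwards, hence over labellings of a connected balanced
multigraph. The fundamental estimate `pow_mul_norm_injAvg_le` bounds the contribution of a
multigraph with `q` edges by `O(n (n / p) ^ (q / 2))`, which is exactly compensated by the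
normalization of `A`. It is proved by induction on the number of vertices: a vertex that is visited
only once is integrated out by means of the tight frame identity of a union of orthonormal bases,
and if every vertex is visited at least twice, then the trivial bound by coherence is good enough. The
multigraphs of lassos and detours contain a `HasCore` certificate that they are not trees of
doubled edges, and this gains a factor that tends to `0`. The concentration of `d` at `1` is
a second moment computation for row sums (`sum_sq_sum_sub_one_le`). -/

/-! ### The semicircle distribution -/

/-- The substitution `x = 2 cos θ`. -/
theorem integral_semicircle (f : ℝ → ℝ) (hf : Continuous f) :
    ∫ x, f x ∂semicircle = 2 / Real.pi * ∫ θ in 0..Real.pi, f (2 * Real.cos θ) * Real.sin θ ^ 2 := by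
  have hmeas : Measurable fun x : ℝ => (Set.Icc (-2 : ℝ) 2).indicator
      (fun x => (2 * Real.pi)⁻¹ * √(4 - x ^ 2)) x :=
    Measurable.indicator (by fun_prop) measurableSet_Icc
  have h1 : ∫ x, f x ∂semicircle
      = ∫ x in (-2 : ℝ)..2, f x * ((2 * Real.pi)⁻¹ * √(4 - x ^ 2)) := by
    rw [semicircle, integral_withDensity_eq_integral_toReal_smul (by fun_prop) (by simp),
      intervalIntegral.integral_of_le (by norm_num), ← integral_Icc_eq_integral_Ioc,
      ← integral_indicator measurableSet_Icc]
    refine integral_congr_ae (Eventually.of_forall fun x => ?_)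
    by_cases hx : x ∈ Set.Icc (-2 : ℝ) 2
    · have : 0 ≤ (2 * Real.pi)⁻¹ * √(4 - x ^ 2) := by positivity
      simp only [Set.indicator_of_mem hx, ENNReal.toReal_ofReal this, smul_eq_mul]
      ring
    · simp [Set.indicator_of_notMem hx]
  have h2 := intervalIntegral.integral_comp_mul_deriv (a := 0) (b := Real.pi)
    (f := fun θ => 2 * Real.cos θ) (f' := fun θ => 2 * -Real.sin θ)
    (g := fun x => f x * ((2 * Real.pi)⁻¹ * √(4 - x ^ 2)))
    (fun θ _ => (Real.hasDerivAt_cos θ).const_mul 2) (by fun_prop) (by fun_prop)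
  simp only [Real.cos_zero, Real.cos_pi, mul_one, mul_neg] at h2
  rw [h1, intervalIntegral.integral_symm, ← h2, ← intervalIntegral.integral_neg,
    ← intervalIntegral.integral_const_mul]
  refine intervalIntegral.integral_congr fun θ hθ => ?_
  rw [Set.uIcc_of_le Real.pi_pos.le] at hθ
  have hs : 0 ≤ Real.sin θ := Real.sin_nonneg_of_mem_Icc hθ
  have : √(4 - (2 * Real.cos θ) ^ 2) = 2 * Real.sin θ := by
    rw [show 4 - (2 * Real.cos θ) ^ 2 = (2 * Real.sin θ) ^ 2 by
      have := Real.sin_sq_add_cos_sq θ; nlinarith]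
    exact Real.sqrt_sq (by positivity)
  simp only [Function.comp, this]
  have := Real.pi_ne_zero
  field_simp

theorem integral_sin_natCast_mul_mul_sin (m : ℕ) :
    ∫ θ in 0..Real.pi, Real.sin ((m + 1) * θ) * Real.sin θ = if m = 0 then Real.pi / 2 else 0 := by
  split_ifs with h
  · subst h
    simp [← sq, integral_sin_sq]
  · have hm : (m : ℝ) ≠ 0 := by exact_mod_cast h
    have hm2 : (m : ℝ) + 2 ≠ 0 := by positivity
    have : ∀ θ : ℝ, Real.sin ((m + 1) * θ) * Real.sin θ
        = (Real.cos (m * θ) - Real.cos ((m + 2) * θ)) / 2 := by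
      intro θ
      rw [show (m : ℝ) * θ = (m + 1) * θ - θ by ring, show ((m : ℝ) + 2) * θ = (m + 1) * θ + θ by ring,
        Real.cos_sub, Real.cos_add]
      ring
    simp_rw [this]
    rw [intervalIntegral.integral_div, intervalIntegral.integral_sub
      (by apply Continuous.intervalIntegrable; fun_prop)
      (by apply Continuous.intervalIntegrable; fun_prop),
      intervalIntegral.integral_comp_mul_left _ hm, intervalIntegral.integral_comp_mul_left _ hm2]
    have e : Real.sin (((m : ℝ) + 2) * Real.pi) = 0 := by
      have := Real.sin_nat_mul_pi (m + 2)
      push_cast at this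
      exact this
    simp [Real.sin_nat_mul_pi, e]

/-- The polynomials `S_m` are orthogonal to the constants for the semicircle law when `m ≥ 1`. -/
theorem integral_S_semicircle (m : ℕ) :
    ∫ x, (Polynomial.Chebyshev.S ℝ m).eval x ∂semicircle = if m = 0 then 1 else 0 := by
  rw [integral_semicircle _ (Polynomial.continuous _)]
  have : ∀ θ : ℝ, (Polynomial.Chebyshev.S ℝ m).eval (2 * Real.cos θ) * Real.sin θ ^ 2
      = Real.sin ((m + 1) * θ) * Real.sin θ := by
    intro θ
    rw [sq, ← mul_assoc, Polynomial.Chebyshev.S_two_mul_real_cos]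
    simp
  simp_rw [this, integral_sin_natCast_mul_mul_sin]
  have := Real.pi_ne_zero
  split_ifs
  · field_simp
  · simp

theorem integral_semicircle_const_mul (c : ℝ) (f : ℝ → ℝ) :
    ∫ x, c * f x ∂semicircle = c * ∫ x, f x ∂semicircle :=
  integral_const_mul c f

theorem integral_semicircle_add {f g : ℝ → ℝ} (hf : Continuous f) (hg : Continuous g) :
    ∫ x, (f x + g x) ∂semicircle = ∫ x, f x ∂semicircle + ∫ x, g x ∂semicircle := by
  rw [integral_semicircle _ hf, integral_semicircle _ hg, integral_semicircle (fun x => f x + g x) (hf.add hg),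
    ← mul_add, ← intervalIntegral.integral_add]
  · simp only [add_mul]
  all_goals apply Continuous.intervalIntegrable; fun_prop

theorem abs_integral_semicircle_le {f : ℝ → ℝ} (hf : Continuous f) {B : ℝ}
    (hB : ∀ x ∈ Set.Icc (-2 : ℝ) 2, |f x| ≤ B) : |∫ x, f x ∂semicircle| ≤ B := by
  rw [integral_semicircle _ hf]
  have h0 := Real.pi_pos
  have hle : |∫ θ in 0..Real.pi, f (2 * Real.cos θ) * Real.sin θ ^ 2|
      ≤ ∫ θ in 0..Real.pi, B * Real.sin θ ^ 2 := by
    refine intervalIntegral.abs_integral_le_integral_abs h0.le |>.trans ?_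
    refine intervalIntegral.integral_mono_on h0.le
      (by apply Continuous.intervalIntegrable; fun_prop)
      (by apply Continuous.intervalIntegrable; fun_prop) fun θ _ => ?_
    rw [abs_mul, abs_of_nonneg (sq_nonneg (Real.sin θ))]
    refine mul_le_mul_of_nonneg_right (hB _ ⟨?_, ?_⟩) (sq_nonneg _)
    · linarith [Real.neg_one_le_cos θ]
    · linarith [Real.cos_le_one θ]
  rw [intervalIntegral.integral_const_mul, integral_sin_sq] at hle
  simp only [Real.sin_zero, Real.sin_pi, zero_mul, sub_zero, zero_add] at hle
  rw [abs_mul, abs_of_pos (by positivity)]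
  calc 2 / Real.pi * _ ≤ 2 / Real.pi * (B * (Real.pi / 2)) := by gcongr
    _ = B := by field_simp

/-! ### A stability criterion for the semicircle distribution -/

/-- The average of a real function on `Fin n`. -/
noncomputable def mean {n : ℕ} (h : Fin n → ℝ) : ℝ := (∑ i, h i) / n

theorem mean_mono {n : ℕ} {g h : Fin n → ℝ} (H : ∀ i, g i ≤ h i) : mean g ≤ mean h :=
  div_le_div_of_nonneg_right (Finset.sum_le_sum fun i _ => H i) (Nat.cast_nonneg n)

theorem mean_nonneg {n : ℕ} {h : Fin n → ℝ} (H : ∀ i, 0 ≤ h i) : 0 ≤ mean h :=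
  div_nonneg (Finset.sum_nonneg fun i _ => H i) (Nat.cast_nonneg n)

theorem mean_add {n : ℕ} (g h : Fin n → ℝ) : mean (fun i => g i + h i) = mean g + mean h := by
  simp [mean, Finset.sum_add_distrib, add_div]

theorem mean_const_mul {n : ℕ} (c : ℝ) (h : Fin n → ℝ) :
    mean (fun i => c * h i) = c * mean h := by
  simp [mean, ← Finset.mul_sum, mul_div_assoc]

theorem mean_const {n : ℕ} (hn : 0 < n) (c : ℝ) : mean (fun _ : Fin n => c) = c := by
  have : (n : ℝ) ≠ 0 := by positivity
  simp [mean]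
  field_simp

theorem abs_mean_le {n : ℕ} (h : Fin n → ℝ) : |mean h| ≤ mean fun i => |h i| := by
  rw [mean, mean, abs_div, Nat.abs_cast]
  exact div_le_div_of_nonneg_right (Finset.abs_sum_le_sum_abs _ _) (Nat.cast_nonneg n)

/-- The truncation of a polynomial function to `[-R, R]`. -/
noncomputable def truncEval (R : ℝ) (q : Polynomial ℝ) (x : ℝ) : ℝ := if |x| ≤ R then q.eval x else 0

theorem truncEval_add (R : ℝ) (q r : Polynomial ℝ) (x : ℝ) :
    truncEval R (q + r) x = truncEval R q x + truncEval R r x := by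
  unfold truncEval; split_ifs <;> simp

theorem truncEval_C_mul (R : ℝ) (c : ℝ) (q : Polynomial ℝ) (x : ℝ) :
    truncEval R (Polynomial.C c * q) x = c * truncEval R q x := by
  unfold truncEval; split_ifs <;> simp

section

variable {J : Type*} {F : Filter J} {n : J → ℕ} {lam : ∀ j, Fin (n j) → ℝ}
  {w : ∀ j, ℕ → Fin (n j) → ℂ} {C : ℕ → ℝ}

/-- On a bounded set of eigenvalues, the weights are close to the Chebyshev polynomials on average,
since they satisfy the same recursion up to small errors. -/
theorem tendsto_mean_trunc_sub_S (hw0 : ∀ j i, w j 0 i = 1) (hw1 : ∀ j i, w j 1 i = lam j i)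
    (hrec : ∀ s, Tendsto (fun j => mean fun i => ‖lam j i * w j (s + 1) i - w j (s + 2) i - w j s i‖)
      F (𝓝 0)) (R : ℝ) (s : ℕ) :
    Tendsto (fun j => mean fun i => if |lam j i| ≤ R then
      ‖w j s i - ((Polynomial.Chebyshev.S ℝ s).eval (lam j i) : ℝ)‖ else 0) F (𝓝 0) := by
  induction s using Nat.twoStepInduction with
  | zero => simpa [hw0, mean] using tendsto_const_nhds
  | one => simpa [hw1, mean] using tendsto_const_nhds
  | more s h0 h1 =>
    have h := ((h1.const_mul |R|).add h0).add (hrec s)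
    simp only [mul_zero, add_zero] at h
    refine squeeze_zero (fun j => mean_nonneg fun i => by split_ifs <;> positivity)
      (fun j => ?_) h
    rw [← mean_const_mul, ← mean_add, ← mean_add]
    refine mean_mono fun i => ?_
    split_ifs with hR
    · have e : w j (s + 2) i - ((Polynomial.Chebyshev.S ℝ ((s + 2 : ℕ) : ℤ)).eval (lam j i) : ℝ)
          = lam j i * (w j (s + 1) i - ((Polynomial.Chebyshev.S ℝ ((s + 1 : ℕ) : ℤ)).eval (lam j i) : ℝ))
            - (w j s i - ((Polynomial.Chebyshev.S ℝ (s : ℤ)).eval (lam j i) : ℝ))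
            - (lam j i * w j (s + 1) i - w j (s + 2) i - w j s i) := by
        push_cast
        rw [Polynomial.Chebyshev.S_add_two]
        simp
        ring
      rw [e]
      refine (norm_sub_le _ _).trans (add_le_add ((norm_sub_le _ _).trans
        (add_le_add ?_ le_rfl)) le_rfl)
      rw [norm_mul]
      refine mul_le_mul_of_nonneg_right ?_ (norm_nonneg _)
      rw [Complex.norm_real, Real.norm_eq_abs]
      exact hR.trans (le_abs_self R)
    · simp

/-- The truncated averages of the Chebyshev polynomial `S_s`, `s ≥ 1`, are small: the corresponding
weights have average zero, and little mass far out. -/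
theorem eventually_abs_mean_trunc_S_le (hw0 : ∀ j i, w j 0 i = 1) (hw1 : ∀ j i, w j 1 i = lam j i)
    (hsum : ∀ j s, 1 ≤ s → ∑ i, w j s i = 0)
    (hC : ∀ s, ∀ᶠ j in F, mean (fun i => ‖w j s i‖ ^ 2) ≤ C s)
    (hrec : ∀ s, Tendsto (fun j => mean fun i => ‖lam j i * w j (s + 1) i - w j (s + 2) i - w j s i‖)
      F (𝓝 0)) (s : ℕ) (hs : 1 ≤ s) {R : ℝ} (hR : 0 < R) :
    ∀ᶠ j in F, |mean fun i => truncEval R (Polynomial.Chebyshev.S ℝ s) (lam j i)|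
      ≤ (C 1 + C s + 1) / R := by
  have h1 : ∀ᶠ j in F, (mean fun i => if |lam j i| ≤ R then
      ‖w j s i - ((Polynomial.Chebyshev.S ℝ s).eval (lam j i) : ℝ)‖ else 0) < 1 / R :=
    (tendsto_mean_trunc_sub_S hw0 hw1 hrec R s).eventually_lt_const (by positivity)
  filter_upwards [h1, hC 1, hC s] with j hj h1 h2
  have e : ((∑ i, truncEval R (Polynomial.Chebyshev.S ℝ s) (lam j i) : ℝ) : ℂ)
      = ∑ i, ((truncEval R (Polynomial.Chebyshev.S ℝ s) (lam j i) : ℝ) - w j s i) := by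
    rw [Finset.sum_sub_distrib, hsum j s hs]
    simp
  have b : |∑ i, truncEval R (Polynomial.Chebyshev.S ℝ s) (lam j i)|
      ≤ ∑ i, ((if |lam j i| ≤ R then
      ‖w j s i - ((Polynomial.Chebyshev.S ℝ s).eval (lam j i) : ℝ)‖ else 0)
        + (2 * R)⁻¹ * (‖w j 1 i‖ ^ 2 + ‖w j s i‖ ^ 2)) := by
    rw [← Real.norm_eq_abs, ← Complex.norm_real, e]
    refine (norm_sum_le _ _).trans (Finset.sum_le_sum fun i _ => ?_)
    unfold truncEval
    split_ifs with h
    · rw [norm_sub_rev]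
      exact le_add_of_nonneg_right (by positivity)
    · have hl : R ≤ ‖w j 1 i‖ := by
        rw [hw1, Complex.norm_real, Real.norm_eq_abs]; exact (not_le.1 h).le
      rw [Complex.ofReal_zero, zero_sub, norm_neg, zero_add, inv_mul_eq_div, le_div_iff₀ (by positivity)]
      nlinarith [norm_nonneg (w j s i), sq_nonneg (‖w j 1 i‖ - ‖w j s i‖)]
  calc |mean fun i => truncEval R (Polynomial.Chebyshev.S ℝ s) (lam j i)|
      ≤ mean fun i => ((if |lam j i| ≤ R then
      ‖w j s i - ((Polynomial.Chebyshev.S ℝ s).eval (lam j i) : ℝ)‖ else 0)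
        + (2 * R)⁻¹ * (‖w j 1 i‖ ^ 2 + ‖w j s i‖ ^ 2)) := by
        rw [mean, mean, abs_div, Nat.abs_cast]
        exact div_le_div_of_nonneg_right b (Nat.cast_nonneg _)
    _ ≤ 1 / R + (2 * R)⁻¹ * (C 1 + C s) := by
        rw [mean_add, mean_const_mul, mean_add]
        gcongr
    _ ≤ (C 1 + C s + 1) / R := by
        have hc1 : 0 ≤ C 1 := (mean_nonneg fun i => by positivity).trans h1
        have hcs : 0 ≤ C s := (mean_nonneg fun i => by positivity).trans h2
        rw [mul_inv, ← sub_nonneg]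
        have : (C 1 + C s + 1) / R - (1 / R + 2⁻¹ * R⁻¹ * (C 1 + C s)) = (C 1 + C s) / (2 * R) := by
          field_simp; ring
        rw [this]; positivity

theorem mean_far_le {n : ℕ} {l : Fin n → ℝ} {R B : ℝ} (hR : 1 ≤ R)
    (hB : mean (fun i => l i ^ 2) ≤ B) : mean (fun i => if |l i| ≤ R then 0 else 1) ≤ B / R := by
  have hR0 : 0 < R := by linarith
  calc mean (fun i => if |l i| ≤ R then 0 else 1) ≤ mean (fun i => R⁻¹ * l i ^ 2) := by
        refine mean_mono fun i => ?_
        split_ifs with h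
        · positivity
        · rw [inv_mul_eq_div, le_div_iff₀ hR0, ← sq_abs]
          nlinarith
    _ ≤ B / R := by
        rw [mean_const_mul, inv_mul_eq_div]; gcongr

/-- The truncated averages of a polynomial function converge to its integral against the
semicircle law, as the index goes along the filter first, and the truncation goes to
infinity next. -/
def HasTruncatedMoment (F : Filter J) (lam : ∀ j, Fin (n j) → ℝ) (q : Polynomial ℝ) : Prop :=
  ∃ K : ℝ, ∀ R : ℝ, 1 ≤ R → ∀ᶠ j in F,
    |(mean fun i => truncEval R q (lam j i)) - ∫ x, q.eval x ∂semicircle| ≤ K / R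

theorem HasTruncatedMoment.add {q r : Polynomial ℝ} (hq : HasTruncatedMoment F lam q)
    (hr : HasTruncatedMoment F lam r) : HasTruncatedMoment F lam (q + r) := by
  obtain ⟨K, hK⟩ := hq
  obtain ⟨L, hL⟩ := hr
  refine ⟨K + L, fun R hR => ?_⟩
  filter_upwards [hK R hR, hL R hR] with j h1 h2
  simp only [truncEval_add, Polynomial.eval_add]
  rw [mean_add, integral_semicircle_add q.continuous r.continuous, add_div]
  refine le_trans (le_of_eq ?_) ((abs_add_le _ _).trans (add_le_add h1 h2))
  congr 1; ring

theorem HasTruncatedMoment.C_mul {q : Polynomial ℝ} (hq : HasTruncatedMoment F lam q) (c : ℝ) :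
    HasTruncatedMoment F lam (Polynomial.C c * q) := by
  obtain ⟨K, hK⟩ := hq
  refine ⟨|c| * K, fun R hR => ?_⟩
  filter_upwards [hK R hR] with j h1
  simp only [truncEval_C_mul, Polynomial.eval_mul, Polynomial.eval_C]
  rw [mean_const_mul, integral_semicircle_const_mul, ← mul_sub, abs_mul, mul_div_assoc]
  gcongr

/-- The products `X ^ k * S_s` have truncated moments by induction on `k`, since the recursion writes
`X * S_s` as `S_{s+1} + S_{s-1}`. -/
theorem hasTruncatedMoment (hn : ∀ j, 0 < n j)
    (hw0 : ∀ j i, w j 0 i = 1) (hw1 : ∀ j i, w j 1 i = lam j i)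
    (hsum : ∀ j s, 1 ≤ s → ∑ i, w j s i = 0)
    (hC : ∀ s, ∀ᶠ j in F, mean (fun i => ‖w j s i‖ ^ 2) ≤ C s)
    (hrec : ∀ s, Tendsto (fun j => mean fun i => ‖lam j i * w j (s + 1) i - w j (s + 2) i - w j s i‖)
      F (𝓝 0)) (q : Polynomial ℝ) : HasTruncatedMoment F lam q := by
  have hS : ∀ s : ℕ, HasTruncatedMoment F lam (Polynomial.Chebyshev.S ℝ s) := by
    intro s
    rcases Nat.eq_zero_or_pos s with rfl | hs
    · refine ⟨C 1, fun R hR => ?_⟩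
      filter_upwards [hC 1] with j h1
      have h2 : mean (fun i => lam j i ^ 2) ≤ C 1 := by
        simpa [hw1] using h1
      rw [integral_S_semicircle, if_pos rfl, ← mean_const (hn j) (1 : ℝ), abs_sub_comm]
      refine le_trans (le_of_eq ?_) (mean_far_le hR h2)
      rw [← abs_of_nonneg (mean_nonneg fun i => by split_ifs <;> positivity :
        0 ≤ mean (fun i => if |lam j i| ≤ R then (0 : ℝ) else 1)), sub_eq_iff_eq_add.2]
      rw [← mean_add]
      congr 1
      ext i
      simp only [truncEval]
      split_ifs <;> simp
    · refine ⟨C 1 + C s + 1, fun R hR => ?_⟩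
      rw [integral_S_semicircle, if_neg (by omega)]
      simp only [sub_zero]
      exact eventually_abs_mean_trunc_S_le hw0 hw1 hsum hC hrec s hs (by linarith)
  have hXS : ∀ k s : ℕ, HasTruncatedMoment F lam (Polynomial.X ^ k * Polynomial.Chebyshev.S ℝ s) := by
    intro k
    induction k with
    | zero => simpa using hS
    | succ k ih =>
      intro s
      rcases s with _ | s
      · have := ih 1
        rw [Nat.cast_one, Polynomial.Chebyshev.S_one] at this
        simpa [pow_succ] using this
      · have e : Polynomial.X ^ (k + 1) * Polynomial.Chebyshev.S ℝ ((s + 1 : ℕ) : ℤ)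
            = Polynomial.X ^ k * Polynomial.Chebyshev.S ℝ ((s + 2 : ℕ) : ℤ)
              + Polynomial.X ^ k * Polynomial.Chebyshev.S ℝ (s : ℤ) := by
          push_cast
          rw [Polynomial.Chebyshev.S_add_two]
          ring
        rw [e]
        exact (ih (s + 2)).add (ih s)
  induction q using Polynomial.induction_on' with
  | add p q hp hq => exact hp.add hq
  | monomial k a =>
    have := (hXS k 0).C_mul a
    rwa [Nat.cast_zero, Polynomial.Chebyshev.S_zero, mul_one, Polynomial.C_mul_X_pow_eq_monomial]
      at this

end

theorem exists_abs_eval_le_mul_pow (q : Polynomial ℝ) :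
    ∃ (c : ℝ) (k : ℕ), 0 ≤ c ∧ ∀ x : ℝ, 1 ≤ |x| → |q.eval x| ≤ c * x ^ (2 * k) := by
  refine ⟨∑ i ∈ Finset.range (q.natDegree + 1), |q.coeff i|, q.natDegree,
    Finset.sum_nonneg fun _ _ => abs_nonneg _, fun x hx => ?_⟩
  rw [Polynomial.eval_eq_sum_range, Finset.sum_mul]
  refine (Finset.abs_sum_le_sum_abs _ _).trans (Finset.sum_le_sum fun i hi => ?_)
  rw [abs_mul, abs_pow]
  refine mul_le_mul_of_nonneg_left ?_ (abs_nonneg _)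
  rw [← Even.pow_abs (even_two_mul _)]
  exact pow_le_pow_right₀ hx (by have := Finset.mem_range.1 hi; omega)

/-- Weak convergence to the semicircle law from convergence of the truncated moments. -/
theorem tendsto_mean_of_hasTruncatedMoment {J : Type*} {F : Filter J} {n : J → ℕ}
    {lam : ∀ j, Fin (n j) → ℝ} (hn : ∀ j, 0 < n j)
    (hmom : ∀ q, HasTruncatedMoment F lam q) {B : ℝ}
    (hB : ∀ᶠ j in F, mean (fun i => lam j i ^ 2) ≤ B) (f : ℝ →ᵇ ℝ) {η : ℝ} (hη : 0 < η) :
    ∀ᶠ j in F, |(mean fun i => f (lam j i)) - ∫ x, f x ∂semicircle| < η := by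
  obtain ⟨q, hq⟩ := exists_polynomial_near_of_continuousOn (-3) 3 f f.continuous.continuousOn
    (η / 5) (by positivity)
  obtain ⟨c₀, k₀, hc₀, hqk⟩ := exists_abs_eval_le_mul_pow q
  set M := ‖f‖ with hM
  have hfM : ∀ x, |f x| ≤ M := fun x => f.norm_coe_le_norm x
  have hM0 : 0 ≤ M := norm_nonneg f
  set c := c₀ + M with hc
  have hc0 : 0 ≤ c := by positivity
  -- the exponent is so large that the moments between `3` and the truncation are negligible
  obtain ⟨m, hm⟩ : ∃ m : ℕ, c * 4 ^ k₀ * (4 / 9 : ℝ) ^ m < η / 5 := by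
    have : Tendsto (fun m : ℕ => c * 4 ^ k₀ * (4 / 9 : ℝ) ^ m) atTop (𝓝 (c * 4 ^ k₀ * 0)) :=
      (tendsto_pow_atTop_nhds_zero_of_lt_one (by norm_num) (by norm_num)).const_mul _
    rw [mul_zero] at this
    exact (this.eventually_lt_const (by positivity)).exists
  obtain ⟨K₁, hK₁⟩ := hmom (Polynomial.X ^ (2 * (k₀ + m)))
  obtain ⟨K₂, hK₂⟩ := hmom q
  obtain ⟨R, hR3, hR⟩ : ∃ R : ℝ, 3 ≤ R ∧ (c * K₁ / 9 ^ m + M * B + K₂) / R < η / 5 := by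
    have : Tendsto (fun R : ℝ => (c * K₁ / 9 ^ m + M * B + K₂) / R) atTop (𝓝 0) :=
      tendsto_const_nhds.div_atTop tendsto_id
    obtain ⟨R, h1, h2⟩ := ((eventually_ge_atTop 3).and
      (this.eventually_lt_const (show 0 < η / 5 by positivity))).exists
    exact ⟨R, h1, h2⟩
  have hR0 : 0 < R := by linarith
  filter_upwards [hK₁ R (by linarith), hK₂ R (by linarith), hB] with j h1 h2 hB
  have hmom1 : (∫ x, (Polynomial.X ^ (2 * (k₀ + m)) : Polynomial ℝ).eval x ∂semicircle)
      ≤ 4 ^ (k₀ + m) := by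
    refine (le_abs_self _).trans (abs_integral_semicircle_le (Polynomial.continuous _)
      fun x hx => ?_)
    rw [Polynomial.eval_pow, Polynomial.eval_X, abs_pow, pow_mul,
      show (4 : ℝ) = 2 ^ 2 by norm_num]
    gcongr
    exact abs_le.2 hx
  have hfar := mean_far_le (R := R) (by linarith) hB
  have hpt : ∀ i, |f (lam j i) - truncEval R q (lam j i)| ≤ η / 5
      + (c / 9 ^ m * truncEval R (Polynomial.X ^ (2 * (k₀ + m))) (lam j i)
      + M * if |lam j i| ≤ R then 0 else 1) := by
    intro i
    set x := lam j i
    unfold truncEval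
    by_cases hx3 : |x| ≤ 3
    · rw [if_pos (hx3.trans hR3), if_pos (hx3.trans hR3), if_pos (hx3.trans hR3), abs_sub_comm]
      refine (hq x (abs_le.1 hx3)).le.trans (le_add_of_nonneg_right ?_)
      have : 0 ≤ x ^ (2 * (k₀ + m)) := Even.pow_nonneg (even_two_mul _) x
      simp only [Polynomial.eval_pow, Polynomial.eval_X, mul_zero, add_zero]
      positivity
    · by_cases hxR : |x| ≤ R
      · rw [if_pos hxR, if_pos hxR, if_pos hxR]
        have hx1 : 1 ≤ |x| := by linarith [not_le.1 hx3]
        have hp : 1 ≤ x ^ (2 * k₀) := by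
          rw [← Even.pow_abs (even_two_mul _)]; exact one_le_pow₀ hx1
        have h9 : (9 : ℝ) ^ m ≤ x ^ (2 * m) := by
          rw [pow_mul, ← sq_abs]
          gcongr
          nlinarith [not_le.1 hx3]
        simp only [Polynomial.eval_pow, Polynomial.eval_X, mul_zero, add_zero]
        calc |f x - q.eval x| ≤ |f x| + |q.eval x| := abs_sub _ _
          _ ≤ M * x ^ (2 * k₀) + c₀ * x ^ (2 * k₀) := by
              refine add_le_add ((hfM x).trans (le_mul_of_one_le_right hM0 hp)) (hqk x hx1)
          _ = c / 9 ^ m * (x ^ (2 * k₀) * 9 ^ m) := by rw [hc]; field_simp; ring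
          _ ≤ c / 9 ^ m * (x ^ (2 * k₀) * x ^ (2 * m)) := by gcongr
          _ = c / 9 ^ m * x ^ (2 * (k₀ + m)) := by rw [mul_add, pow_add]
          _ ≤ _ := by linarith
      · rw [if_neg hxR, if_neg hxR, if_neg hxR]
        have := hfM x
        simp only [sub_zero, mul_zero, zero_add, mul_one]
        linarith
  have hmean : |(mean fun i => f (lam j i)) - mean fun i => truncEval R q (lam j i)|
      ≤ η / 5 + (c / 9 ^ m * (4 ^ (k₀ + m) + K₁ / R) + M * (B / R)) := by
    have e : (mean fun i => f (lam j i)) - (mean fun i => truncEval R q (lam j i))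
        = mean fun i => (f (lam j i) - truncEval R q (lam j i)) := by
      simp [mean, Finset.sum_sub_distrib, sub_div]
    rw [e]
    refine (abs_mean_le _).trans ((mean_mono hpt).trans ?_)
    rw [mean_add, mean_add, mean_const (hn j), mean_const_mul, mean_const_mul]
    have := (abs_le.1 h1).2
    gcongr
    linarith
  have hqf : |(∫ x, q.eval x ∂semicircle) - ∫ x, f x ∂semicircle| ≤ η / 5 := by
    have e : (∫ x, q.eval x ∂semicircle) - ∫ x, f x ∂semicircle
        = ∫ x, (q.eval x + (-1) * f x) ∂semicircle := by
      rw [integral_semicircle_add q.continuous (by fun_prop), integral_semicircle_const_mul]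
      ring
    rw [e]
    refine abs_integral_semicircle_le (by fun_prop) fun x hx => ?_
    have := hq x ⟨by linarith [hx.1], by linarith [hx.2]⟩
    rw [neg_one_mul, ← sub_eq_add_neg]
    exact this.le
  have e1 : c / 9 ^ m * (4 ^ (k₀ + m) + K₁ / R) = c * 4 ^ k₀ * (4 / 9 : ℝ) ^ m
      + c * K₁ / 9 ^ m / R := by
    rw [div_pow, pow_add]; field_simp
  have e2 : (c * K₁ / 9 ^ m + M * B + K₂) / R = c * K₁ / 9 ^ m / R + M * (B / R) + K₂ / R := by
    ring
  rw [e1] at hmean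
  rw [e2] at hR
  have t := abs_le.1 hmean
  have t2 := abs_le.1 h2
  have t3 := abs_le.1 hqf
  rw [abs_lt]
  constructor <;> linarith [t.1, t.2, t2.1, t2.2, t3.1, t3.2]

/-- A quantitative criterion for closeness to the semicircle law: it suffices that weights `w s`
with vanishing averages and bounded second moments approximately satisfy the three-term recursion
of the Chebyshev polynomials `S_s`. -/
theorem exists_forall_abs_mean_sub_lt (C : ℕ → ℝ) (f : ℝ →ᵇ ℝ) {η : ℝ} (hη : 0 < η) :
    ∃ (δ : ℝ) (K : ℕ), 0 < δ ∧ ∀ (n : ℕ) (lam : Fin n → ℝ) (w : ℕ → Fin n → ℂ), 0 < n →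
      (∀ i, w 0 i = 1) → (∀ i, w 1 i = lam i) → (∀ s, 1 ≤ s → ∑ i, w s i = 0) →
      (∀ s ≤ K, mean (fun i => ‖w s i‖ ^ 2) ≤ C s) →
      (∀ s ≤ K, (mean fun i => ‖lam i * w (s + 1) i - w (s + 2) i - w s i‖) ≤ δ) →
      |(mean fun i => f (lam i)) - ∫ x, f x ∂semicircle| < η := by
  by_contra! H
  choose n lam w hn hw0 hw1 hsum hC hrec hbad using
    fun k : ℕ => H (1 / ((k : ℝ) + 1)) k (by positivity)
  have hC' : ∀ s, ∀ᶠ j in atTop, mean (fun i => ‖w j s i‖ ^ 2) ≤ C s := fun s => by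
    filter_upwards [eventually_ge_atTop s] with j hj using hC j s hj
  have hrec' : ∀ s, Tendsto
      (fun j => mean fun i => ‖lam j i * w j (s + 1) i - w j (s + 2) i - w j s i‖) atTop (𝓝 0) := by
    intro s
    refine squeeze_zero' (Eventually.of_forall fun j => mean_nonneg fun i => norm_nonneg _) ?_
      tendsto_one_div_add_atTop_nhds_zero_nat
    filter_upwards [eventually_ge_atTop s] with j hj using hrec j s hj
  have hB : ∀ᶠ j in atTop, mean (fun i => lam j i ^ 2) ≤ C 1 := by
    filter_upwards [hC' 1] with j hj
    simpa [hw1] using hj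
  obtain ⟨j, hj⟩ := (tendsto_mean_of_hasTruncatedMoment hn
    (hasTruncatedMoment hn hw0 hw1 hsum hC' hrec') hB f hη).exists
  exact absurd (hbad j) (not_le.2 hj)

/-! ### Multigraphs and averages over injective labellings -/

/-- The properties of the Gram kernel `K` of an incoherent dictionary `D` in dimension `p`
that matter here: unit vectors, coherence, and the tight frame identity. -/
structure IsIncoherentFrame {ι : Type*} (D : Finset ι) (K : ι → ι → ℂ) (p μ : ℝ) : Prop where
  self : ∀ a ∈ D, K a a = 1
  conj_symm : ∀ a b, (starRingEnd ℂ) (K a b) = K b a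
  norm_le : ∀ a ∈ D, ∀ b ∈ D, a ≠ b → ‖K a b‖ ≤ μ / √p
  sum_mul : ∀ a ∈ D, ∀ b ∈ D, ∑ c ∈ D, K a c * K c b = (D.card / p : ℝ) * K a b

section Multigraph

variable {V E : Type*}

/-- The directed multigraph with edges `s e → t e` has as many edges out of any vertex as into it;
stated by pairing with arbitrary functions on the vertices. -/
def IsBalanced [Fintype E] (s t : E → V) : Prop := ∀ g : V → ℤ, ∑ e, g (s e) = ∑ e, g (t e)

/-- The edges of the multigraph `s e → t e` belong to one connected component: a property of the
vertices that does not change along edges holds at all edges or at none. -/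
def IsEdgeConnected (s t : E → V) : Prop :=
  ∀ X : V → Prop, (∀ e, X (s e) ↔ X (t e)) → ∀ e e', X (s e) ↔ X (s e')

/-- A certificate that the multigraph `s e → t e` is not a tree with doubled edges: a nonempty set
of vertices none of which is, even within the set, the end of a pendant doubled edge. Each vertex
of the set has two edges out, or two edges in, or comes from and goes to different vertices. -/
def HasCore (s t : E → V) : Prop :=
  ∃ C : Set V, C.Nonempty ∧ ∀ u ∈ C, ∃ e e', s e ∈ C ∧ t e ∈ C ∧ s e' ∈ C ∧ t e' ∈ C ∧
    s e ≠ t e ∧ s e' ≠ t e' ∧ ((e ≠ e' ∧ s e = u ∧ s e' = u) ∨ (e ≠ e' ∧ t e = u ∧ t e' = u) ∨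
      (t e = u ∧ s e' = u ∧ s e ≠ t e'))

theorem IsBalanced.comp [Fintype E] {s t : E → V} (h : IsBalanced s t) {V' : Type*} (m : V → V') :
    IsBalanced (m ∘ s) (m ∘ t) := fun g => h (g ∘ m)

theorem IsEdgeConnected.comp {s t : E → V} (h : IsEdgeConnected s t) {V' : Type*} (m : V → V') :
    IsEdgeConnected (m ∘ s) (m ∘ t) := fun X hX => h (X ∘ m) hX

theorem IsBalanced.range_eq [Fintype E] {s t : E → V} (h : IsBalanced s t) : Set.range t = Set.range s := by
  classical
  ext i
  have := h fun k => if k = i then 1 else 0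
  simp only [Finset.sum_boole, Nat.cast_inj] at this
  constructor
  · rintro ⟨e, he⟩
    have : 0 < (Finset.univ.filter fun e => s e = i).card := by
      rw [this]; exact Finset.card_pos.2 ⟨e, by simpa using he⟩
    obtain ⟨e', he'⟩ := Finset.card_pos.1 this
    exact ⟨e', by simpa using he'⟩
  · rintro ⟨e, he⟩
    have : 0 < (Finset.univ.filter fun e => t e = i).card := by
      rw [← this]; exact Finset.card_pos.2 ⟨e, by simpa using he⟩
    obtain ⟨e', he'⟩ := Finset.card_pos.1 this
    exact ⟨e', by simpa using he'⟩

open Classical in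
theorem image_update_id_comp [Fintype E] {s : E → V} {i j : V}
    (hj : j ∈ (Finset.univ.image s).erase i) :
    Finset.univ.image (Function.update id i j ∘ s) = (Finset.univ.image s).erase i := by
  obtain ⟨hji, hj⟩ := Finset.mem_erase.1 hj
  ext k
  simp only [Finset.mem_image, Finset.mem_univ, true_and, Function.comp, Finset.mem_erase]
  constructor
  · rintro ⟨e, rfl⟩
    by_cases he : s e = i
    · rw [he, Function.update_self]
      exact ⟨hji, by simpa using hj⟩
    · rw [Function.update_of_ne he]; exact ⟨he, e, rfl⟩
  · rintro ⟨he, e, rfl⟩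
    exact ⟨e, by rw [Function.update_of_ne he]; rfl⟩

open Classical in
/-- The number of edges that are not loops. -/
noncomputable def properEdges [Fintype E] (s t : E → V) : ℕ := (Finset.univ.filter fun e => s e ≠ t e).card

variable {ι : Type*} [Fintype V] [Fintype E]

open Classical in
/-- The average, over all maps `x` from the vertices to `D`, of the product of the kernel over the
edges, restricted to the `x` that are injective on the vertices of edges. -/
noncomputable def injAvg (D : Finset ι) (K : ι → ι → ℂ) (s t : E → V) : ℂ :=
  (∑ x ∈ Fintype.piFinset fun _ : V => D,
    if Set.InjOn x (Set.range s) then ∏ e, K (x (s e)) (x (t e)) else 0) /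
      (D.card : ℂ) ^ Fintype.card V

open Classical in
theorem sum_piFinset_update (D : Finset ι) (i : V) (G : (V → ι) → ℂ) :
    ∑ x ∈ Fintype.piFinset fun _ : V => D, ∑ φ ∈ D, G (Function.update x i φ)
      = D.card * ∑ x ∈ Fintype.piFinset fun _ : V => D, G x := by
  have h : ∑ x ∈ Fintype.piFinset fun _ : V => D, ∑ φ ∈ D, G (Function.update x i φ)
      = ∑ x ∈ Fintype.piFinset fun _ : V => D, ∑ φ ∈ D, G x := by
    rw [← Finset.sum_product', ← Finset.sum_product']
    refine Finset.sum_nbij' (fun y => (Function.update y.1 i y.2, y.1 i))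
      (fun y => (Function.update y.1 i y.2, y.1 i)) ?_ ?_ ?_ ?_ ?_
    · rintro ⟨x, φ⟩ h
      simp only [Finset.mem_product, Fintype.mem_piFinset] at h ⊢
      refine ⟨fun k => ?_, h.1 i⟩
      by_cases hk : k = i
      · subst hk; simpa using h.2
      · simpa [Function.update_of_ne hk] using h.1 k
    · rintro ⟨x, φ⟩ h
      simp only [Finset.mem_product, Fintype.mem_piFinset] at h ⊢
      refine ⟨fun k => ?_, h.1 i⟩
      by_cases hk : k = i
      · subst hk; simpa using h.2
      · simpa [Function.update_of_ne hk] using h.1 k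
    · rintro ⟨x, φ⟩ _; simp
    · rintro ⟨x, φ⟩ _; simp
    · rintro ⟨x, φ⟩ _; simp
  rw [h]
  simp [Finset.mul_sum]

/-- The trivial bound: coherence applied to each edge. -/
theorem norm_injAvg_le_pow {D : Finset ι} {K : ι → ι → ℂ} {p μ : ℝ}
    (hK : IsIncoherentFrame D K p μ) (hμ : 0 ≤ μ) {s t : E → V}
    (hb : IsBalanced s t) : ‖injAvg D K s t‖ ≤ (μ / √p) ^ properEdges s t := by
  classical
  unfold injAvg
  rw [norm_div, norm_pow, Complex.norm_natCast]
  have hR : 0 ≤ (μ / √p) ^ properEdges s t := by positivity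
  refine div_le_of_le_mul₀ (by positivity) hR ?_
  have : ((Fintype.piFinset fun _ : V => D).card : ℝ) = (D.card : ℝ) ^ Fintype.card V := by
    simp [Fintype.card_piFinset]
  rw [← this, mul_comm, ← nsmul_eq_mul]
  refine (norm_sum_le _ _).trans (Finset.sum_le_card_nsmul _ _ _ fun x hx => ?_)
  rw [Fintype.mem_piFinset] at hx
  split_ifs with hinj
  · rw [norm_prod, properEdges, Finset.card_filter, ← Finset.prod_pow_eq_pow_sum]
    refine Finset.prod_le_prod (fun _ _ => norm_nonneg _) fun e _ => ?_
    split_ifs with he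
    · rw [pow_one]
      refine hK.norm_le _ (hx _) _ (hx _) fun h => he (hinj ⟨e, rfl⟩ ?_ h)
      rw [← hb.range_eq]; exact ⟨e, rfl⟩
    · rw [not_not.1 he, hK.self _ (hx _)]; simp
  · simpa using hR

open Classical in
/-- Integrating out a vertex `i` that is visited once, on the way from `a = s e₁` to `b = t e₂`:
by the frame identity the sum over the free position of `i` amounts to gluing `i` to `b`, and
the positions excluded by injectivity amount to gluing `i` to the other vertices. -/
theorem injAvg_eq_of_visited_once {D : Finset ι} {K : ι → ι → ℂ} {p μ : ℝ}
    (hK : IsIncoherentFrame D K p μ) (hD : D.Nonempty) {s t : E → V} (hb : IsBalanced s t) {i : V}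
    {e₁ e₂ : E} (h1 : t e₁ = i) (h1' : s e₁ ≠ i) (h2 : s e₂ = i) (h2' : t e₂ ≠ i)
    (hother : ∀ e, e ≠ e₁ → e ≠ e₂ → (s e = i ↔ t e = i)) :
    injAvg D K s t = (1 / p : ℝ) * injAvg D K (Function.update id i (t e₂) ∘ s)
        (Function.update id i (t e₂) ∘ t)
      - (1 / D.card : ℝ) * ∑ j ∈ (Finset.univ.image s).erase i,
        injAvg D K (Function.update id i j ∘ s) (Function.update id i j ∘ t) := by
  set W := (Finset.univ.image s).erase i with hW
  set Pr : (V → ι) → ℂ := fun x => ∏ e, K (x (s e)) (x (t e)) with hPr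
  have hne : e₁ ≠ e₂ := fun h => h1' (h ▸ h2)
  have hbW : t e₂ ∈ W := by
    have : t e₂ ∈ Set.range s := by rw [← hb.range_eq]; exact ⟨e₂, rfl⟩
    obtain ⟨e, he⟩ := this
    exact Finset.mem_erase.2 ⟨h2', Finset.mem_image.2 ⟨e, Finset.mem_univ _, he⟩⟩
  have hN : (D.card : ℂ) ≠ 0 := by exact_mod_cast hD.card_pos.ne'
  -- the product splits off the two edges at `i`
  have hprod : ∀ x ∈ Fintype.piFinset fun _ : V => D, ∃ rest : ℂ, ∀ φ ∈ D,
      Pr (Function.update x i φ) = rest * (K (x (s e₁)) φ * K φ (x (t e₂))) := by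
    intro x hx
    refine ⟨∏ e ∈ (Finset.univ.erase e₁).erase e₂, if s e = i then 1 else K (x (s e)) (x (t e)),
      fun φ hφ => ?_⟩
    rw [hPr]
    simp only
    rw [← Finset.mul_prod_erase Finset.univ _ (Finset.mem_univ e₁),
      ← Finset.mul_prod_erase (Finset.univ.erase e₁) _
        (Finset.mem_erase.2 ⟨hne.symm, Finset.mem_univ e₂⟩), ← mul_assoc, mul_comm]
    congr 1
    · refine Finset.prod_congr rfl fun e he => ?_
      simp only [Finset.mem_erase, Finset.mem_univ, and_true] at he
      have := hother e he.2 he.1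
      split_ifs with hs
      · rw [hs, this.1 hs]; simp [hK.self φ hφ]
      · rw [Function.update_of_ne hs, Function.update_of_ne (fun h => hs (this.2 h))]
    · rw [h1, h2, Function.update_self, Function.update_of_ne h1', Function.update_of_ne h2']
  have hglue : ∀ (x : V → ι) (j : V), Function.update x i (x j) = x ∘ Function.update id i j := by
    intro x j; ext k
    by_cases hk : k = i
    · subst hk; simp
    · simp [Function.update_of_ne hk]
  have hrange : ∀ j ∈ W, Set.range (Function.update id i j ∘ s) = (W : Set V) := by
    intro j hj
    rw [hW, ← image_update_id_comp hj, Finset.coe_image, Finset.coe_univ, Set.image_univ]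
  have hinj : ∀ (x : V → ι) (φ : ι), Set.InjOn (Function.update x i φ) (Set.range s) ↔
      Set.InjOn x (W : Set V) ∧ ∀ j ∈ W, x j ≠ φ := by
    intro x φ
    have hr : Set.range s = insert i (W : Set V) := by
      rw [hW, Finset.coe_erase, Set.insert_sdiff_singleton]
      simp [Set.insert_eq_of_mem (show i ∈ Set.range s from ⟨e₂, h2⟩)]
    have hi : i ∉ (W : Set V) := by simp [hW]
    have hEq : Set.EqOn (Function.update x i φ) x (W : Set V) := fun k hk =>
      Function.update_of_ne (fun (h : k = i) => hi (h ▸ hk)) _ _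
    rw [hr, Set.injOn_insert hi, hEq.injOn_iff, hEq.image_eq, Function.update_self]
    simp
  have hsum : ∀ x ∈ Fintype.piFinset fun _ : V => D,
      ∑ φ ∈ D, (if Set.InjOn (Function.update x i φ) (Set.range s)
        then Pr (Function.update x i φ) else 0)
      = (D.card / p : ℝ) * (if Set.InjOn x (W : Set V)
          then Pr (x ∘ Function.update id i (t e₂)) else 0)
        - ∑ j ∈ W, if Set.InjOn x (W : Set V) then Pr (x ∘ Function.update id i j) else 0 := by
    intro x hx
    have hxD := Fintype.mem_piFinset.1 hx
    simp_rw [hinj]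
    by_cases hxW : Set.InjOn x (W : Set V)
    · simp only [hxW, true_and, if_true]
      obtain ⟨rest, hrest⟩ := hprod x hx
      have t1 : ∑ φ ∈ D, Pr (Function.update x i φ)
          = (D.card / p : ℝ) * Pr (x ∘ Function.update id i (t e₂)) := by
        rw [← hglue, hrest _ (hxD _), hK.self _ (hxD _), mul_one, Finset.sum_congr rfl hrest,
          ← Finset.mul_sum, hK.sum_mul _ (hxD _) _ (hxD _)]
        ring
      have t2 : ∑ φ ∈ D with ¬ ∀ j ∈ W, x j ≠ φ, Pr (Function.update x i φ)
          = ∑ j ∈ W, Pr (x ∘ Function.update id i j) := by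
        have : D.filter (fun φ => ¬ ∀ j ∈ W, x j ≠ φ) = W.image x := by
          ext φ
          simp only [Finset.mem_filter, Finset.mem_image]
          push Not
          exact ⟨fun h => h.2, fun ⟨j, hj, h⟩ => ⟨h ▸ hxD j, j, hj, h⟩⟩
        rw [this, Finset.sum_image hxW]
        exact Finset.sum_congr rfl fun j _ => by rw [hglue]
      rw [← t1, ← t2, eq_sub_iff_add_eq, ← Finset.sum_filter,
        Finset.sum_filter_add_sum_filter_not]
    · simp [hxW]
  have hG := sum_piFinset_update D i fun x => if Set.InjOn x (Set.range s) then Pr x else 0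
  rw [Finset.sum_congr rfl hsum, Finset.sum_sub_distrib, ← Finset.mul_sum, Finset.sum_comm] at hG
  have hT : ∀ j ∈ W, injAvg D K (Function.update id i j ∘ s) (Function.update id i j ∘ t)
      = (∑ x ∈ Fintype.piFinset fun _ : V => D,
        if Set.InjOn x (W : Set V) then Pr (x ∘ Function.update id i j) else 0) /
          (D.card : ℂ) ^ Fintype.card V := by
    intro j hj
    simp only [injAvg, hrange j hj]
    rfl
  rw [hT _ hbW, Finset.sum_congr rfl hT, ← Finset.sum_div, injAvg]
  change (∑ x ∈ Fintype.piFinset fun _ : V => D,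
    if Set.InjOn x (Set.range s) then Pr x else 0) / _ = _
  rw [eq_comm, ← mul_div_assoc, ← mul_div_assoc, ← sub_div]
  congr 1
  rw [← mul_right_inj' hN, ← hG]
  push_cast
  field_simp

end Multigraph

/-! ### The fundamental estimate for injective averages -/

section Multigraph

variable {V E ι : Type*}

open Classical in
/-- Removing a pendant doubled edge `a → i → a` keeps a core. -/
theorem HasCore.update_of_pendant {s t : E → V} (h : HasCore s t) {i : V} {e₁ e₂ : E}
    (h1' : s e₁ ≠ i) (h2' : t e₂ ≠ i)
    (hother : ∀ e, e ≠ e₁ → e ≠ e₂ → (s e = i ↔ t e = i)) (hab : s e₁ = t e₂) :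
    HasCore (Function.update id i (t e₂) ∘ s) (Function.update id i (t e₂) ∘ t) := by
  obtain ⟨C, hC, hcore⟩ := h
  have out : ∀ e, s e = i → s e ≠ t e → e = e₂ := by
    intro e he hne
    by_contra h2
    by_cases h1 : e = e₁
    · exact h1' (h1 ▸ he)
    · exact hne (he.trans ((hother e h1 h2).1 he).symm)
  have inn : ∀ e, t e = i → s e ≠ t e → e = e₁ := by
    intro e he hne
    by_contra h1
    by_cases h2 : e = e₂
    · exact h2' (h2 ▸ he)
    · exact hne (((hother e h1 h2).2 he).trans he.symm)
  have hiC : i ∉ C := by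
    intro hi
    obtain ⟨e, e', -, -, -, -, n, n', h⟩ := hcore i hi
    rcases h with ⟨hne, a, b⟩ | ⟨hne, a, b⟩ | ⟨a, b, hne⟩
    · exact hne ((out e a n).trans (out e' b n').symm)
    · exact hne ((inn e a n).trans (inn e' b n').symm)
    · rw [inn e a n, out e' b n'] at hne
      exact hne hab
  have key : ∀ {k}, k ∈ C → Function.update id i (t e₂) k = k := fun {k} hk =>
    Function.update_of_ne (fun h : k = i => hiC (h ▸ hk)) _ _
  refine ⟨C, hC, fun u hu => ?_⟩
  obtain ⟨e, e', a, b, c, d, n, n', h⟩ := hcore u hu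
  exact ⟨e, e', by simpa only [Function.comp, key a, key b, key c, key d] using ⟨a, b, c, d, n, n', h⟩⟩

variable [Fintype E]

open Classical in
theorem properEdges_le_add {V' : Type*} {s t : E → V} {s' t' : E → V'} (A : Finset E)
    (h : ∀ e ∉ A, s e ≠ t e → s' e ≠ t' e) :
    properEdges s t ≤ properEdges s' t' + A.card := by
  unfold properEdges
  refine (Finset.card_le_card fun e he => ?_).trans (Finset.card_union_le _ A)
  simp only [Finset.mem_union, Finset.mem_filter, Finset.mem_univ, true_and] at he ⊢
  by_cases hA : e ∈ A
  · exact Or.inr hA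
  · exact Or.inl (h e hA he)

open Classical in
theorem IsBalanced.card_out_eq_card_in {s t : E → V} (hb : IsBalanced s t) (i : V) :
    (Finset.univ.filter fun e => s e = i ∧ t e ≠ i).card
      = (Finset.univ.filter fun e => t e = i ∧ s e ≠ i).card := by
  have h := hb fun k => if k = i then 1 else 0
  simp only [Finset.sum_boole, Nat.cast_inj] at h
  have h1 := Finset.card_filter_add_card_filter_not (s := Finset.univ.filter fun e => s e = i)
    (fun e => t e = i)
  have h2 := Finset.card_filter_add_card_filter_not (s := Finset.univ.filter fun e => t e = i)
    (fun e => s e = i)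
  simp only [Finset.filter_filter] at h1 h2
  have h3 : (Finset.univ.filter fun e => s e = i ∧ t e = i)
      = Finset.univ.filter fun e => t e = i ∧ s e = i := by
    ext e; simp [and_comm]
  rw [h3] at h1
  simp only [ne_eq]
  omega

open Classical in
theorem IsEdgeConnected.eq_of_card_out_eq_zero {s t : E → V} (hc : IsEdgeConnected s t)
    (hb : IsBalanced s t) {i : V} (hi : i ∈ Set.range s)
    (h0 : (Finset.univ.filter fun e => s e = i ∧ t e ≠ i).card = 0) (e : E) : s e = i := by
  have h0' := h0
  rw [hb.card_out_eq_card_in i] at h0'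
  rw [Finset.card_eq_zero, Finset.filter_eq_empty_iff] at h0 h0'
  obtain ⟨e', he'⟩ := hi
  refine (hc (fun k => k = i) (fun e => ⟨fun h => ?_, fun h => ?_⟩) e' e).1 he'
  · by_contra h'
    exact h0 (Finset.mem_univ e) ⟨h, h'⟩
  · by_contra h'
    exact h0' (Finset.mem_univ e) ⟨h, h'⟩

open Classical in
theorem sum_card_out_eq_properEdges (s t : E → V) :
    ∑ i ∈ Finset.univ.image s, (Finset.univ.filter fun e => s e = i ∧ t e ≠ i).card
      = properEdges s t := by
  unfold properEdges
  rw [Finset.card_eq_sum_card_fiberwise (f := s) (t := Finset.univ.image s)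
    (fun e _ => by simp)]
  refine Finset.sum_congr rfl fun i _ => ?_
  rw [Finset.filter_filter]
  congr 1
  ext e
  simp only [Finset.mem_filter, Finset.mem_univ, true_and]
  constructor
  · rintro ⟨rfl, h⟩; exact ⟨Ne.symm h, rfl⟩
  · rintro ⟨h, rfl⟩; exact ⟨rfl, Ne.symm h⟩

open Classical in
theorem HasCore.two_le_card_image {s t : E → V} (h : HasCore s t) (hb : IsBalanced s t) :
    2 ≤ (Finset.univ.image s).card := by
  obtain ⟨C, ⟨u, hu⟩, hcore⟩ := h
  obtain ⟨e, e', -, -, -, -, n, -, -⟩ := hcore u hu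
  obtain ⟨e'', he''⟩ : t e ∈ Set.range s := by rw [← hb.range_eq]; exact ⟨e, rfl⟩
  refine Finset.one_lt_card.2 ⟨s e, by simp, t e, ?_, n⟩
  rw [← he'']; simp

variable [Fintype V]

open Classical in
/-- The fundamental estimate. Up to a constant, the contribution of all labellings of a connected
balanced multigraph by `n` random elements of the dictionary is at most `n (n / p) ^ (q / 2)`,
where `q` is the number of its edges; and it is smaller by a factor `δ` if the multigraph has
a core. The induction integrates out the vertices visited once. What remains when there are none
is so concentrated on few vertices that coherence suffices. -/
theorem pow_mul_norm_injAvg_le {D : Finset ι} {K : ι → ι → ℂ} {p μ n δ ρ : ℝ}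
    (hK : IsIncoherentFrame D K p μ) (hμ : 0 ≤ μ) (hn : 1 ≤ n) (hnp : n ≤ p) (hpN : p ≤ D.card)
    (hρ : ρ = √n / √p) (hδρ : ρ ≤ δ) (hδN : p / D.card ≤ δ) (hδn : 1 / n ≤ δ) (hδ1 : δ ≤ 1)
    [Nonempty E]
    (v : ℕ) : ∀ (s t : E → V) (g : ℝ), IsBalanced s t → IsEdgeConnected s t →
      (Finset.univ.image s).card = v → (g = 1 ∨ (g = δ ∧ HasCore s t)) →
      n ^ v * ‖injAvg D K s t‖
        ≤ max 1 μ ^ Fintype.card E * v.factorial * g * n * ρ ^ properEdges s t := by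
  have hp0 : 0 < p := by linarith
  have hn0 : 0 < n := by linarith
  have hN0 : (0 : ℝ) < D.card := by linarith
  have hρ0 : 0 ≤ ρ := by rw [hρ]; positivity
  have hρ1 : ρ ≤ 1 := by
    rw [hρ, div_le_one (Real.sqrt_pos.2 hp0)]; exact Real.sqrt_le_sqrt hnp
  have hρ2 : ρ ^ 2 = n / p := by
    rw [hρ, div_pow, Real.sq_sqrt hn0.le, Real.sq_sqrt hp0.le]
  have hδ0 : 0 ≤ δ := hρ0.trans hδρ
  set M := max 1 μ ^ Fintype.card E with hM
  have hM1 : 1 ≤ M := one_le_pow₀ (le_max_left 1 μ)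
  have hD : D.Nonempty := by
    rw [← Finset.card_pos]; exact_mod_cast hN0
  induction v with
  | zero =>
    intro s t g _ _ hv _
    rw [Finset.card_eq_zero, Finset.image_eq_empty] at hv
    exact absurd hv Finset.univ_nonempty.ne_empty
  | succ v ih =>
    intro s t g hb hc hv hg
    have hg0 : 0 ≤ g := by rcases hg with rfl | ⟨rfl, -⟩ <;> linarith
    have hgδ : δ ≤ g := by rcases hg with rfl | ⟨rfl, -⟩ <;> linarith
    have hgn : 1 ≤ g * n := by
      rw [div_le_iff₀ hn0] at hδn
      nlinarith
    by_cases hsingle : ∃ i ∈ Finset.univ.image s,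
        (Finset.univ.filter fun e => s e = i ∧ t e ≠ i).card = 1
    · obtain ⟨i, hi, h1⟩ := hsingle
      have h1' := h1
      rw [hb.card_out_eq_card_in i] at h1'
      obtain ⟨e₂, he₂⟩ := Finset.card_eq_one.1 h1
      obtain ⟨e₁, he₁⟩ := Finset.card_eq_one.1 h1'
      have m₂ : s e₂ = i ∧ t e₂ ≠ i := by
        have : e₂ ∈ Finset.univ.filter fun e => s e = i ∧ t e ≠ i := by rw [he₂]; simp
        simpa using this
      have m₁ : t e₁ = i ∧ s e₁ ≠ i := by
        have : e₁ ∈ Finset.univ.filter fun e => t e = i ∧ s e ≠ i := by rw [he₁]; simp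
        simpa using this
      have hother : ∀ e, e ≠ e₁ → e ≠ e₂ → (s e = i ↔ t e = i) := by
        intro e n1 n2
        constructor
        · intro h
          by_contra h'
          have : e ∈ Finset.univ.filter fun e => s e = i ∧ t e ≠ i := by simp [h, h']
          rw [he₂] at this
          exact n2 (by simpa using this)
        · intro h
          by_contra h'
          have : e ∈ Finset.univ.filter fun e => t e = i ∧ s e ≠ i := by simp [h, h']
          rw [he₁] at this
          exact n1 (by simpa using this)
      have hloop : ∀ (j : V) (e : E), e ∉ ({e₁, e₂} : Finset E) → s e ≠ t e →
          (Function.update id i j ∘ s) e ≠ (Function.update id i j ∘ t) e := by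
        intro j e he hne
        simp only [Finset.mem_insert, Finset.mem_singleton, not_or] at he
        have := hother e he.1 he.2
        have hs : s e ≠ i := fun h => hne (h.trans (this.1 h).symm)
        have ht : t e ≠ i := fun h => hs (this.2 h)
        simpa [Function.update_of_ne hs, Function.update_of_ne ht] using hne
      have hcardW : ((Finset.univ.image s).erase i).card = v := by
        rw [Finset.card_erase_of_mem hi, hv]; rfl
      set B := M * v.factorial * n * ρ ^ properEdges s t with hB
      have hB0 : 0 ≤ B := by positivity
      -- each gluing costs at most two edges
      have hglue : ∀ j ∈ (Finset.univ.image s).erase i, ∀ g' : ℝ, 0 ≤ g' →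
          (g' = 1 ∨ (g' = δ ∧ HasCore (Function.update id i j ∘ s) (Function.update id i j ∘ t))) →
          ρ ^ 2 * (n ^ v * ‖injAvg D K (Function.update id i j ∘ s)
            (Function.update id i j ∘ t)‖) ≤ g' * B := by
        intro j hj g' hg'0 hg'
        have := ih _ _ g' (hb.comp (Function.update id i j)) (hc.comp (Function.update id i j))
          (by rw [image_update_id_comp hj, hcardW]) hg'
        have hq := properEdges_le_add (s := s) (t := t) {e₁, e₂} (hloop j)
        have hcard : ({e₁, e₂} : Finset E).card ≤ 2 := Finset.card_le_two
        have hpow : ρ ^ (properEdges (Function.update id i j ∘ s) (Function.update id i j ∘ t) + 2)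
            ≤ ρ ^ properEdges s t := pow_le_pow_of_le_one hρ0 hρ1 (by omega)
        calc _ ≤ ρ ^ 2 * (M * v.factorial * g' * n * ρ ^ properEdges (Function.update id i j ∘ s)
              (Function.update id i j ∘ t)) := by gcongr
          _ = g' * (M * v.factorial * n *
              ρ ^ (properEdges (Function.update id i j ∘ s) (Function.update id i j ∘ t) + 2)) := by
              rw [pow_add]; ring
          _ ≤ g' * B := by rw [hB]; gcongr
      have hbW : t e₂ ∈ (Finset.univ.image s).erase i := by
        have : t e₂ ∈ Set.range s := by rw [← hb.range_eq]; exact ⟨e₂, rfl⟩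
        obtain ⟨e, he⟩ := this
        exact Finset.mem_erase.2 ⟨m₂.2, Finset.mem_image.2 ⟨e, Finset.mem_univ _, he⟩⟩
      have hmain : ρ ^ 2 * (n ^ v * ‖injAvg D K (Function.update id i (t e₂) ∘ s)
            (Function.update id i (t e₂) ∘ t)‖) ≤ g * B := by
        by_cases hab : s e₁ = t e₂
        · exact hglue _ hbW g hg0 (hg.imp id fun h =>
            ⟨h.1, h.2.update_of_pendant m₁.2 m₂.2 hother hab⟩)
        · -- a vertex visited on the way between different vertices costs one edge only
          have := ih _ _ 1 (hb.comp (Function.update id i (t e₂)))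
            (hc.comp (Function.update id i (t e₂)))
            (by rw [image_update_id_comp hbW, hcardW]) (Or.inl rfl)
          have hq := properEdges_le_add (s := s) (t := t)
            (s' := Function.update id i (t e₂) ∘ s) (t' := Function.update id i (t e₂) ∘ t)
            {e₂} (by
              intro e he hne
              by_cases h : e = e₁
              · subst h
                simpa [m₁.1, Function.update_of_ne m₁.2] using hab
              · refine hloop _ e ?_ hne
                simp only [Finset.mem_insert, Finset.mem_singleton, not_or] at he ⊢
                exact ⟨h, he⟩)
          rw [Finset.card_singleton] at hq
          have hpow : ρ ^ (properEdges (Function.update id i (t e₂) ∘ s)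
              (Function.update id i (t e₂) ∘ t) + 1) ≤ ρ ^ properEdges s t :=
            pow_le_pow_of_le_one hρ0 hρ1 hq
          calc _ ≤ ρ ^ 2 * (M * v.factorial * 1 * n * ρ ^ properEdges
                (Function.update id i (t e₂) ∘ s) (Function.update id i (t e₂) ∘ t)) := by gcongr
            _ = ρ * (M * v.factorial * n * ρ ^ (properEdges (Function.update id i (t e₂) ∘ s)
                (Function.update id i (t e₂) ∘ t) + 1)) := by rw [pow_succ ρ (properEdges _ _)]; ring
            _ ≤ g * B := by rw [hB]; gcongr; linarith
      have hrec := injAvg_eq_of_visited_once hK hD hb m₁.1 m₁.2 m₂.1 m₂.2 hother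
      have hnorm : ‖injAvg D K s t‖ ≤ 1 / p * ‖injAvg D K (Function.update id i (t e₂) ∘ s)
            (Function.update id i (t e₂) ∘ t)‖ + 1 / D.card * ∑ j ∈ (Finset.univ.image s).erase i,
            ‖injAvg D K (Function.update id i j ∘ s) (Function.update id i j ∘ t)‖ := by
        rw [hrec]
        refine (norm_sub_le _ _).trans ?_
        rw [norm_mul, norm_mul, Complex.norm_real, Complex.norm_real,
          Real.norm_of_nonneg (by positivity), Real.norm_of_nonneg (by positivity)]
        gcongr
        exact norm_sum_le _ _
      have hsum : (p / D.card) * ∑ j ∈ (Finset.univ.image s).erase i, ρ ^ 2 * (n ^ v *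
          ‖injAvg D K (Function.update id i j ∘ s) (Function.update id i j ∘ t)‖)
          ≤ g * (v * B) := by
        have : ∑ j ∈ (Finset.univ.image s).erase i, ρ ^ 2 * (n ^ v *
          ‖injAvg D K (Function.update id i j ∘ s) (Function.update id i j ∘ t)‖) ≤ v * B := by
          refine (Finset.sum_le_card_nsmul _ _ B fun j hj => ?_).trans_eq ?_
          · simpa using hglue j hj 1 zero_le_one (Or.inl rfl)
          · rw [hcardW, nsmul_eq_mul]
        gcongr
        exact hδN.trans hgδ
      calc n ^ (v + 1) * ‖injAvg D K s t‖
          ≤ n ^ (v + 1) * (1 / p * ‖injAvg D K (Function.update id i (t e₂) ∘ s)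
            (Function.update id i (t e₂) ∘ t)‖ + 1 / D.card * ∑ j ∈ (Finset.univ.image s).erase i,
            ‖injAvg D K (Function.update id i j ∘ s) (Function.update id i j ∘ t)‖) := by gcongr
        _ = ρ ^ 2 * (n ^ v * ‖injAvg D K (Function.update id i (t e₂) ∘ s)
            (Function.update id i (t e₂) ∘ t)‖) + (p / D.card) *
            ∑ j ∈ (Finset.univ.image s).erase i, ρ ^ 2 * (n ^ v *
          ‖injAvg D K (Function.update id i j ∘ s) (Function.update id i j ∘ t)‖) := by
            rw [← Finset.mul_sum, ← Finset.mul_sum, hρ2]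
            field_simp
            ring
        _ ≤ g * B + g * (v * B) := add_le_add hmain hsum
        _ = _ := by rw [hB, Nat.factorial_succ]; push_cast; ring
    · push Not at hsingle
      have htriv := norm_injAvg_le_pow hK hμ hb
      set q := properEdges s t with hq
      have hqE : q ≤ Fintype.card E := by
        rw [hq, properEdges]; exact Finset.card_le_univ _
      have hμq : μ ^ q ≤ M := by
        calc μ ^ q ≤ max 1 μ ^ q := by gcongr; exact le_max_right 1 μ
          _ ≤ M := pow_le_pow_right₀ (le_max_left 1 μ) hqE
      have hfac : (1 : ℝ) ≤ (v + 1).factorial := by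
        exact_mod_cast Nat.succ_le_of_lt (Nat.factorial_pos _)
      have hsq : (μ / √p) ^ q * √n ^ q = μ ^ q * ρ ^ q := by
        rw [hρ, ← mul_pow, ← mul_pow]; congr 1; ring
      have hMf : 1 ≤ M * (v + 1).factorial := one_le_mul_of_one_le_of_one_le hM1 hfac
      by_cases hv1 : v = 0
      · subst hv1
        have hg1 : g = 1 := by
          rcases hg with h | ⟨-, h⟩
          · exact h
          · have := h.two_le_card_image hb
            omega
        have hq0 : q = 0 := by
          obtain ⟨u, hu⟩ := Finset.card_eq_one.1 hv
          have hall : ∀ e, s e = u := fun e => by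
            have : s e ∈ Finset.univ.image s := by simp
            rw [hu] at this; simpa using this
          have hallt : ∀ e, t e = u := fun e => by
            obtain ⟨e', he'⟩ : t e ∈ Set.range s := by rw [← hb.range_eq]; exact ⟨e, rfl⟩
            rw [← he', hall]
          rw [hq, properEdges, Finset.card_eq_zero, Finset.filter_eq_empty_iff]
          intro e _
          simp [hall, hallt]
        rw [hq0, pow_zero] at htriv
        rw [hq0, hg1, pow_zero, zero_add, pow_one]
        nlinarith
      · have hdeg : ∀ i ∈ Finset.univ.image s,
            2 ≤ (Finset.univ.filter fun e => s e = i ∧ t e ≠ i).card := by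
          intro i hi
          have h1 := hsingle i hi
          have h0 : (Finset.univ.filter fun e => s e = i ∧ t e ≠ i).card ≠ 0 := by
            intro h0
            have hall := hc.eq_of_card_out_eq_zero hb (by simpa using hi) h0
            have : Finset.univ.image s ⊆ {i} := fun k hk => by
              obtain ⟨e, -, rfl⟩ := Finset.mem_image.1 hk
              simp [hall e]
            have := Finset.card_le_card this
            rw [hv, Finset.card_singleton] at this
            omega
          omega
        have h2v : 2 * (v + 1) ≤ q := by
          rw [hq, ← sum_card_out_eq_properEdges, ← hv, mul_comm, ← smul_eq_mul]
          exact Finset.card_nsmul_le_sum _ _ _ hdeg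
        have hnq : n ^ (v + 1) ≤ √n ^ q := by
          calc n ^ (v + 1) = √n ^ (2 * (v + 1)) := by rw [pow_mul, Real.sq_sqrt hn0.le]
            _ ≤ √n ^ q := pow_le_pow_right₀ (Real.one_le_sqrt.2 hn) h2v
        calc n ^ (v + 1) * ‖injAvg D K s t‖ ≤ √n ^ q * (μ / √p) ^ q := by gcongr
          _ = μ ^ q * ρ ^ q := by rw [mul_comm, hsq]
          _ ≤ M * ρ ^ q := by gcongr
          _ ≤ M * ((v + 1).factorial * (g * n)) * ρ ^ q := by
              gcongr
              refine le_mul_of_one_le_right (by positivity) ?_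
              exact one_le_mul_of_one_le_of_one_le hfac hgn
          _ = _ := by ring

end Multigraph

/-! ### Random subsets of a finite set -/

section Sampling

variable {ι : Type*}

open Classical in
/-- The number of `n`-element subsets of `D` that contain `W`. -/
noncomputable def countSupersets (D : Finset ι) (n : ℕ) (W : Finset ι) : ℕ :=
  ((D.powersetCard n).filter fun S => W ⊆ S).card

open Classical in
theorem countSupersets_mul_choose {D W : Finset ι} {n : ℕ} (hW : W ⊆ D) :
    countSupersets D n W * D.card.choose W.card = (D.powersetCard n).card * n.choose W.card := by
  unfold countSupersets
  by_cases hWn : W.card ≤ n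
  · rw [Finset.card_filter_powersetCard_subset _ _ _ hW hWn, Finset.card_powersetCard,
      Nat.choose_mul hWn, mul_comm]
  · rw [Nat.choose_eq_zero_of_lt (not_le.1 hWn), mul_zero, Finset.filter_false_of_mem]
    · simp
    · intro S hS hWS
      exact hWn ((Finset.card_le_card hWS).trans (Finset.mem_powersetCard.1 hS).2.le)

theorem descFactorial_mul_pow_le {n N : ℕ} (h : n ≤ N) (v : ℕ) :
    n.descFactorial v * N ^ v ≤ N.descFactorial v * n ^ v := by
  induction v with
  | zero => simp
  | succ v ih =>
    rw [Nat.descFactorial_succ, Nat.descFactorial_succ, pow_succ, pow_succ]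
    have : (n - v) * N ≤ (N - v) * n := by
      rw [Nat.sub_mul, Nat.sub_mul, mul_comm n N]
      exact Nat.sub_le_sub_left (Nat.mul_le_mul_left v h) _
    calc _ = ((n - v) * N) * (n.descFactorial v * N ^ v) := by ring
      _ ≤ ((N - v) * n) * (N.descFactorial v * n ^ v) := Nat.mul_le_mul this ih
      _ = _ := by ring

theorem choose_mul_pow_le {n N : ℕ} (h : n ≤ N) (v : ℕ) :
    n.choose v * N ^ v ≤ N.choose v * n ^ v := by
  have := descFactorial_mul_pow_le h v
  rw [Nat.descFactorial_eq_factorial_mul_choose, Nat.descFactorial_eq_factorial_mul_choose,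
    mul_assoc, mul_assoc] at this
  exact Nat.le_of_mul_le_mul_left this (Nat.factorial_pos v)

/-- The probability that a random `n`-element subset contains `W` is at most `(n / |D|) ^ |W|`. -/
theorem countSupersets_mul_pow_le {D W : Finset ι} {n : ℕ} (hW : W ⊆ D) (hn : n ≤ D.card) :
    countSupersets D n W * D.card ^ W.card ≤ (D.powersetCard n).card * n ^ W.card := by
  have h1 := countSupersets_mul_choose (n := n) hW
  have h2 := choose_mul_pow_le hn W.card
  have h3 : 0 < D.card.choose W.card := Nat.choose_pos (Finset.card_le_card hW)
  refine Nat.le_of_mul_le_mul_left ?_ h3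
  calc _ = (countSupersets D n W * D.card.choose W.card) * D.card ^ W.card := by ring
    _ = (D.powersetCard n).card * (n.choose W.card * D.card ^ W.card) := by rw [h1]; ring
    _ ≤ (D.powersetCard n).card * (D.card.choose W.card * n ^ W.card) := by gcongr
    _ = _ := by ring

open Classical in
theorem sum_powersetCard_sum_piFinset {Q : Type*} [Fintype Q] (D : Finset ι) (n : ℕ)
    (c : (Q → ι) → Prop) (G : (Q → ι) → ℂ) :
    ∑ S ∈ D.powersetCard n, ∑ w ∈ (Fintype.piFinset fun _ : Q => S).filter c, G w
      = ∑ w ∈ (Fintype.piFinset fun _ : Q => D).filter c,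
        countSupersets D n (Finset.univ.image w) * G w := by
  have h : ∀ S ∈ D.powersetCard n, ∑ w ∈ (Fintype.piFinset fun _ : Q => S).filter c, G w
      = ∑ w ∈ (Fintype.piFinset fun _ : Q => D).filter c,
        if Finset.univ.image w ⊆ S then G w else 0 := by
    intro S hS
    rw [← Finset.sum_filter]
    refine Finset.sum_congr ?_ fun _ _ => rfl
    have hSD := (Finset.mem_powersetCard.1 hS).1
    ext w
    simp only [Finset.mem_filter, Fintype.mem_piFinset, Finset.image_subset_iff, Finset.mem_univ,
      true_implies]
    exact ⟨fun h => ⟨⟨fun a => hSD (h.1 a), h.2⟩, h.1⟩, fun h => ⟨h.2, h.1.2⟩⟩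
  rw [Finset.sum_congr rfl h, Finset.sum_comm]
  refine Finset.sum_congr rfl fun w _ => ?_
  rw [← Finset.sum_filter, Finset.sum_const, nsmul_eq_mul, countSupersets]

open Classical in
/-- The maps `w : Q → D` with the same coincidences as `ℓ` are the composites `x ∘ ℓ`, where `x` is
injective on the range of `ℓ`; the values of `x` outside this range are irrelevant. -/
theorem sum_injOn_comp {Q : Type*} [Fintype Q] (D : Finset ι) (ℓ : Q → Q) (G : (Q → ι) → ℂ) :
    ∑ x ∈ Fintype.piFinset (fun _ : Q => D),
      (if Set.InjOn x (Set.range ℓ) then G (x ∘ ℓ) else 0)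
      = (D.card : ℂ) ^ (Fintype.card Q - (Finset.univ.image ℓ).card) *
        ∑ w ∈ (Fintype.piFinset fun _ : Q => D).filter (fun w => ∀ a b, w a = w b ↔ ℓ a = ℓ b),
          G w := by
  rw [← Finset.sum_filter, ← Finset.sum_fiberwise_of_maps_to (g := fun x => x ∘ ℓ)
    (t := (Fintype.piFinset fun _ : Q => D).filter (fun w => ∀ a b, w a = w b ↔ ℓ a = ℓ b)),
    Finset.mul_sum]
  · refine Finset.sum_congr rfl fun w hw => ?_
    rw [Finset.mem_filter, Fintype.mem_piFinset] at hw
    have hset : ((Fintype.piFinset fun _ : Q => D).filter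
          (fun x => Set.InjOn x (Set.range ℓ))).filter (fun x => x ∘ ℓ = w)
        = Fintype.piFinset fun q : Q => if h : q ∈ Set.range ℓ then {w h.choose} else D := by
      ext x
      simp only [Finset.mem_filter, Fintype.mem_piFinset]
      constructor
      · rintro ⟨⟨hx, -⟩, rfl⟩ q
        split_ifs with h
        · rw [Finset.mem_singleton, Function.comp, h.choose_spec]
        · exact hx q
      · intro hx
        have hxw : x ∘ ℓ = w := by
          ext a
          have := hx (ℓ a)
          rw [dif_pos ⟨a, rfl⟩, Finset.mem_singleton] at this
          rw [Function.comp, this, hw.2]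
          exact (⟨a, rfl⟩ : ℓ a ∈ Set.range ℓ).choose_spec
        refine ⟨⟨fun q => ?_, ?_⟩, hxw⟩
        · have := hx q
          split_ifs at this with h
          · rw [Finset.mem_singleton.1 this]; exact hw.1 _
          · exact this
        · rintro _ ⟨a, rfl⟩ _ ⟨b, rfl⟩ hab
          rw [← hw.2, ← hxw]; exact hab
    rw [Finset.sum_congr rfl (g := fun _ => G w)
      (fun x hx => by rw [(Finset.mem_filter.1 hx).2]), Finset.sum_const, nsmul_eq_mul, hset,
      Fintype.card_piFinset]
    congr 1
    have : ∀ q : Q, (if h : q ∈ Set.range ℓ then {w h.choose} else D).card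
        = if q ∈ Finset.univ.image ℓ then 1 else D.card := by
      intro q
      have : q ∈ Finset.univ.image ℓ ↔ q ∈ Set.range ℓ := by simp
      simp only [this]
      split_ifs <;> simp
    rw [Finset.prod_congr rfl fun q _ => this q, Finset.prod_ite, Finset.prod_const_one, one_mul,
      Finset.prod_const, ← Finset.card_univ, ← Finset.card_sdiff_of_subset (Finset.subset_univ _)]
    push_cast
    congr 2
    ext q; simp
  · intro x hx
    rw [Finset.mem_filter, Fintype.mem_piFinset] at hx ⊢
    refine ⟨fun a => hx.1 _, fun a b => ⟨fun h => hx.2 ⟨a, rfl⟩ ⟨b, rfl⟩ h, fun h => ?_⟩⟩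
    simp only [Function.comp, h]

end Sampling

/-! ### Coincidence patterns of two labellings -/

section Walk

/-- The positions on two copies of a walk with `m + 1` vertices. -/
def PairPos (m : ℕ) : Type := Fin (m + 1) ⊕ Fin (m + 1)

instance (m : ℕ) : Fintype (PairPos m) := inferInstanceAs (Fintype (Fin (m + 1) ⊕ Fin (m + 1)))

/-- The multigraph with vertices `Fin (m + 1)` and edges `src e → tgt e` is the graph of a walk
from `α` to `β` that visits all vertices. -/
structure IsWalk {m : ℕ} {E : Type*} [Fintype E] (src tgt : E → Fin (m + 1))
    (α β : Fin (m + 1)) : Prop where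
  balance : ∀ g : Fin (m + 1) → ℤ, ∑ e, g (src e) + g β = ∑ e, g (tgt e) + g α
  loopless : ∀ e, src e ≠ tgt e
  connected : ∀ X : Fin (m + 1) → Prop, (∀ e, X (src e) ↔ X (tgt e)) → ∀ i j, X i ↔ X j

variable {m : ℕ} {E : Type*}

/-- The sources of the edges of the closed walk that follows one copy of a walk forwards
and another copy of it backwards. -/
def closedSrc (src tgt : E → Fin (m + 1)) : E ⊕ E → PairPos m :=
  Sum.elim (Sum.inl ∘ src) (Sum.inr ∘ tgt)

/-- A labelling of two copies of `Fin (m + 1)` that is injective on each, and is the same on the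
two copies of `α` and on the two copies of `β`. -/
def IsPairLabelling (α β : Fin (m + 1)) {V : Type*} (w : PairPos m → V) : Prop :=
  Function.Injective (w ∘ Sum.inl) ∧ Function.Injective (w ∘ Sum.inr) ∧
    w (Sum.inl α) = w (Sum.inr α) ∧ w (Sum.inl β) = w (Sum.inr β)

variable {src tgt : E → Fin (m + 1)} {α β : Fin (m + 1)} {V : Type*}
  {w : PairPos m → V}

theorem IsPairLabelling.congr {V' : Type*} {w' : PairPos m → V'}
    (hw : IsPairLabelling α β w) (h : ∀ a b, w' a = w' b ↔ w a = w b) : IsPairLabelling α β w' :=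
  ⟨fun _ _ hab => hw.1 ((h _ _).1 hab), fun _ _ hab => hw.2.1 ((h _ _).1 hab),
    (h _ _).2 hw.2.2.1, (h _ _).2 hw.2.2.2⟩

theorem HasCore.closed (hcore : HasCore src tgt) (hw : IsPairLabelling α β w) :
    HasCore (w ∘ closedSrc src tgt) (w ∘ closedSrc tgt src) := by
  obtain ⟨C, ⟨u, hu⟩, hC⟩ := hcore
  refine ⟨(w ∘ Sum.inl) '' C, ⟨_, u, hu, rfl⟩, ?_⟩
  rintro _ ⟨u, hu, rfl⟩
  obtain ⟨e, e', a, b, c, d, n, n', h⟩ := hC u hu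
  refine ⟨Sum.inl e, Sum.inl e', ⟨_, a, rfl⟩, ⟨_, b, rfl⟩, ⟨_, c, rfl⟩, ⟨_, d, rfl⟩,
    fun h' => n (hw.1 h'), fun h' => n' (hw.1 h'), ?_⟩
  rcases h with ⟨hne, a, b⟩ | ⟨hne, a, b⟩ | ⟨a, b, hne⟩
  · exact Or.inl ⟨fun h => hne (Sum.inl_injective h), congrArg (w ∘ Sum.inl) a,
      congrArg (w ∘ Sum.inl) b⟩
  · exact Or.inr (Or.inl ⟨fun h => hne (Sum.inl_injective h), congrArg (w ∘ Sum.inl) a,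
      congrArg (w ∘ Sum.inl) b⟩)
  · exact Or.inr (Or.inr ⟨congrArg (w ∘ Sum.inl) a, congrArg (w ∘ Sum.inl) b,
      fun h' => hne (hw.1 h')⟩)

variable [Fintype E]

theorem IsWalk.exists_src_or_tgt [Nonempty E] (h : IsWalk src tgt α β) (i : Fin (m + 1)) :
    ∃ e, src e = i ∨ tgt e = i := by
  by_contra! H
  have := h.connected (fun k => k = i) fun e => iff_of_false (H e).1 (H e).2
  obtain ⟨e⟩ := ‹Nonempty E›
  exact (H e).1 ((this i (src e)).1 rfl)

theorem IsWalk.isBalanced (h : IsWalk src tgt α β) (hw : IsPairLabelling α β w) :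
    IsBalanced (w ∘ closedSrc src tgt) (w ∘ closedSrc tgt src) := by
  intro g
  have h1 := h.balance fun i => g (w (Sum.inl i))
  have h2 := h.balance fun i => g (w (Sum.inr i))
  simp only [closedSrc, Fintype.sum_sum_type, Function.comp, Sum.elim_inl, Sum.elim_inr]
  rw [hw.2.2.1, hw.2.2.2] at h1
  linarith

theorem IsWalk.isEdgeConnected (h : IsWalk src tgt α β) (hw : IsPairLabelling α β w) :
    IsEdgeConnected (w ∘ closedSrc src tgt) (w ∘ closedSrc tgt src) := by
  intro X hX
  have h1 := h.connected (fun i => X (w (Sum.inl i))) fun e => hX (Sum.inl e)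
  have h2 := h.connected (fun i => X (w (Sum.inr i))) fun e => (hX (Sum.inr e)).symm
  have key : ∀ a, X (w a) ↔ X (w (Sum.inl α)) := by
    rintro (i | i)
    · exact h1 i α
    · rw [hw.2.2.1]; exact h2 i α
  exact fun e e' => (key _).trans (key _).symm

theorem IsWalk.properEdges_eq (h : IsWalk src tgt α β) (hw : IsPairLabelling α β w) :
    properEdges (w ∘ closedSrc src tgt) (w ∘ closedSrc tgt src) = 2 * Fintype.card E := by
  classical
  rw [properEdges, Finset.filter_true_of_mem, Finset.card_univ, Fintype.card_sum, two_mul]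
  rintro (e | e) -
  · exact fun h' => h.loopless e (hw.1 h')
  · exact fun h' => h.loopless e (hw.2.1 h').symm

theorem IsWalk.image_comp_closedSrc [DecidableEq V] [Nonempty E] (h : IsWalk src tgt α β)
    (hw : IsPairLabelling α β w) :
    Finset.univ.image (w ∘ closedSrc src tgt) = Finset.univ.image w := by
  have hr := (h.isBalanced hw).range_eq
  ext k
  simp only [Finset.mem_image, Finset.mem_univ, true_and]
  change k ∈ Set.range (w ∘ closedSrc src tgt) ↔ _
  constructor
  · rintro ⟨e, rfl⟩; exact ⟨_, rfl⟩
  · rintro ⟨i | i, rfl⟩ <;> obtain ⟨e, he | he⟩ := h.exists_src_or_tgt i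
    · exact ⟨Sum.inl e, congrArg (fun k => w (Sum.inl k)) he⟩
    · rw [← hr]; exact ⟨Sum.inl e, congrArg (fun k => w (Sum.inl k)) he⟩
    · rw [← hr]; exact ⟨Sum.inr e, congrArg (fun k => w (Sum.inr k)) he⟩
    · exact ⟨Sum.inr e, congrArg (fun k => w (Sum.inr k)) he⟩

/-- A constant, depending only on the coherence and the numbers of edges and vertices of a walk,
in the bounds for sums over pairs of labelled copies of the walk. -/
noncomputable def walkConst (μ : ℝ) (m : ℕ) (E : Type*) [Fintype E] : ℝ :=
  2 ^ Fintype.card (PairPos m × PairPos m) *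
    (max 1 μ ^ Fintype.card (E ⊕ E) * (Fintype.card (PairPos m)).factorial)

theorem walkConst_pos (μ : ℝ) (m : ℕ) (E : Type*) [Fintype E] : 0 < walkConst μ m E := by
  unfold walkConst
  have : 0 < max 1 μ := lt_max_of_lt_left one_pos
  positivity

variable {ι : Type*} {D : Finset ι} {K : ι → ι → ℂ} {p μ δ ρ : ℝ} {n : ℕ}

open Classical in
/-- The contribution of the pairs of copies of a walk with prescribed coincidences. -/
theorem norm_sum_coincidence_class_le [Nonempty E] (hK : IsIncoherentFrame D K p μ) (hμ : 0 ≤ μ)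
    (hn : 1 ≤ n) (hnp : (n : ℝ) ≤ p) (hpN : p ≤ D.card) (hρ : ρ = √n / √p) (hδρ : ρ ≤ δ)
    (hδN : p / D.card ≤ δ) (hδn : (1 : ℝ) / n ≤ δ) (hδ1 : δ ≤ 1)
    (h : IsWalk src tgt α β) {g : ℝ} (hg : g = 1 ∨ (g = δ ∧ HasCore src tgt))
    {w₀ : PairPos m → ι} (hw₀ : IsPairLabelling α β w₀) :
    ‖∑ w ∈ (Fintype.piFinset fun _ : PairPos m => D).filter
        (fun w => ∀ a b, w a = w b ↔ w₀ a = w₀ b),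
      (countSupersets D n (Finset.univ.image w) : ℂ) *
        ∏ e, K (w (closedSrc src tgt e)) (w (closedSrc tgt src e))‖
      ≤ (D.powersetCard n).card * (max 1 μ ^ Fintype.card (E ⊕ E) *
        (Fintype.card (PairPos m)).factorial * g * n *
          ρ ^ (2 * Fintype.card E)) := by
  have hnN : n ≤ D.card := by exact_mod_cast hnp.trans hpN
  have hN0 : (0 : ℝ) < D.card := by
    have : 0 < D.card := by omega
    exact_mod_cast this
  have hg0 : 0 ≤ g := by
    rcases hg with rfl | ⟨rfl, -⟩
    · exact zero_le_one
    · exact le_trans (by positivity) hδn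
  have hρ0 : 0 ≤ ρ := by rw [hρ]; positivity
  have : Nonempty (PairPos m) := ⟨Sum.inl 0⟩
  -- the labels are chosen among the positions themselves
  set ℓ : PairPos m → PairPos m := Function.invFun w₀ ∘ w₀ with hℓ
  have hℓw : ∀ a b, ℓ a = ℓ b ↔ w₀ a = w₀ b := fun a b =>
    ⟨fun h => by
      have := congrArg w₀ h
      simpa [hℓ, Function.invFun_eq (⟨_, rfl⟩ : ∃ c, w₀ c = w₀ _)] using this,
    fun h => congrArg (Function.invFun w₀) h⟩
  have hpl : IsPairLabelling α β ℓ := hw₀.congr hℓw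
  set v := (Finset.univ.image ℓ).card with hv
  have hvcard : v ≤ Fintype.card (PairPos m) := Finset.card_le_univ _
  simp_rw [← hℓw]
  set T := (Fintype.piFinset fun _ : PairPos m => D).filter (fun w => ∀ a b, w a = w b ↔ ℓ a = ℓ b) with hT
  have himg : ∀ w ∈ T, (Finset.univ.image w).card = v ∧ Finset.univ.image w ⊆ D := by
    intro w hw
    rw [hT, Finset.mem_filter, Fintype.mem_piFinset] at hw
    refine ⟨?_, fun k hk => ?_⟩
    · refine Finset.card_bij (fun k hk => ℓ (Finset.mem_image.1 hk).choose) ?_ ?_ ?_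
      · intro k hk; simp
      · intro k hk k' hk' he
        rw [← hw.2, (Finset.mem_image.1 hk).choose_spec.2,
          (Finset.mem_image.1 hk').choose_spec.2] at he
        exact he
      · intro k hk
        obtain ⟨a, -, rfl⟩ := Finset.mem_image.1 hk
        have hm : w a ∈ Finset.univ.image w := by simp
        refine ⟨w a, hm, ?_⟩
        rw [← hw.2]
        exact (Finset.mem_image.1 hm).choose_spec.2
    · obtain ⟨a, -, rfl⟩ := Finset.mem_image.1 hk
      exact hw.1 a
  -- the inclusion probability depends only on the number of distinct labels
  obtain ⟨r, hr0, hr⟩ : ∃ r : ℝ, 0 ≤ r ∧ ∀ w ∈ T,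
      (countSupersets D n (Finset.univ.image w) : ℝ) = r ∧
        r * (D.card : ℝ) ^ v ≤ (D.powersetCard n).card * (n : ℝ) ^ v := by
    refine ⟨(D.powersetCard n).card * n.choose v / D.card.choose v, by positivity, fun w hw => ?_⟩
    obtain ⟨h1, h2⟩ := himg w hw
    have e := countSupersets_mul_choose (n := n) h2
    have le := countSupersets_mul_pow_le h2 hnN
    rw [h1] at e le
    have hpos : (0 : ℝ) < D.card.choose v := by
      have := Nat.choose_pos (Finset.card_le_card h2)
      rw [h1] at this
      exact_mod_cast this
    have e' : (countSupersets D n (Finset.univ.image w) : ℝ)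
        = (D.powersetCard n).card * n.choose v / D.card.choose v := by
      rw [eq_div_iff hpos.ne']; exact_mod_cast e
    refine ⟨e', ?_⟩
    rw [← e']
    exact_mod_cast le
  set G : (PairPos m → ι) → ℂ := fun w => ∏ e, K (w (closedSrc src tgt e)) (w (closedSrc tgt src e)) with hG
  have hsum : ∑ w ∈ T, (countSupersets D n (Finset.univ.image w) : ℂ) * G w
      = r * ∑ w ∈ T, G w := by
    rw [Finset.mul_sum]
    refine Finset.sum_congr rfl fun w hw => ?_
    rw [← (hr w hw).1]
    simp
  change ‖∑ w ∈ T, (countSupersets D n (Finset.univ.image w) : ℂ) * G w‖ ≤ _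
  rcases T.eq_empty_or_nonempty with hemp | ⟨w₁, hw₁⟩
  · rw [hemp]
    simp only [Finset.sum_empty, norm_zero]
    have : 0 < max 1 μ := lt_max_of_lt_left one_pos
    positivity
  have hrle := (hr w₁ hw₁).2
  have hcore : g = 1 ∨ (g = δ ∧ HasCore (ℓ ∘ closedSrc src tgt) (ℓ ∘ closedSrc tgt src)) :=
    hg.imp id fun h' => ⟨h'.1, h'.2.closed hpl⟩
  have hmain := pow_mul_norm_injAvg_le hK hμ (by exact_mod_cast hn) hnp hpN hρ hδρ hδN hδn hδ1 v
    (ℓ ∘ closedSrc src tgt) (ℓ ∘ closedSrc tgt src) g (h.isBalanced hpl) (h.isEdgeConnected hpl)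
    (by rw [h.image_comp_closedSrc hpl]) hcore
  have havg : injAvg D K (ℓ ∘ closedSrc src tgt) (ℓ ∘ closedSrc tgt src) * (D.card : ℂ) ^ v
      = ∑ w ∈ T, G w := by
    have hrng : Set.range (ℓ ∘ closedSrc src tgt) = Set.range ℓ := by
      have := congrArg (fun A : Finset (PairPos m) => (A : Set (PairPos m))) (h.image_comp_closedSrc hpl)
      rw [← Set.image_univ, ← Set.image_univ]
      simpa only [Finset.coe_image, Finset.coe_univ] using this
    have := sum_injOn_comp D ℓ G
    have hNc : (D.card : ℂ) ≠ 0 := by exact_mod_cast hN0.ne'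
    rw [injAvg, hrng]
    have e2 : (∑ x ∈ Fintype.piFinset (fun _ : PairPos m => D), if Set.InjOn x (Set.range ℓ) then
        ∏ e, K (x ((ℓ ∘ closedSrc src tgt) e)) (x ((ℓ ∘ closedSrc tgt src) e)) else 0)
        = (D.card : ℂ) ^ (Fintype.card (PairPos m) - v) * ∑ w ∈ T, G w := this
    rw [e2, div_mul_eq_mul_div, div_eq_iff (pow_ne_zero _ hNc), mul_right_comm, ← pow_add,
      Nat.sub_add_cancel hvcard, mul_comm]
  rw [hsum, ← havg, norm_mul, norm_mul, norm_pow, Complex.norm_natCast, Complex.norm_real,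
    Real.norm_of_nonneg hr0]
  have hfac : ((v.factorial : ℕ) : ℝ) ≤ (Fintype.card (PairPos m)).factorial := by
    exact_mod_cast Nat.factorial_le hvcard
  have hmax : 0 < max 1 μ := lt_max_of_lt_left one_pos
  calc r * (‖injAvg D K (ℓ ∘ closedSrc src tgt) (ℓ ∘ closedSrc tgt src)‖ * (D.card : ℝ) ^ v)
      = r * (D.card : ℝ) ^ v * ‖injAvg D K (ℓ ∘ closedSrc src tgt) (ℓ ∘ closedSrc tgt src)‖ := by
        ring
    _ ≤ (D.powersetCard n).card * (n : ℝ) ^ v *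
        ‖injAvg D K (ℓ ∘ closedSrc src tgt) (ℓ ∘ closedSrc tgt src)‖ := by gcongr
    _ = (D.powersetCard n).card * ((n : ℝ) ^ v *
        ‖injAvg D K (ℓ ∘ closedSrc src tgt) (ℓ ∘ closedSrc tgt src)‖) := by ring
    _ ≤ (D.powersetCard n).card * (max 1 μ ^ Fintype.card (E ⊕ E) * v.factorial * g * n *
        ρ ^ properEdges (ℓ ∘ closedSrc src tgt) (ℓ ∘ closedSrc tgt src)) := by gcongr
    _ ≤ _ := by rw [h.properEdges_eq hpl]; gcongr

open Classical in
/-- The sum over all pairs of copies of a walk in a random set, by the fundamental estimate for the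
multigraphs that arise from the possible coincidences between the two copies. -/
theorem norm_sum_pairLabelling_le [Nonempty E] (hK : IsIncoherentFrame D K p μ) (hμ : 0 ≤ μ)
    (hn : 1 ≤ n) (hnp : (n : ℝ) ≤ p) (hpN : p ≤ D.card) (hρ : ρ = √n / √p) (hδρ : ρ ≤ δ)
    (hδN : p / D.card ≤ δ) (hδn : (1 : ℝ) / n ≤ δ) (hδ1 : δ ≤ 1)
    (h : IsWalk src tgt α β) {g : ℝ} (hg : g = 1 ∨ (g = δ ∧ HasCore src tgt)) :
    ‖∑ S ∈ D.powersetCard n, ∑ w ∈ (Fintype.piFinset fun _ : PairPos m => S).filter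
        (IsPairLabelling α β), ∏ e, K (w (closedSrc src tgt e)) (w (closedSrc tgt src e))‖
      ≤ (D.powersetCard n).card * (walkConst μ m E * g * n * ρ ^ (2 * Fintype.card E)) := by
  rw [sum_powersetCard_sum_piFinset]
  have hg0 : 0 ≤ g := by
    rcases hg with rfl | ⟨rfl, -⟩
    · exact zero_le_one
    · exact le_trans (by positivity) hδn
  have hρ0 : 0 ≤ ρ := by rw [hρ]; positivity
  set B := (D.powersetCard n).card * (max 1 μ ^ Fintype.card (E ⊕ E) *
        (Fintype.card (PairPos m)).factorial * g * n * ρ ^ (2 * Fintype.card E)) with hB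
  have hmax : 0 < max 1 μ := lt_max_of_lt_left one_pos
  have hB0 : 0 ≤ B := by positivity
  -- group the labellings by their sets of coincidences
  rw [← Finset.sum_fiberwise (g := fun w : PairPos m → ι =>
    Finset.univ.filter fun ab : PairPos m × PairPos m => w ab.1 = w ab.2)]
  refine (norm_sum_le _ _).trans ((Finset.sum_le_card_nsmul _ _ B fun κ _ => ?_).trans_eq ?_)
  · rcases (((Fintype.piFinset fun _ : PairPos m => D).filter (IsPairLabelling α β)).filter fun w : PairPos m → ι =>
        (Finset.univ.filter fun ab : PairPos m × PairPos m => w ab.1 = w ab.2) = κ).eq_empty_or_nonempty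
      with hemp | ⟨w₀, hw₀⟩
    · rw [hemp]; simpa using hB0
    · rw [Finset.mem_filter, Finset.mem_filter] at hw₀
      obtain ⟨⟨-, hw₀p⟩, hκ⟩ := hw₀
      refine le_trans (le_of_eq ?_) (norm_sum_coincidence_class_le hK hμ hn hnp hpN hρ hδρ hδN hδn
        hδ1 h hg hw₀p)
      congr 1
      refine Finset.sum_congr ?_ fun _ _ => rfl
      ext w
      simp only [Finset.mem_filter, ← hκ]
      constructor
      · rintro ⟨⟨h1, -⟩, h2⟩
        refine ⟨h1, fun a b => ?_⟩
        have := Finset.ext_iff.1 h2 (a, b)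
        simpa using this
      · rintro ⟨h1, h2⟩
        exact ⟨⟨h1, hw₀p.congr h2⟩, by ext ⟨a, b⟩; simp [h2]⟩
  · rw [nsmul_eq_mul, Finset.card_univ, Fintype.card_finset, hB, walkConst]
    push_cast
    ring

end Walk

/-! ### Walks and their second moments -/

section WalkSum

variable {ι E : Type*} [Fintype E] {m : ℕ}

open Classical in
/-- The sum of the products of the entries of `A` over all injectively labelled copies in `S` of
the graph with edges `src e → tgt e`, with prescribed labels at `α` and at `β`. -/
noncomputable def walkSum (A : ι → ι → ℂ) (S : Finset ι) (src tgt : E → Fin (m + 1))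
    (α β : Fin (m + 1)) (a b : ι) : ℂ :=
  ∑ v ∈ Fintype.piFinset fun _ : Fin (m + 1) => S,
    if Function.Injective v ∧ v α = a ∧ v β = b then ∏ e, A (v (src e)) (v (tgt e)) else 0

open Classical in
/-- The off-diagonal part of the kernel `K`, multiplied by `c`. -/
noncomputable def offDiag (K : ι → ι → ℂ) (c : ℝ) (a b : ι) : ℂ := if a = b then 0 else c * K a b

open Classical in
theorem sum_normSq_walkSum {K : ι → ι → ℂ} (hK : ∀ a b, (starRingEnd ℂ) (K a b) = K b a) (c : ℝ)
    (S : Finset ι) {src tgt : E → Fin (m + 1)} (hloop : ∀ e, src e ≠ tgt e) (α β : Fin (m + 1)) :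
    ((∑ a ∈ S, ∑ b ∈ S, ‖walkSum (offDiag K c) S src tgt α β a b‖ ^ 2 : ℝ) : ℂ)
      = (c : ℂ) ^ (2 * Fintype.card E) *
        ∑ w ∈ (Fintype.piFinset fun _ : PairPos m => S).filter (IsPairLabelling α β),
          ∏ e, K (w (closedSrc src tgt e)) (w (closedSrc tgt src e)) := by
  set Pi := Fintype.piFinset fun _ : Fin (m + 1) => S with hPi
  set F : (Fin (m + 1) → ι) → ℂ := fun v => ∏ e, K (v (src e)) (v (tgt e)) with hF
  have hA : ∀ v : Fin (m + 1) → ι, Function.Injective v →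
      ∏ e, offDiag K c (v (src e)) (v (tgt e)) = (c : ℂ) ^ Fintype.card E * F v := by
    intro v hv
    rw [hF, ← Finset.card_univ, ← Finset.prod_const, ← Finset.prod_mul_distrib]
    refine Finset.prod_congr rfl fun e _ => ?_
    rw [offDiag, if_neg fun h => hloop e (hv h)]
  have hW : ∀ a b, walkSum (offDiag K c) S src tgt α β a b = (c : ℂ) ^ Fintype.card E *
      ∑ v ∈ Pi.filter Function.Injective, if v α = a ∧ v β = b then F v else 0 := by
    intro a b
    rw [walkSum, Finset.sum_filter, Finset.mul_sum]
    refine Finset.sum_congr rfl fun v _ => ?_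
    by_cases hv : Function.Injective v
    · by_cases h : v α = a ∧ v β = b
      · simp [hv, h, hA v hv]
      · simp [hv, h]
    · simp [hv]
  have hsq : ∀ a b, ((‖walkSum (offDiag K c) S src tgt α β a b‖ ^ 2 : ℝ) : ℂ)
      = (c : ℂ) ^ (2 * Fintype.card E) * ∑ v ∈ Pi.filter Function.Injective,
        ∑ v' ∈ Pi.filter Function.Injective,
        if (v α = a ∧ v' α = a) ∧ (v β = b ∧ v' β = b) then
          F v * (starRingEnd ℂ) (F v') else 0 := by
    intro a b
    push_cast
    rw [← Complex.mul_conj', hW, map_mul, map_pow, Complex.conj_ofReal, map_sum,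
      mul_mul_mul_comm, ← pow_add, ← two_mul, Finset.sum_mul_sum]
    congr 1
    refine Finset.sum_congr rfl fun v _ => Finset.sum_congr rfl fun v' _ => ?_
    by_cases h1 : v α = a <;> by_cases h2 : v β = b <;> by_cases h3 : v' α = a <;>
      by_cases h4 : v' β = b <;> simp [h1, h2, h3, h4]
  rw [Complex.ofReal_sum]
  simp_rw [Complex.ofReal_sum, hsq, ← Finset.mul_sum]
  congr 1
  have hswap : ∑ a ∈ S, ∑ b ∈ S, ∑ v ∈ Pi.filter Function.Injective,
        ∑ v' ∈ Pi.filter Function.Injective,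
        (if (v α = a ∧ v' α = a) ∧ (v β = b ∧ v' β = b) then
          F v * (starRingEnd ℂ) (F v') else 0)
      = ∑ v ∈ Pi.filter Function.Injective, ∑ v' ∈ Pi.filter Function.Injective,
        if v α = v' α ∧ v β = v' β then F v * (starRingEnd ℂ) (F v') else 0 := by
    rw [Finset.sum_congr rfl fun a _ => Finset.sum_comm, Finset.sum_comm]
    refine Finset.sum_congr rfl fun v hv => ?_
    rw [Finset.sum_congr rfl fun a _ => Finset.sum_comm, Finset.sum_comm]
    refine Finset.sum_congr rfl fun v' hv' => ?_
    rw [hPi, Finset.mem_filter, Fintype.mem_piFinset] at hv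
    rw [Finset.sum_eq_single_of_mem (v α) (hv.1 α), Finset.sum_eq_single_of_mem (v β) (hv.1 β)]
    · simp [eq_comm]
    · intro b _ hb; rw [if_neg]; exact fun h => hb h.2.1.symm
    · intro a _ ha
      refine Finset.sum_eq_zero fun b _ => ?_
      rw [if_neg]; exact fun h => ha h.1.1.symm
  rw [hswap, ← Finset.sum_product', ← Finset.sum_filter]
  refine Finset.sum_nbij' (fun vv => (Sum.elim vv.1 vv.2 : PairPos m → ι))
    (fun w => (fun i => w (Sum.inl i), fun i => w (Sum.inr i))) ?_ ?_ ?_ ?_ ?_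
  · rintro ⟨v, v'⟩ h
    simp only [hPi, Finset.mem_filter, Finset.mem_product, Fintype.mem_piFinset] at h
    refine Finset.mem_filter.2 ⟨Fintype.mem_piFinset.2 ?_, h.1.1.2, h.1.2.2, h.2.1, h.2.2⟩
    rintro (i | i)
    · exact h.1.1.1 i
    · exact h.1.2.1 i
  · intro w h
    simp only [hPi, Finset.mem_filter, Finset.mem_product, Fintype.mem_piFinset] at h ⊢
    exact ⟨⟨⟨fun i => h.1 _, h.2.1⟩, ⟨fun i => h.1 _, h.2.2.1⟩⟩, h.2.2.2.1, h.2.2.2.2⟩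
  · rintro ⟨v, v'⟩ _; rfl
  · intro w _
    funext q
    rcases q with i | i <;> rfl
  · rintro ⟨v, v'⟩ _
    rw [Fintype.prod_sum_type, hF, map_prod]
    congr 1
    exact Finset.prod_congr rfl fun e _ => hK _ _

open Classical in
/-- The Hilbert–Schmidt norms of the walk sums are bounded on average, and small on average if the
graph of the walk has a core. -/
theorem sum_normSq_walkSum_le [Nonempty E] {D : Finset ι} {K : ι → ι → ℂ} {p μ δ : ℝ} {n : ℕ}
    (hK : IsIncoherentFrame D K p μ) (hμ : 0 ≤ μ) (hn : 1 ≤ n) (hnp : (n : ℝ) ≤ p)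
    (hpN : p ≤ D.card) (hδρ : √(n / p) ≤ δ) (hδN : p / D.card ≤ δ) (hδn : (1 : ℝ) / n ≤ δ)
    (hδ1 : δ ≤ 1) {src tgt : E → Fin (m + 1)} {α β : Fin (m + 1)} (h : IsWalk src tgt α β) {g : ℝ}
    (hg : g = 1 ∨ (g = δ ∧ HasCore src tgt)) :
    ∑ S ∈ D.powersetCard n, ∑ a ∈ S, ∑ b ∈ S,
        ‖walkSum (offDiag K √(p / n)) S src tgt α β a b‖ ^ 2
      ≤ (D.powersetCard n).card * (walkConst μ m E * g * n) := by
  have hn0 : (0 : ℝ) < n := by exact_mod_cast hn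
  have hp0 : 0 < p := by linarith
  have hρ : √(n / p) = √n / √p := Real.sqrt_div hn0.le p
  have hmain := norm_sum_pairLabelling_le hK hμ hn hnp hpN hρ hδρ hδN hδn hδ1 h hg
  have hcρ : √(p / n) * √(n / p) = 1 := by
    rw [← Real.sqrt_mul (by positivity), div_mul_div_cancel₀ hn0.ne', div_self hp0.ne', Real.sqrt_one]
  have e : ((∑ S ∈ D.powersetCard n, ∑ a ∈ S, ∑ b ∈ S,
        ‖walkSum (offDiag K √(p / n)) S src tgt α β a b‖ ^ 2 : ℝ) : ℂ)
      = ((√(p / n) : ℝ) : ℂ) ^ (2 * Fintype.card E) * ∑ S ∈ D.powersetCard n,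
        ∑ w ∈ (Fintype.piFinset fun _ : PairPos m => S).filter (IsPairLabelling α β),
          ∏ e, K (w (closedSrc src tgt e)) (w (closedSrc tgt src e)) := by
    rw [Complex.ofReal_sum, Finset.mul_sum]
    exact Finset.sum_congr rfl fun S _ => sum_normSq_walkSum hK.conj_symm _ S h.loopless α β
  have hnn : 0 ≤ ∑ S ∈ D.powersetCard n, ∑ a ∈ S, ∑ b ∈ S,
        ‖walkSum (offDiag K √(p / n)) S src tgt α β a b‖ ^ 2 :=
    Finset.sum_nonneg fun _ _ => Finset.sum_nonneg fun _ _ => Finset.sum_nonneg fun _ _ =>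
      sq_nonneg _
  rw [← Real.norm_of_nonneg hnn, ← Complex.norm_real, e, norm_mul, norm_pow, Complex.norm_real,
    Real.norm_of_nonneg (Real.sqrt_nonneg _)]
  calc _ ≤ √(p / n) ^ (2 * Fintype.card E) * ((D.powersetCard n).card *
        (walkConst μ m E * g * n * √(n / p) ^ (2 * Fintype.card E))) := by gcongr
    _ = (D.powersetCard n).card * (walkConst μ m E * g * n) *
        (√(p / n) * √(n / p)) ^ (2 * Fintype.card E) := by rw [mul_pow]; ring
    _ = _ := by rw [hcρ, one_pow, mul_one]

end WalkSum

section Paths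

/-- The sources of the path `0 → 1 → ⋯ → m` with an additional edge `j → 0`. -/
def lassoSrc {m : ℕ} (j : Fin (m + 1)) : Option (Fin m) → Fin (m + 1) :=
  fun e => e.elim j Fin.castSucc

/-- The targets of the path `0 → 1 → ⋯ → m` with an additional edge `j → 0`. -/
def lassoTgt {m : ℕ} : Option (Fin m) → Fin (m + 1) := fun e => e.elim 0 Fin.succ

/-- The sources of the path `0 → 1 → ⋯ → m` with additional edges `0 → j` and `j → 0`. -/
def detourSrc {m : ℕ} (j : Fin (m + 1)) : Option (Option (Fin m)) → Fin (m + 1) :=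
  fun e => e.elim 0 (lassoSrc j)

/-- The targets of the path `0 → 1 → ⋯ → m` with additional edges `0 → j` and `j → 0`. -/
def detourTgt {m : ℕ} (j : Fin (m + 1)) : Option (Option (Fin m)) → Fin (m + 1) :=
  fun e => e.elim j lassoTgt

theorem iff_of_path {m : ℕ} {X : Fin (m + 1) → Prop}
    (h : ∀ e : Fin m, X e.castSucc ↔ X e.succ) (i j : Fin (m + 1)) : X i ↔ X j := by
  have key : ∀ k : Fin (m + 1), X k ↔ X 0 := fun k => by
    induction k using Fin.induction with
    | zero => rfl
    | succ k ih => exact (h k).symm.trans ih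
  exact (key i).trans (key j).symm

theorem isWalk_path (m : ℕ) : IsWalk (Fin.castSucc : Fin m → _) Fin.succ 0 (Fin.last m) where
  balance g := by
    have h1 := Fin.sum_univ_castSucc g
    have h2 := Fin.sum_univ_succ g
    linarith
  loopless e := Fin.castSucc_lt_succ.ne
  connected _ hX := iff_of_path hX

theorem isWalk_lasso {m : ℕ} {j : Fin (m + 1)} (hj : j ≠ 0) :
    IsWalk (lassoSrc j) lassoTgt j (Fin.last m) where
  balance g := by
    have := (isWalk_path m).balance g
    simp only [Fintype.sum_option, lassoSrc, lassoTgt, Option.elim] at *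
    linarith
  loopless e := by
    rcases e with _ | e
    · exact hj
    · exact Fin.castSucc_lt_succ.ne
  connected _ hX := iff_of_path fun e => hX (some e)

theorem isWalk_detour {m : ℕ} {j : Fin (m + 1)} (hj : j ≠ 0) :
    IsWalk (detourSrc j) (detourTgt j) 0 (Fin.last m) where
  balance g := by
    have := (isWalk_path m).balance g
    simp only [Fintype.sum_option, detourSrc, detourTgt, lassoSrc, lassoTgt, Option.elim] at *
    linarith
  loopless e := by
    rcases e with _ | _ | e
    · exact hj.symm
    · exact hj
    · exact Fin.castSucc_lt_succ.ne
  connected _ hX := iff_of_path fun e => hX (some (some e))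

/-- The cycle `0 → 1 → ⋯ → j → 0` is a core if it has length at least `3`. -/
theorem hasCore_lasso {m : ℕ} {j : Fin (m + 1)} (hj : 2 ≤ (j : ℕ)) :
    HasCore (lassoSrc j) lassoTgt := by
  have hjm := j.isLt
  refine ⟨{k | k ≤ j}, ⟨j, by simp⟩, fun u (hu : u ≤ j) => ?_⟩
  have hu' : (u : ℕ) ≤ j := hu
  rcases eq_or_ne (u : ℕ) 0 with h0 | h0
  · refine ⟨none, some ⟨0, by omega⟩, ?_⟩
    simp only [lassoSrc, lassoTgt, Option.elim, Set.mem_ofPred_eq, Fin.ext_iff, Fin.le_def,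
      Fin.val_castSucc, Fin.val_succ, Fin.val_zero, ne_eq]
    refine ⟨by omega, by omega, by omega, by omega, by omega, by omega, Or.inr (Or.inr ?_)⟩
    omega
  rcases eq_or_ne (u : ℕ) j with h1 | h1
  · refine ⟨some ⟨u - 1, by omega⟩, none, ?_⟩
    simp only [lassoSrc, lassoTgt, Option.elim, Set.mem_ofPred_eq, Fin.ext_iff, Fin.le_def,
      Fin.val_castSucc, Fin.val_succ, Fin.val_zero, ne_eq]
    refine ⟨by omega, by omega, by omega, by omega, by omega, by omega, Or.inr (Or.inr ?_)⟩
    omega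
  · refine ⟨some ⟨u - 1, by omega⟩, some ⟨u, by omega⟩, ?_⟩
    simp only [lassoSrc, lassoTgt, Option.elim, Set.mem_ofPred_eq, Fin.ext_iff, Fin.le_def,
      Fin.val_castSucc, Fin.val_succ, ne_eq]
    refine ⟨by omega, by omega, by omega, by omega, by omega, by omega, Or.inr (Or.inr ⟨by omega, trivial, by omega⟩)⟩

theorem hasCore_detour {m : ℕ} {j : Fin (m + 1)} (hj : j ≠ 0) :
    HasCore (detourSrc j) (detourTgt j) := by
  have hjm := j.isLt
  have hj0 : (j : ℕ) ≠ 0 := fun h => hj (Fin.ext h)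
  refine ⟨{k | k ≤ j}, ⟨j, by simp⟩, fun u (hu : u ≤ j) => ?_⟩
  have hu' : (u : ℕ) ≤ j := hu
  rcases eq_or_ne (u : ℕ) 0 with h0 | h0
  · refine ⟨none, some (some ⟨0, by omega⟩), ?_⟩
    simp only [detourSrc, detourTgt, lassoSrc, lassoTgt, Option.elim, Set.mem_ofPred_eq,
      Fin.ext_iff, Fin.le_def, Fin.val_castSucc, Fin.val_succ, Fin.val_zero, ne_eq]
    refine ⟨by omega, by omega, by omega, by omega, by omega, by omega, Or.inl ⟨by simp, ?_⟩⟩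
    omega
  rcases eq_or_ne (u : ℕ) j with h1 | h1
  · refine ⟨none, some (some ⟨u - 1, by omega⟩), ?_⟩
    simp only [detourSrc, detourTgt, lassoSrc, lassoTgt, Option.elim, Set.mem_ofPred_eq,
      Fin.ext_iff, Fin.le_def, Fin.val_castSucc, Fin.val_succ, Fin.val_zero, ne_eq]
    refine ⟨by omega, by omega, by omega, by omega, by omega, by omega,
      Or.inr (Or.inl ⟨by simp, ?_⟩)⟩
    omega
  · refine ⟨some (some ⟨u - 1, by omega⟩), some (some ⟨u, by omega⟩), ?_⟩
    simp only [detourSrc, detourTgt, lassoSrc, lassoTgt, Option.elim, Set.mem_ofPred_eq,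
      Fin.ext_iff, Fin.le_def, Fin.val_castSucc, Fin.val_succ, ne_eq]
    refine ⟨by omega, by omega, by omega, by omega, by omega, by omega, Or.inr (Or.inr ⟨by omega, trivial, by omega⟩)⟩

end Paths

/-! ### The three-term recursion for self-avoiding paths -/

section Recursion

variable {ι : Type*}

open Classical in
theorem sum_piFinset_cons {k : ℕ} (S : Finset ι) (F : (Fin (k + 1) → ι) → ℂ) :
    ∑ w ∈ Fintype.piFinset (fun _ : Fin (k + 1) => S), F w
      = ∑ u ∈ S, ∑ v ∈ Fintype.piFinset (fun _ : Fin k => S), F (Fin.cons u v) := by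
  rw [← Finset.sum_product']
  refine Finset.sum_nbij' (fun w => (w 0, Fin.tail w)) (fun x => Fin.cons x.1 x.2) ?_ ?_ ?_ ?_ ?_
  · intro w hw
    rw [Fintype.mem_piFinset] at hw
    exact Finset.mem_product.2 ⟨hw 0, Fintype.mem_piFinset.2 fun i => hw i.succ⟩
  · rintro ⟨u, v⟩ h
    rw [Finset.mem_product, Fintype.mem_piFinset] at h
    exact Fintype.mem_piFinset.2 fun i => Fin.cases h.1 h.2 i
  · intro w _; exact Fin.cons_self_tail w
  · rintro ⟨u, v⟩ _; simp
  · intro w _; simp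

/-- The product of the entries of `A` along a path. -/
noncomputable def pathProd (A : ι → ι → ℂ) {m : ℕ} (v : Fin (m + 1) → ι) : ℂ :=
  ∏ i : Fin m, A (v i.castSucc) (v i.succ)

theorem pathProd_cons (A : ι → ι → ℂ) {m : ℕ} (u : ι) (v : Fin (m + 1) → ι) :
    pathProd A (Fin.cons u v : Fin (m + 2) → ι) = A u (v 0) * pathProd A v := by
  rw [pathProd, Fin.prod_univ_succ, pathProd]
  simp

/-- The sum over the self-avoiding paths of length `m` in `S` from `a` to `b`. -/
noncomputable def pathSum (A : ι → ι → ℂ) (S : Finset ι) (m : ℕ) (a b : ι) : ℂ :=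
  walkSum A S (Fin.castSucc : Fin m → _) Fin.succ 0 (Fin.last m) a b

open Classical in
theorem sum_mul_pathSum_eq_sum (A : ι → ι → ℂ) (S : Finset ι) (m : ℕ) (a b : ι) :
    ∑ u ∈ S, A a u * pathSum A S m u b
      = ∑ v ∈ Fintype.piFinset (fun _ : Fin (m + 1) => S),
        if Function.Injective v ∧ v (Fin.last m) = b then A a (v 0) * pathProd A v else 0 := by
  simp_rw [pathSum, walkSum, Finset.mul_sum]
  rw [Finset.sum_comm]
  refine Finset.sum_congr rfl fun v hv => ?_
  rw [Fintype.mem_piFinset] at hv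
  rw [Finset.sum_eq_single_of_mem (v 0) (hv 0)]
  · by_cases h : Function.Injective v ∧ v (Fin.last m) = b
    · simp [h, pathProd]
    · rw [if_neg h, if_neg, mul_zero]
      exact fun h' => h ⟨h'.1, h'.2.2⟩
  · intro u _ hu
    rw [if_neg, mul_zero]
    exact fun h' => hu h'.2.1.symm

open Classical in
theorem pathSum_succ (A : ι → ι → ℂ) {S : Finset ι} (m : ℕ) {a : ι} (ha : a ∈ S) (b : ι) :
    pathSum A S (m + 1) a b
      = ∑ v ∈ Fintype.piFinset (fun _ : Fin (m + 1) => S),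
        if (Function.Injective v ∧ v (Fin.last m) = b) ∧ ∀ i, v i ≠ a then
          A a (v 0) * pathProd A v else 0 := by
  rw [pathSum, walkSum, sum_piFinset_cons, Finset.sum_eq_single_of_mem a ha]
  · refine Finset.sum_congr rfl fun v _ => ?_
    have e := pathProd_cons A a v
    rw [pathProd] at e
    rw [e]
    refine if_congr ?_ rfl rfl
    rw [Fin.cons_injective_iff, ← Fin.succ_last, Fin.cons_succ, Fin.cons_zero]
    simp only [Set.mem_range, not_exists, true_and]
    tauto
  · intro u _ hu
    refine Finset.sum_eq_zero fun v _ => ?_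
    rw [if_neg]
    exact fun h => hu h.2.1

open Classical in
/-- The paths that return to the starting point at their second step: the sum over the first step
is a diagonal entry of `A * A`, except for the steps excluded by injectivity. -/
theorem sum_return (A : ι → ι → ℂ) (hA : ∀ a, A a a = 0) (S : Finset ι) (m : ℕ) (a b : ι) :
    ∑ v ∈ Fintype.piFinset (fun _ : Fin (m + 2) => S),
        (if (Function.Injective v ∧ v (Fin.last (m + 1)) = b) ∧ v 1 = a then
          A a (v 0) * pathProd A v else 0)
      = (∑ u ∈ S, A a u * A u a) * pathSum A S m a b
        - ∑ k : Fin m, walkSum A S (detourSrc k.succ) (detourTgt k.succ) 0 (Fin.last m) a b := by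
  rw [sum_piFinset_cons, Finset.sum_comm, pathSum, walkSum, Finset.mul_sum]
  simp_rw [walkSum]
  rw [Finset.sum_comm (s := (Finset.univ : Finset (Fin m))), ← Finset.sum_sub_distrib]
  refine Finset.sum_congr rfl fun v hv => ?_
  rw [Fintype.mem_piFinset] at hv
  by_cases h : Function.Injective v ∧ v 0 = a ∧ v (Fin.last m) = b
  · obtain ⟨hinj, h0, hl⟩ := h
    have hd : ∀ k : Fin m, ∏ e, A (v (detourSrc k.succ e)) (v (detourTgt k.succ e))
        = A a (v k.succ) * A (v k.succ) a * pathProd A v := by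
      intro k
      simp only [Fintype.prod_option, detourSrc, detourTgt, lassoSrc, lassoTgt, Option.elim, h0,
        pathProd, mul_assoc]
    simp only [hinj, h0, hl, and_self, if_true, hd]
    rw [← Finset.sum_mul]
    change _ = _ * pathProd A v - _
    rw [← sub_mul]
    have hcond : ∀ u, (if (Function.Injective (Fin.cons u v : Fin (m + 2) → ι) ∧
        (Fin.cons u v : Fin (m + 2) → ι) (Fin.last (m + 1)) = b) ∧
        (Fin.cons u v : Fin (m + 2) → ι) 1 = a then
          A a ((Fin.cons u v : Fin (m + 2) → ι) 0) * pathProd A (Fin.cons u v : Fin (m + 2) → ι) else 0)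
        = (if u ∉ Finset.univ.image v then A a u * A u a else 0) * pathProd A v := by
      intro u
      have h1 : (Fin.cons u v : Fin (m + 2) → ι) 1 = v 0 := by
        rw [← Fin.succ_zero_eq_one, Fin.cons_succ]
      have hiff : ((Function.Injective (Fin.cons u v : Fin (m + 2) → ι) ∧
          (Fin.cons u v : Fin (m + 2) → ι) (Fin.last (m + 1)) = b) ∧
          (Fin.cons u v : Fin (m + 2) → ι) 1 = a) ↔ u ∉ Finset.univ.image v := by
        rw [Fin.cons_injective_iff, ← Fin.succ_last, Fin.cons_succ, h1]
        simp [hinj, hl, h0]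
      rw [if_congr hiff rfl rfl, Fin.cons_zero, pathProd_cons, h0, ite_mul, zero_mul, mul_assoc]
    rw [Finset.sum_congr rfl fun u _ => hcond u, ← Finset.sum_mul]
    congr 1
    have hsub : Finset.univ.image v ⊆ S := by
      intro u hu
      obtain ⟨i, -, rfl⟩ := Finset.mem_image.1 hu
      exact hv i
    rw [eq_sub_iff_add_eq, ← Finset.sum_filter,
      ← Finset.sum_filter_add_sum_filter_not S (fun u => u ∉ Finset.univ.image v)]
    congr 1
    have : S.filter (fun u => ¬ u ∉ Finset.univ.image v) = Finset.univ.image v := by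
      ext u
      simp only [Finset.mem_filter, not_not]
      exact ⟨fun h => h.2, fun h => ⟨hsub h, h⟩⟩
    rw [this, Finset.sum_image hinj.injOn, Fin.sum_univ_succ, h0, hA]
    simp
  · have hd : ∀ k : Fin m, (if Function.Injective v ∧ v 0 = a ∧ v (Fin.last m) = b then
        ∏ e, A (v (detourSrc k.succ e)) (v (detourTgt k.succ e)) else 0) = 0 := fun k => if_neg h
    rw [if_neg h, mul_zero, Finset.sum_congr rfl fun k _ => hd k, Finset.sum_const_zero, sub_zero]
    refine Finset.sum_eq_zero fun u _ => if_neg fun h' => h ?_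
    obtain ⟨⟨h1, h2⟩, h3⟩ := h'
    rw [Fin.cons_injective_iff] at h1
    rw [← Fin.succ_last, Fin.cons_succ] at h2
    rw [← Fin.succ_zero_eq_one, Fin.cons_succ] at h3
    exact ⟨h1.2, h3, h2⟩

open Classical in
/-- The three-term recursion for the sums over self-avoiding paths, with its error terms. One more
step in front of a path leads to a new point, or back to the second point of the path, or closes
a longer cycle. -/
theorem sum_mul_pathSum_succ (A : ι → ι → ℂ) (hA : ∀ a, A a a = 0) {S : Finset ι} (m : ℕ) {a : ι}
    (ha : a ∈ S) (b : ι) :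
    ∑ u ∈ S, A a u * pathSum A S (m + 1) u b
      = pathSum A S (m + 2) a b + (∑ u ∈ S, A a u * A u a) * pathSum A S m a b
        + ∑ k : Fin m, (walkSum A S (lassoSrc k.succ.succ) lassoTgt k.succ.succ (Fin.last (m + 1)) a b
          - walkSum A S (detourSrc k.succ) (detourTgt k.succ) 0 (Fin.last m) a b) := by
  suffices h : ∑ u ∈ S, A a u * pathSum A S (m + 1) u b = pathSum A S (m + 2) a b
      + ∑ v ∈ Fintype.piFinset (fun _ : Fin (m + 2) => S),
        (if (Function.Injective v ∧ v (Fin.last (m + 1)) = b) ∧ v 1 = a then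
          A a (v 0) * pathProd A v else 0)
      + ∑ k : Fin m, walkSum A S (lassoSrc k.succ.succ) lassoTgt k.succ.succ (Fin.last (m + 1)) a b by
    rw [h, sum_return A hA, Finset.sum_sub_distrib]
    ring
  rw [sum_mul_pathSum_eq_sum, pathSum_succ A (m + 1) ha]
  simp_rw [walkSum]
  rw [Finset.sum_comm (s := (Finset.univ : Finset (Fin m))), ← Finset.sum_add_distrib,
    ← Finset.sum_add_distrib]
  refine Finset.sum_congr rfl fun v _ => ?_
  by_cases h : Function.Injective v ∧ v (Fin.last (m + 1)) = b
  · simp only [h, true_and, and_true]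
    have hl : ∀ j : Fin (m + 2), v j = a → ∏ e, A (v (lassoSrc j e)) (v (lassoTgt e))
        = A a (v 0) * pathProd A v := by
      intro j hj
      simp only [Fintype.prod_option, lassoSrc, lassoTgt, Option.elim, hj, pathProd]
    have hsum : ∑ j : Fin (m + 2), (if v j = a then A a (v 0) * pathProd A v else 0)
        = (if v 1 = a then A a (v 0) * pathProd A v else 0)
          + ∑ k : Fin m, if v k.succ.succ = a then
            ∏ e, A (v (lassoSrc k.succ.succ e)) (v (lassoTgt e)) else 0 := by
      rw [Fin.sum_univ_succ, Fin.sum_univ_succ, Fin.succ_zero_eq_one]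
      have h0 : (if v 0 = a then A a (v 0) * pathProd A v else 0) = 0 := by
        split_ifs with h0
        · rw [h0, hA, zero_mul]
        · rfl
      rw [h0, zero_add]
      congr 1
      refine Finset.sum_congr rfl fun k _ => ?_
      split_ifs with hk
      · rw [hl _ hk]
      · rfl
    by_cases hex : ∀ i, v i ≠ a
    · simp [hex]
    · push Not at hex
      obtain ⟨i, hi⟩ := hex
      have h1 : ∑ j : Fin (m + 2), (if v j = a then A a (v 0) * pathProd A v else 0)
          = A a (v 0) * pathProd A v := by
        rw [Finset.sum_eq_single i]
        · rw [if_pos hi]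
        · intro j _ hj
          rw [if_neg fun h' => hj (h.1 (h'.trans hi.symm))]
        · simp
      have hne : ¬ ∀ i, v i ≠ a := fun h' => h' i hi
      rw [if_neg hne, zero_add]
      exact h1.symm.trans hsum
  · have hl : ∀ k : Fin m, (if Function.Injective v ∧ v k.succ.succ = a ∧ v (Fin.last (m + 1)) = b
        then ∏ e, A (v (lassoSrc k.succ.succ e)) (v (lassoTgt e)) else 0) = 0 := fun k =>
      if_neg fun h' => h ⟨h'.1, h'.2.2⟩
    rw [Finset.sum_congr rfl fun k _ => hl k]
    simp [h]

theorem pathSum_zero (A : ι → ι → ℂ) {S : Finset ι} [DecidableEq ι] {a : ι} (ha : a ∈ S) (b : ι) :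
    pathSum A S 0 a b = if a = b then 1 else 0 := by
  classical
  rw [pathSum, walkSum, sum_piFinset_cons, Finset.sum_eq_single_of_mem a ha]
  · rw [Finset.sum_eq_single_of_mem default (by simp)]
    · have : Function.Injective (Fin.cons a default : Fin 1 → ι) :=
        fun i j _ => Subsingleton.elim (α := Fin 1) i j
      have hl : (Fin.cons a default : Fin 1 → ι) (Fin.last 0) = a := rfl
      simp [this]
    · intro v _ hv; exact absurd (Subsingleton.elim _ _) hv
  · intro u _ hu
    refine Finset.sum_eq_zero fun v _ => if_neg fun h => hu h.2.1

theorem pathSum_one (A : ι → ι → ℂ) (hA : ∀ a, A a a = 0) {S : Finset ι} {a b : ι} (ha : a ∈ S)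
    (hb : b ∈ S) : pathSum A S 1 a b = A a b := by
  classical
  rw [pathSum_succ A 0 ha, sum_piFinset_cons, Finset.sum_eq_single_of_mem b hb]
  · rw [Finset.sum_eq_single_of_mem default (by simp)]
    · have : Function.Injective (Fin.cons b default : Fin 1 → ι) :=
        fun i j _ => Subsingleton.elim (α := Fin 1) i j
      have hl : (Fin.cons b default : Fin 1 → ι) (Fin.last 0) = b := rfl
      by_cases hab : b = a
      · subst hab; simp [hA]
      · have hall : ∀ i : Fin 1, (Fin.cons b default : Fin 1 → ι) i ≠ a := fun i => by
          rw [Subsingleton.elim i 0]; exact hab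
        rw [if_pos ⟨⟨this, hl⟩, hall⟩]
        simp [pathProd]
    · intro v _ hv; exact absurd (Subsingleton.elim _ _) hv
  · intro u _ hu
    refine Finset.sum_eq_zero fun v _ => if_neg fun h => hu h.1.2

theorem pathSum_self (A : ι → ι → ℂ) (S : Finset ι) {m : ℕ} (hm : 1 ≤ m) (a : ι) :
    pathSum A S m a a = 0 := by
  classical
  refine Finset.sum_eq_zero fun v _ => if_neg fun h => ?_
  have := congrArg Fin.val (h.1 (h.2.1.trans h.2.2.symm))
  simp at this
  omega

end Recursion

/-! ### Concentration of the diagonal -/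

section Diagonal

variable {ι : Type*}

open Classical in
theorem sum_powersetCard_sum_sum (D : Finset ι) (n : ℕ) (h : ι → ι → ℝ) :
    ∑ S ∈ D.powersetCard n, ∑ x ∈ S, ∑ u ∈ S, h x u
      = ∑ x ∈ D, ∑ u ∈ D, countSupersets D n {x, u} * h x u := by
  have e : ∀ S ∈ D.powersetCard n, ∑ x ∈ S, ∑ u ∈ S, h x u
      = ∑ x ∈ D, ∑ u ∈ D, if {x, u} ⊆ S then h x u else 0 := by
    intro S hS
    have hSD := (Finset.mem_powersetCard.1 hS).1
    rw [← Finset.sum_subset hSD]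
    · refine Finset.sum_congr rfl fun x hx => ?_
      rw [← Finset.sum_subset hSD]
      · refine Finset.sum_congr rfl fun u hu => ?_
        rw [if_pos]
        simp [Finset.insert_subset_iff, hx, hu]
      · intro u _ hu
        rw [if_neg]
        simp [Finset.insert_subset_iff, hu]
    · intro x _ hx
      refine Finset.sum_eq_zero fun u _ => ?_
      rw [if_neg]
      simp [Finset.insert_subset_iff, hx]
  rw [Finset.sum_congr rfl e, Finset.sum_comm]
  refine Finset.sum_congr rfl fun x _ => ?_
  rw [Finset.sum_comm]
  refine Finset.sum_congr rfl fun u _ => ?_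
  rw [← Finset.sum_filter, Finset.sum_const, nsmul_eq_mul, countSupersets]

open Classical in
theorem sum_powersetCard_sum_sum_sum (D : Finset ι) (n : ℕ) (h : ι → ι → ι → ℝ) :
    ∑ S ∈ D.powersetCard n, ∑ x ∈ S, ∑ u ∈ S, ∑ v ∈ S, h x u v
      = ∑ x ∈ D, ∑ u ∈ D, ∑ v ∈ D, countSupersets D n {x, u, v} * h x u v := by
  have e : ∀ S ∈ D.powersetCard n, ∑ x ∈ S, ∑ u ∈ S, ∑ v ∈ S, h x u v
      = ∑ x ∈ S, ∑ u ∈ S, ∑ v ∈ D, if v ∈ S then h x u v else 0 := by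
    intro S hS
    have hSD := (Finset.mem_powersetCard.1 hS).1
    refine Finset.sum_congr rfl fun x _ => Finset.sum_congr rfl fun u _ => ?_
    rw [← Finset.sum_filter, Finset.filter_mem_eq_inter, Finset.inter_eq_right.2 hSD]
  have e2 : ∀ S ∈ D.powersetCard n, ∑ x ∈ S, ∑ u ∈ S, ∑ v ∈ S, h x u v
      = ∑ x ∈ D, ∑ u ∈ D, ∑ v ∈ D, if {x, u, v} ⊆ S then h x u v else 0 := by
    intro S hS
    have hSD := (Finset.mem_powersetCard.1 hS).1
    rw [e S hS, ← Finset.sum_subset hSD]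
    · refine Finset.sum_congr rfl fun x hx => ?_
      rw [← Finset.sum_subset hSD]
      · refine Finset.sum_congr rfl fun u hu => Finset.sum_congr rfl fun v _ => ?_
        refine if_congr ?_ rfl rfl
        simp [Finset.insert_subset_iff, hx, hu]
      · intro u _ hu
        refine Finset.sum_eq_zero fun v _ => ?_
        rw [if_neg]
        simp [Finset.insert_subset_iff, hu]
    · intro x _ hx
      refine Finset.sum_eq_zero fun u _ => Finset.sum_eq_zero fun v _ => ?_
      rw [if_neg]
      simp [Finset.insert_subset_iff, hx]
  rw [Finset.sum_congr rfl e2, Finset.sum_comm]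
  refine Finset.sum_congr rfl fun x _ => ?_
  rw [Finset.sum_comm]
  refine Finset.sum_congr rfl fun u _ => ?_
  rw [Finset.sum_comm]
  refine Finset.sum_congr rfl fun v _ => ?_
  rw [← Finset.sum_filter, Finset.sum_const, nsmul_eq_mul, countSupersets]

/-- The row sums of a random `n`-element principal submatrix of the symmetric array `g` concentrate
at `1`, if its full row sums are `(N - p) / n`, where `N = |D|`, and its entries are `O(1 / n)`. -/
theorem sum_sq_sum_sub_one_le {D : Finset ι} {n : ℕ} {p c : ℝ} {g : ι → ι → ℝ} (hn : 1 ≤ n)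
    (hp : 0 ≤ p) (hpN : p ≤ D.card) (hnN : n ≤ D.card) (h0 : ∀ x u, 0 ≤ g x u)
    (hxx : ∀ x, g x x = 0) (hrow : ∀ x ∈ D, ∑ u ∈ D, g x u = (D.card - p) / n)
    (hc : ∀ x ∈ D, ∀ u ∈ D, g x u ≤ c / n) :
    ∑ S ∈ D.powersetCard n, ∑ x ∈ S, (∑ u ∈ S, g x u - 1) ^ 2
      ≤ (D.powersetCard n).card * (c ^ 2 + 2 + 2 * n * (p / D.card)) := by
  classical
  set N : ℝ := (D.card : ℝ) with hN
  set M : ℝ := ((D.powersetCard n).card : ℝ) with hM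
  have hn0 : (0 : ℝ) < n := by exact_mod_cast hn
  have hn1 : (1 : ℝ) ≤ n := by exact_mod_cast hn
  have hnN' : (n : ℝ) ≤ N := by rw [hN]; exact_mod_cast hnN
  have hN0 : 0 < N := by linarith
  have hM0 : 0 ≤ M := by positivity
  have hcount : ∀ W : Finset ι, W ⊆ D → (countSupersets D n W : ℝ) ≤ M * (n / N) ^ W.card := by
    intro W hW
    rw [div_pow, ← mul_div_assoc, le_div_iff₀ (by positivity)]
    have h := countSupersets_mul_pow_le hW hnN
    rw [hN, hM]
    exact_mod_cast h
  have hsub2 : ∀ x ∈ D, ∀ u ∈ D, ({x, u} : Finset ι) ⊆ D := fun x hx u hu => by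
    simp [Finset.insert_subset_iff, hx, hu]
  -- the mean of the row sums
  have hfirst : M * ((1 - p / N) * (n - 1))
      ≤ ∑ S ∈ D.powersetCard n, ∑ x ∈ S, ∑ u ∈ S, g x u := by
    rw [sum_powersetCard_sum_sum]
    have hle : ∀ x ∈ D, ∀ u ∈ D, M * (n * (n - 1) / N ^ 2) * g x u
        ≤ countSupersets D n {x, u} * g x u := by
      intro x hx u hu
      by_cases hxu : x = u
      · simp [hxu, hxx]
      · refine mul_le_mul_of_nonneg_right ?_ (h0 x u)
        have h := countSupersets_mul_choose (n := n) (hsub2 x hx u hu)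
        rw [Finset.card_pair hxu] at h
        have h' : (countSupersets D n {x, u} : ℝ) * (D.card.choose 2 : ℕ)
            = M * (n.choose 2 : ℕ) := by rw [hM]; exact_mod_cast h
        rw [Nat.cast_choose_two, Nat.cast_choose_two, ← hN] at h'
        rw [← mul_div_assoc, div_le_iff₀ (by positivity)]
        have h0 : (0 : ℝ) ≤ countSupersets D n {x, u} := by positivity
        nlinarith
    calc M * ((1 - p / N) * (n - 1))
        = ∑ x ∈ D, ∑ u ∈ D, M * (n * (n - 1) / N ^ 2) * g x u := by
          simp_rw [← Finset.mul_sum]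
          rw [Finset.sum_congr rfl hrow, Finset.sum_const, nsmul_eq_mul, ← hN]
          field_simp
      _ ≤ _ := Finset.sum_le_sum fun x hx => Finset.sum_le_sum fun u hu => hle x hx u hu
  -- their mean square
  have hsecond : ∑ S ∈ D.powersetCard n, ∑ x ∈ S, ∑ u ∈ S, ∑ v ∈ S, g x u * g x v
      ≤ M * (c ^ 2 + n) := by
    rw [sum_powersetCard_sum_sum_sum]
    have hle : ∀ x ∈ D, ∀ u ∈ D, ∀ v ∈ D, countSupersets D n {x, u, v} * (g x u * g x v)
        ≤ M * (n / N) ^ 3 * (g x u * g x v)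
          + if u = v then M * (n / N) ^ 2 * (c / n) ^ 2 else 0 := by
      intro x hx u hu v hv
      have hz : 0 ≤ M * (n / N) ^ 3 * (g x u * g x v) := by
        have := h0 x u; have := h0 x v; positivity
      by_cases hxu : x = u
      · rw [← hxu, hxx]; simp only [zero_mul, mul_zero, zero_add]; split_ifs <;> positivity
      by_cases hxv : x = v
      · rw [← hxv, hxx]; simp only [mul_zero, zero_add]; split_ifs <;> positivity
      by_cases huv : u = v
      · subst huv
        rw [if_pos rfl]
        refine le_add_of_nonneg_of_le hz ?_
        have h2 := hcount _ (hsub2 x hx u hu)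
        rw [Finset.card_pair hxu] at h2
        rw [Finset.pair_eq_singleton u, ← sq]
        exact mul_le_mul h2 (pow_le_pow_left₀ (h0 x u) (hc x hx u hu) 2) (by positivity)
          (by positivity)
      · rw [if_neg huv, add_zero]
        have h3 := hcount {x, u, v} (by simp [Finset.insert_subset_iff, hx, hu, hv])
        rw [Finset.card_eq_three.2 ⟨x, u, v, hxu, hxv, huv, rfl⟩] at h3
        exact mul_le_mul_of_nonneg_right h3 (mul_nonneg (h0 x u) (h0 x v))
    have hdiag : ∀ x ∈ D, ∑ u ∈ D, ∑ v ∈ D, (M * (n / N) ^ 3 * (g x u * g x v)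
          + if u = v then M * (n / N) ^ 2 * (c / n) ^ 2 else 0)
        = M * (n / N) ^ 3 * ((N - p) / n) ^ 2 + N * (M * (n / N) ^ 2 * (c / n) ^ 2) := by
      intro x hx
      simp_rw [Finset.sum_add_distrib, ← Finset.mul_sum, ← Finset.sum_mul, hrow x hx, ← sq,
        Finset.sum_ite_eq]
      congr 1
      rw [Finset.sum_congr rfl fun u hu => if_pos hu, Finset.sum_const, nsmul_eq_mul]
    calc _ ≤ ∑ x ∈ D, ∑ u ∈ D, ∑ v ∈ D, (M * (n / N) ^ 3 * (g x u * g x v)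
          + if u = v then M * (n / N) ^ 2 * (c / n) ^ 2 else 0) :=
        Finset.sum_le_sum fun x hx => Finset.sum_le_sum fun u hu => Finset.sum_le_sum fun v hv =>
          hle x hx u hu v hv
      _ = M * (c ^ 2 + n * ((N - p) / N) ^ 2) := by
        rw [Finset.sum_congr rfl hdiag, Finset.sum_const, nsmul_eq_mul, ← hN]
        field_simp
        ring
      _ ≤ M * (c ^ 2 + n * 1) := by
        have h1 : 0 ≤ (N - p) / N := div_nonneg (by linarith) hN0.le
        have h2 : (N - p) / N ≤ 1 := (div_le_one hN0).2 (by linarith)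
        gcongr
        exact pow_le_one₀ h1 h2
      _ = _ := by rw [mul_one]
  have hexp : ∑ S ∈ D.powersetCard n, ∑ x ∈ S, (∑ u ∈ S, g x u - 1) ^ 2
      = ∑ S ∈ D.powersetCard n, ∑ x ∈ S, ∑ u ∈ S, ∑ v ∈ S, g x u * g x v
        - 2 * ∑ S ∈ D.powersetCard n, ∑ x ∈ S, ∑ u ∈ S, g x u + M * n := by
    have hcard : M * n = ∑ S ∈ D.powersetCard n, ∑ _x ∈ S, (1 : ℝ) := by
      rw [Finset.sum_congr rfl (g := fun _ => (n : ℝ)) fun S hS => by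
        rw [Finset.sum_const, nsmul_eq_mul, (Finset.mem_powersetCard.1 hS).2, mul_one],
        Finset.sum_const, nsmul_eq_mul]
    rw [hcard, Finset.mul_sum, ← Finset.sum_sub_distrib, ← Finset.sum_add_distrib]
    refine Finset.sum_congr rfl fun S _ => ?_
    rw [Finset.mul_sum, ← Finset.sum_sub_distrib, ← Finset.sum_add_distrib]
    refine Finset.sum_congr rfl fun x _ => ?_
    rw [← Finset.sum_mul_sum]
    ring
  rw [hexp]
  have h1 : 0 ≤ M * (p / N) := by positivity
  nlinarith

/-- The tight frame identity gives the row sums of the squared kernel, coherence its entries. -/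
theorem normSq_offDiag {D : Finset ι} {K : ι → ι → ℂ} {p μ : ℝ} (hK : IsIncoherentFrame D K p μ)
    (hp : 0 < p) {n : ℕ} (hn : 1 ≤ n) {x : ι} (hx : x ∈ D) :
    (∑ u ∈ D, ‖offDiag K √(p / n) x u‖ ^ 2 = (D.card - p) / n) ∧
      ∀ u ∈ D, ‖offDiag K √(p / n) x u‖ ^ 2 ≤ μ ^ 2 / n := by
  classical
  have hn0 : (0 : ℝ) < n := by exact_mod_cast hn
  have hsq : ∀ u, ‖offDiag K √(p / n) x u‖ ^ 2 = if x = u then 0 else p / n * ‖K x u‖ ^ 2 := by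
    intro u
    rw [offDiag]
    split_ifs
    · simp
    · rw [norm_mul, mul_pow, Complex.norm_real, Real.norm_eq_abs, sq_abs,
        Real.sq_sqrt (by positivity)]
  constructor
  · have h := hK.sum_mul x hx x hx
    have h' : ∑ u ∈ D, ‖K x u‖ ^ 2 = D.card / p := by
      rw [hK.self x hx, mul_one] at h
      have e : ∀ u, K x u * K u x = ((‖K x u‖ ^ 2 : ℝ) : ℂ) := fun u => by
        rw [← hK.conj_symm x u, Complex.mul_conj']; push_cast; rfl
      simp_rw [e, ← Complex.ofReal_sum] at h
      exact_mod_cast h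
    simp_rw [hsq]
    have e : ∀ u, (if x = u then 0 else p / n * ‖K x u‖ ^ 2)
        = p / n * ‖K x u‖ ^ 2 - if x = u then p / n * ‖K x u‖ ^ 2 else 0 := fun u => by
      split_ifs <;> simp
    simp_rw [e]
    rw [Finset.sum_sub_distrib, ← Finset.mul_sum, h', Finset.sum_ite_eq, if_pos hx, hK.self x hx]
    simp
    field_simp
  · intro u hu
    rw [hsq]
    split_ifs with h
    · positivity
    · have h1 := hK.norm_le x hx u hu h
      have h2 := pow_le_pow_left₀ (norm_nonneg _) h1 2
      rw [div_pow, Real.sq_sqrt hp.le] at h2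
      calc p / n * ‖K x u‖ ^ 2 ≤ p / n * (μ ^ 2 / p) := by gcongr
        _ = μ ^ 2 / n := by field_simp

end Diagonal

/-! ### Diagonal coefficients in an eigenbasis -/

section QuadraticForm

variable {J : Type*} [Fintype J] {n : ℕ}

/-- The diagonal matrix coefficients of `M` in the orthonormal basis `b`. -/
noncomputable def diagCoeff (b : OrthonormalBasis (Fin n) ℂ (EuclideanSpace ℂ J)) (M : J → J → ℂ)
    (i : Fin n) : ℂ :=
  ∑ a, (starRingEnd ℂ) (b i a) * ∑ c, M a c * b i c

/-- The square of the Hilbert-Schmidt norm of the principal submatrix of `M` on `S`. -/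
noncomputable def hsSq {ι : Type*} (S : Finset ι) (M : ι → ι → ℂ) : ℝ :=
  ∑ a ∈ S, ∑ c ∈ S, ‖M a c‖ ^ 2

theorem hsSq_nonneg {ι : Type*} (S : Finset ι) (M : ι → ι → ℂ) : 0 ≤ hsSq S M :=
  Finset.sum_nonneg fun _ _ => Finset.sum_nonneg fun _ _ => sq_nonneg _

/-- Parseval's identity for a row vector `r`. -/
theorem sum_normSq_row (b : OrthonormalBasis (Fin n) ℂ (EuclideanSpace ℂ J)) (r : J → ℂ) :
    ∑ i, ‖∑ c, r c * b i c‖ ^ 2 = ∑ c, ‖r c‖ ^ 2 := by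
  have h := b.sum_sq_norm_inner_right (WithLp.toLp 2 fun c => (starRingEnd ℂ) (r c))
  rw [EuclideanSpace.norm_sq_eq] at h
  simp only [RCLike.norm_conj] at h
  rw [← h]
  refine Finset.sum_congr rfl fun i _ => ?_
  rw [PiLp.inner_apply, ← RCLike.norm_conj, map_sum]
  simp [RCLike.inner_apply]

theorem sum_normSq_coord (b : OrthonormalBasis (Fin n) ℂ (EuclideanSpace ℂ J)) (a : J) :
    ∑ i, ‖b i a‖ ^ 2 = 1 := by
  classical
  have h := sum_normSq_row b fun c => if c = a then 1 else 0
  simpa [ite_mul, apply_ite norm, ite_pow] using h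

theorem sum_conj_mul_self (b : OrthonormalBasis (Fin n) ℂ (EuclideanSpace ℂ J)) (i : Fin n) :
    ∑ a, (starRingEnd ℂ) (b i a) * b i a = 1 := by
  have h : ∑ a, ‖b i a‖ ^ 2 = 1 := by
    rw [← EuclideanSpace.norm_sq_eq, b.norm_eq_one, one_pow]
  simp_rw [Complex.conj_mul']
  exact_mod_cast h

theorem sum_conj_mul_coord [DecidableEq J] (b : OrthonormalBasis (Fin n) ℂ (EuclideanSpace ℂ J))
    (a c : J) : ∑ i, (starRingEnd ℂ) (b i a) * b i c = if a = c then 1 else 0 := by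
  have h := b.sum_inner_mul_inner (EuclideanSpace.single c (1 : ℂ)) (EuclideanSpace.single a 1)
  simp only [EuclideanSpace.inner_single_left, EuclideanSpace.inner_single_right, map_one,
    one_mul] at h
  rw [Finset.sum_congr rfl fun i _ => mul_comm _ _, h]
  simp

theorem sum_diagCoeff (b : OrthonormalBasis (Fin n) ℂ (EuclideanSpace ℂ J)) (M : J → J → ℂ) :
    ∑ i, diagCoeff b M i = ∑ a, M a a := by
  classical
  unfold diagCoeff
  simp_rw [Finset.mul_sum]
  rw [Finset.sum_comm]
  refine Finset.sum_congr rfl fun a _ => ?_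
  rw [Finset.sum_comm]
  have : ∀ c, ∑ i, (starRingEnd ℂ) (b i a) * (M a c * b i c) = if a = c then M a c else 0 := by
    intro c
    simp_rw [mul_left_comm _ (M a c)]
    rw [← Finset.mul_sum, sum_conj_mul_coord, mul_ite, mul_one, mul_zero]
  simp_rw [this]
  simp

/-- The Cauchy-Schwarz inequality for the diagonal coefficients of a matrix whose rows are
multiplied by the entries of `d`. -/
theorem sum_norm_diagCoeff_mul_le (b : OrthonormalBasis (Fin n) ℂ (EuclideanSpace ℂ J)) (d : J → ℝ)
    (M : J → J → ℂ) :
    ∑ i, ‖diagCoeff b (fun a c => d a * M a c) i‖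
      ≤ √(∑ a, d a ^ 2) * √(∑ a, ∑ c, ‖M a c‖ ^ 2) := by
  have h1 : ∀ i, ‖diagCoeff b (fun a c => d a * M a c) i‖
      ≤ ∑ a, (|d a| * ‖b i a‖) * ‖∑ c, M a c * b i c‖ := by
    intro i
    refine (norm_sum_le _ _).trans (Finset.sum_le_sum fun a _ => ?_)
    simp_rw [mul_assoc, ← Finset.mul_sum]
    rw [norm_mul, norm_mul, RCLike.norm_conj, Complex.norm_real, Real.norm_eq_abs]
    exact le_of_eq (by ring)
  refine (Finset.sum_le_sum fun i _ => h1 i).trans ?_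
  rw [← Finset.sum_product']
  refine (Real.sum_mul_le_sqrt_mul_sqrt _ _ _).trans (le_of_eq ?_)
  congr 2
  · rw [Finset.sum_product_right]
    refine Finset.sum_congr rfl fun a _ => ?_
    simp_rw [mul_pow, sq_abs]
    rw [← Finset.mul_sum, sum_normSq_coord, mul_one]
  · rw [Finset.sum_product_right]
    exact Finset.sum_congr rfl fun a _ => sum_normSq_row b (M a)

theorem sum_normSq_diagCoeff_le (b : OrthonormalBasis (Fin n) ℂ (EuclideanSpace ℂ J))
    (M : J → J → ℂ) : ∑ i, ‖diagCoeff b M i‖ ^ 2 ≤ ∑ a, ∑ c, ‖M a c‖ ^ 2 := by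
  have h1 : ∀ i, ‖diagCoeff b M i‖ ^ 2 ≤ ∑ a, ‖∑ c, M a c * b i c‖ ^ 2 := by
    intro i
    have hb : ∑ a, ‖b i a‖ ^ 2 = 1 := by
      rw [← EuclideanSpace.norm_sq_eq, b.norm_eq_one, one_pow]
    have h : ‖diagCoeff b M i‖ ≤ ∑ a, ‖b i a‖ * ‖∑ c, M a c * b i c‖ := by
      refine (norm_sum_le _ _).trans (le_of_eq ?_)
      exact Finset.sum_congr rfl fun a _ => by rw [norm_mul, RCLike.norm_conj]
    calc _ ≤ (∑ a, ‖b i a‖ * ‖∑ c, M a c * b i c‖) ^ 2 := pow_le_pow_left₀ (norm_nonneg _) h 2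
      _ ≤ (∑ a, ‖b i a‖ ^ 2) * ∑ a, ‖∑ c, M a c * b i c‖ ^ 2 :=
        Finset.sum_mul_sq_le_sq_mul_sq _ _ _
      _ = _ := by rw [hb, one_mul]
  refine (Finset.sum_le_sum fun i _ => h1 i).trans (le_of_eq ?_)
  rw [Finset.sum_comm]
  exact Finset.sum_congr rfl fun a _ => sum_normSq_row b _

theorem diagCoeff_add (b : OrthonormalBasis (Fin n) ℂ (EuclideanSpace ℂ J)) (M M' : J → J → ℂ)
    (i : Fin n) :
    diagCoeff b (fun a c => M a c + M' a c) i = diagCoeff b M i + diagCoeff b M' i := by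
  simp [diagCoeff, add_mul, mul_add, Finset.sum_add_distrib]

theorem diagCoeff_sub (b : OrthonormalBasis (Fin n) ℂ (EuclideanSpace ℂ J)) (M M' : J → J → ℂ)
    (i : Fin n) :
    diagCoeff b (fun a c => M a c - M' a c) i = diagCoeff b M i - diagCoeff b M' i := by
  simp [diagCoeff, sub_mul, mul_sub, Finset.sum_sub_distrib]

theorem diagCoeff_sum {κ : Type*} (b : OrthonormalBasis (Fin n) ℂ (EuclideanSpace ℂ J))
    (s : Finset κ) (M : κ → J → J → ℂ) (i : Fin n) :
    diagCoeff b (fun a c => ∑ k ∈ s, M k a c) i = ∑ k ∈ s, diagCoeff b (M k) i := by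
  classical
  induction s using Finset.induction_on with
  | empty => simp [diagCoeff]
  | insert k s hk ih => simp only [Finset.sum_insert hk, diagCoeff_add, ih]

/-- In an eigenbasis of the Hermitian matrix `A`, the diagonal coefficients of `A * M` are those of
`M` multiplied by the eigenvalues. -/
theorem diagCoeff_mul_left (b : OrthonormalBasis (Fin n) ℂ (EuclideanSpace ℂ J)) {A : J → J → ℂ}
    (hA : ∀ a c, (starRingEnd ℂ) (A a c) = A c a) {lam : Fin n → ℝ}
    (hb : ∀ i a, ∑ c, A a c * b i c = lam i * b i a) (M : J → J → ℂ) (i : Fin n) :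
    diagCoeff b (fun a c => ∑ u, A a u * M u c) i = lam i * diagCoeff b M i := by
  have h : ∀ u, ∑ a, (starRingEnd ℂ) (b i a) * A a u = lam i * (starRingEnd ℂ) (b i u) := by
    intro u
    have := congrArg (starRingEnd ℂ) (hb i u)
    rw [map_sum, map_mul, Complex.conj_ofReal] at this
    rw [← this]
    exact Finset.sum_congr rfl fun a _ => by rw [map_mul, hA, mul_comm]
  unfold diagCoeff
  have e : ∀ a, (starRingEnd ℂ) (b i a) * ∑ c, (∑ u, A a u * M u c) * b i c
      = ∑ u, (starRingEnd ℂ) (b i a) * A a u * ∑ c, M u c * b i c := by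
    intro a
    simp_rw [mul_assoc, ← Finset.mul_sum, Finset.sum_mul, Finset.mul_sum]
    rw [Finset.sum_comm]
    simp_rw [mul_assoc]
  rw [Finset.sum_congr rfl fun a _ => e a, Finset.sum_comm, Finset.mul_sum]
  refine Finset.sum_congr rfl fun u _ => ?_
  rw [← Finset.sum_mul, h, mul_assoc]

end QuadraticForm

/-! ### The spectrum of the normalized error -/

section Spectrum

variable {p : ℕ} [Fact p.Prime]

/-- The kernel of the normalized error, indexed by all signals. -/
noncomputable def errorKernel (p n : ℕ) [Fact p.Prime] : Signal p → Signal p → ℂ :=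
  offDiag (fun a b => inner ℂ a b) √((p : ℝ) / n)

theorem errorKernel_self (n : ℕ) (a : Signal p) : errorKernel p n a a = 0 := if_pos rfl

theorem conj_errorKernel (n : ℕ) (a b : Signal p) :
    (starRingEnd ℂ) (errorKernel p n a b) = errorKernel p n b a := by
  classical
  unfold errorKernel offDiag
  by_cases h : a = b
  · simp [h]
  · rw [if_neg h, if_neg (Ne.symm h), map_mul, Complex.conj_ofReal, inner_conj_symm]

theorem gramOp_apply (S : Finset (Signal p)) (f : EuclideanSpace ℂ S) (a : S) :
    gramOp S f a = ∑ u : S, inner ℂ (a : Signal p) (u : Signal p) * f u := by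
  classical
  have h1 : inner ℂ (EuclideanSpace.single a (1 : ℂ)) (gramOp S f) = gramOp S f a := by
    simp [EuclideanSpace.inner_single_left]
  have h2 : resolution S (EuclideanSpace.single a (1 : ℂ)) = (a : Signal p) := by
    simp [resolution, ite_smul]
  rw [← h1, gramOp, LinearMap.comp_apply, LinearMap.adjoint_inner_right, h2]
  simp only [resolution, LinearMap.coe_mk, AddHom.coe_mk, inner_sum, inner_smul_right]
  exact Finset.sum_congr rfl fun u _ => mul_comm _ _

theorem normalizedError_apply {S : Finset (Signal p)} (hS : ∀ a ∈ S, ‖a‖ = 1)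
    (f : EuclideanSpace ℂ S) (a : S) :
    normalizedError S f a = ∑ u : S, errorKernel p S.card a u * f u := by
  classical
  have h : ∀ u : S, errorKernel p S.card a u * f u
      = (√((p : ℝ) / S.card) : ℝ) * (inner ℂ (a : Signal p) (u : Signal p) * f u
        - if a = u then f u else 0) := by
    intro u
    unfold errorKernel offDiag
    by_cases hau : a = u
    · subst hau
      rw [if_pos rfl, if_pos rfl, inner_self_eq_norm_sq_to_K, hS a a.2]
      simp
    · rw [if_neg fun h => hau (Subtype.ext h), if_neg hau, sub_zero, mul_assoc]
  rw [Finset.sum_congr rfl fun u _ => h u, ← Finset.mul_sum, Finset.sum_sub_distrib,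
    ← gramOp_apply, Finset.sum_ite_eq, if_pos (Finset.mem_univ a)]
  simp [normalizedError]

theorem exists_eigenbasis {S : Finset (Signal p)} (hS : ∀ a ∈ S, ‖a‖ = 1) :
    ∃ b : OrthonormalBasis (Fin S.card) ℂ (EuclideanSpace ℂ S), ∀ i (a : S),
      ∑ u : S, errorKernel p S.card a u * b i u = errorEigenvalues S i * b i a := by
  have hfin : Module.finrank ℂ (EuclideanSpace ℂ S) = S.card := by simp
  refine ⟨(normalizedError_isSymmetric S).eigenvectorBasis hfin, fun i a => ?_⟩
  rw [← normalizedError_apply hS, LinearMap.IsSymmetric.apply_eigenvectorBasis]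
  rfl

theorem integral_spectralDistribution (S : Finset (Signal p)) (f : ℝ →ᵇ ℝ) :
    ∫ x, f x ∂(spectralDistribution S) = mean fun i => f (errorEigenvalues S i) := by
  rw [spectralDistribution, integral_smul_measure, integral_finsetSum_measure]
  · simp [mean, div_eq_inv_mul]
  · exact fun i _ => f.integrable _

/-- The total size of the error terms in the three-term recursion for self-avoiding paths of
length `m + 1`. -/
noncomputable def recursionError {ι : Type*} (A : ι → ι → ℂ) (S : Finset ι) (m : ℕ) : ℝ :=
  ∑ k : Fin m, (hsSq S (walkSum A S (lassoSrc k.succ.succ) lassoTgt k.succ.succ (Fin.last (m + 1)))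
      + hsSq S (walkSum A S (detourSrc k.succ) (detourTgt k.succ) 0 (Fin.last m)))
    + ∑ a ∈ S, (∑ u ∈ S, ‖A a u‖ ^ 2 - 1) ^ 2

/-- The matrix coefficients of the path sums in an eigenbasis satisfy the Chebyshev recursion up to
an error controlled by `recursionError`. -/
theorem mean_norm_recursion_le {ι : Type*} {A : ι → ι → ℂ} (hA0 : ∀ a, A a a = 0)
    (hA : ∀ a b, (starRingEnd ℂ) (A a b) = A b a) {S : Finset ι} (hS : 0 < S.card)
    (b : OrthonormalBasis (Fin S.card) ℂ (EuclideanSpace ℂ S)) {lam : Fin S.card → ℝ}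
    (hb : ∀ i (a : S), ∑ u : S, A a u * b i u = lam i * b i a) {m : ℕ} {C τ : ℝ} (hτ : 0 ≤ τ)
    (hC : hsSq S (pathSum A S m) ≤ C * S.card) (herr : recursionError A S m ≤ τ ^ 2 * S.card) :
    (mean fun i => ‖lam i * diagCoeff b (fun a c : S => pathSum A S (m + 1) a c) i
        - diagCoeff b (fun a c : S => pathSum A S (m + 2) a c) i
        - diagCoeff b (fun a c : S => pathSum A S m a c) i‖) ≤ τ * (2 * m + √C) := by
  classical
  have hn : (0 : ℝ) < S.card := by exact_mod_cast hS
  set L : Fin m → ι → ι → ℂ := fun k =>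
    walkSum A S (lassoSrc k.succ.succ) lassoTgt k.succ.succ (Fin.last (m + 1)) with hL
  set T : Fin m → ι → ι → ℂ := fun k =>
    walkSum A S (detourSrc k.succ) (detourTgt k.succ) 0 (Fin.last m) with hT
  set d : S → ℝ := fun a => ∑ u ∈ S, ‖A a u‖ ^ 2 - 1 with hd
  have hcoe : ∀ M : ι → ι → ℂ, ∑ a : S, ∑ c : S, ‖M a c‖ ^ 2 = hsSq S M := by
    intro M
    rw [hsSq, ← Finset.sum_coe_sort S]
    exact Finset.sum_congr rfl fun a _ => Finset.sum_coe_sort S fun c => ‖M a c‖ ^ 2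
  have hdsq : ∑ a, d a ^ 2 = ∑ a ∈ S, (∑ u ∈ S, ‖A a u‖ ^ 2 - 1) ^ 2 :=
    Finset.sum_coe_sort S fun a => (∑ u ∈ S, ‖A a u‖ ^ 2 - 1) ^ 2
  have hbound : (∀ k, hsSq S (L k) ≤ τ ^ 2 * S.card) ∧ (∀ k, hsSq S (T k) ≤ τ ^ 2 * S.card) ∧
      ∑ a, d a ^ 2 ≤ τ ^ 2 * S.card := by
    have h0 : 0 ≤ ∑ a, d a ^ 2 := Finset.sum_nonneg fun a _ => sq_nonneg _
    have hsum : ∀ k, hsSq S (L k) + hsSq S (T k) ≤ ∑ k, (hsSq S (L k) + hsSq S (T k)) := fun k =>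
      Finset.single_le_sum (f := fun k => hsSq S (L k) + hsSq S (T k))
        (fun k _ => add_nonneg (hsSq_nonneg _ _) (hsSq_nonneg _ _)) (Finset.mem_univ k)
    have hsum0 : 0 ≤ ∑ k, (hsSq S (L k) + hsSq S (T k)) :=
      Finset.sum_nonneg fun k _ => add_nonneg (hsSq_nonneg _ _) (hsSq_nonneg _ _)
    rw [recursionError, ← hdsq] at herr
    refine ⟨fun k => ?_, fun k => ?_, ?_⟩
    · linarith [hsum k, hsSq_nonneg S (T k)]
    · linarith [hsum k, hsSq_nonneg S (L k)]
    · linarith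
  have hsqrt : ∀ {x : ℝ}, x ≤ τ ^ 2 * S.card → √x ≤ τ * √S.card := fun h =>
    (Real.sqrt_le_sqrt h).trans (le_of_eq (by rw [Real.sqrt_mul (sq_nonneg τ), Real.sqrt_sq hτ]))
  have hone : ∀ M : ι → ι → ℂ, hsSq S M ≤ τ ^ 2 * S.card →
      ∑ i, ‖diagCoeff b (fun a c : S => M a c) i‖ ≤ τ * S.card := by
    intro M hM
    have h := sum_norm_diagCoeff_mul_le b (fun _ => 1) fun a c : S => M a c
    simp only [Complex.ofReal_one, one_mul, one_pow, Finset.sum_const, Finset.card_univ,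
      Fintype.card_coe, nsmul_eq_mul, mul_one, hcoe] at h
    calc _ ≤ √S.card * √(hsSq S M) := h
      _ ≤ √S.card * (τ * √S.card) := by gcongr; exact hsqrt hM
      _ = τ * (√S.card * √S.card) := by ring
      _ = _ := by rw [Real.mul_self_sqrt hn.le]
  have hdiag : ∑ i, ‖diagCoeff b (fun a c : S => d a * pathSum A S m a c) i‖
      ≤ τ * √C * S.card := by
    calc _ ≤ √(∑ a, d a ^ 2) * √(hsSq S (pathSum A S m)) := by
          rw [← hcoe]; exact sum_norm_diagCoeff_mul_le b d fun a c : S => pathSum A S m a c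
      _ ≤ (τ * √S.card) * √(C * S.card) := by
          gcongr
          exact hsqrt hbound.2.2
      _ = τ * √C * (√S.card * √S.card) := by rw [Real.sqrt_mul' _ hn.le]; ring
      _ = _ := by rw [Real.mul_self_sqrt hn.le]
  have hrec : ∀ i, lam i * diagCoeff b (fun a c : S => pathSum A S (m + 1) a c) i
        - diagCoeff b (fun a c : S => pathSum A S (m + 2) a c) i
        - diagCoeff b (fun a c : S => pathSum A S m a c) i
      = diagCoeff b (fun a c : S => d a * pathSum A S m a c) i
        + ∑ k, (diagCoeff b (fun a c : S => L k a c) i - diagCoeff b (fun a c : S => T k a c) i) := by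
    intro i
    rw [← diagCoeff_mul_left b (A := fun a c : S => A a c) (fun a c => hA a c) hb, ← diagCoeff_sub,
      ← diagCoeff_sub]
    simp_rw [← diagCoeff_sub]
    rw [← diagCoeff_sum, ← diagCoeff_add]
    congr 1
    funext a c
    have h := sum_mul_pathSum_succ A hA0 m a.2 (c : ι)
    have hda : ∑ u ∈ S, A a u * A u a = ((d a + 1 : ℝ) : ℂ) := by
      rw [hd]
      simp only [sub_add_cancel]
      rw [Complex.ofReal_sum]
      refine Finset.sum_congr rfl fun u _ => ?_
      rw [← hA a u, Complex.mul_conj']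
      push_cast
      rfl
    rw [Finset.sum_coe_sort S fun u => A a u * pathSum A S (m + 1) u c, h, hda]
    push_cast
    ring
  rw [mean, div_le_iff₀ hn]
  calc _ ≤ ∑ i, (‖diagCoeff b (fun a c : S => d a * pathSum A S m a c) i‖
        + ∑ k, (‖diagCoeff b (fun a c : S => L k a c) i‖
          + ‖diagCoeff b (fun a c : S => T k a c) i‖)) := by
        refine Finset.sum_le_sum fun i _ => ?_
        rw [hrec]
        refine (norm_add_le _ _).trans (add_le_add_right ((norm_sum_le _ _).trans ?_) _)
        exact Finset.sum_le_sum fun k _ => norm_sub_le _ _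
    _ ≤ τ * √C * S.card + ∑ _k : Fin m, (τ * S.card + τ * S.card) := by
        rw [Finset.sum_add_distrib, Finset.sum_comm]
        refine add_le_add hdiag (Finset.sum_le_sum fun k _ => ?_)
        rw [Finset.sum_add_distrib]
        exact add_le_add (hone _ (hbound.1 k)) (hone _ (hbound.2.1 k))
    _ = _ := by
        rw [Finset.sum_const, Finset.card_univ, Fintype.card_fin, nsmul_eq_mul]
        ring

/-- The deterministic criterion: the spectral distribution is close to the semicircle if finitely
many path sums have bounded, and their recursion errors small, Hilbert-Schmidt norms. -/
theorem exists_forall_abs_integral_sub_lt (C : ℕ → ℝ) (f : ℝ →ᵇ ℝ) {η : ℝ} (hη : 0 < η) :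
    ∃ (τ : ℝ) (K : ℕ), 0 < τ ∧ ∀ (p : ℕ) [Fact p.Prime] (S : Finset (Signal p)), 0 < S.card →
      (∀ a ∈ S, ‖a‖ = 1) →
      (∀ m ≤ K, hsSq S (pathSum (errorKernel p S.card) S m) ≤ C m * S.card) →
      (∀ m ≤ K, recursionError (errorKernel p S.card) S m ≤ τ * S.card) →
      |∫ x, f x ∂(spectralDistribution S) - ∫ x, f x ∂semicircle| < η := by
  classical
  obtain ⟨δ, K, hδ, H⟩ := exists_forall_abs_mean_sub_lt C f hη
  set c : ℝ := 2 * K + ∑ m ∈ Finset.range (K + 1), √(C m) + 1 with hc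
  have hc0 : 0 < c := by positivity
  refine ⟨(δ / c) ^ 2, K, by positivity, fun p _ S hS hnorm hpath herr => ?_⟩
  obtain ⟨b, hb⟩ := exists_eigenbasis hnorm
  rw [integral_spectralDistribution]
  have hn : (0 : ℝ) < S.card := by exact_mod_cast hS
  have hA0 := errorKernel_self (p := p) S.card
  have hA := conj_errorKernel (p := p) S.card
  set A := errorKernel p S.card with hAdef
  refine H S.card _ (fun s i => diagCoeff b (fun a c : S => pathSum A S s a c) i) hS ?_ ?_ ?_ ?_ ?_
  · intro i
    have h1 : ∀ a c : S, pathSum A S 0 a c = if a = c then 1 else 0 := fun a c => by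
      rw [pathSum_zero A a.2]
      exact if_congr Subtype.coe_inj rfl rfl
    refine Eq.trans ?_ (sum_conj_mul_self b i)
    simp [diagCoeff, h1]
  · intro i
    have h1 : ∀ a c : S, pathSum A S 1 a c = A a c := fun a c => pathSum_one A hA0 a.2 c.2
    simp only [diagCoeff, h1, hb]
    simp_rw [mul_left_comm _ ((errorEigenvalues S i : ℝ) : ℂ)]
    rw [← Finset.mul_sum, sum_conj_mul_self, mul_one]
  · intro s hs
    rw [sum_diagCoeff]
    exact Finset.sum_eq_zero fun a _ => pathSum_self A S hs a
  · intro s hs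
    rw [mean, div_le_iff₀ hn]
    refine (sum_normSq_diagCoeff_le b _).trans (le_trans (le_of_eq ?_) (hpath s hs))
    rw [hsSq, ← Finset.sum_coe_sort S]
    exact Finset.sum_congr rfl fun a _ => Finset.sum_coe_sort S fun c => ‖pathSum A S s a c‖ ^ 2
  · intro s hs
    refine (mean_norm_recursion_le hA0 hA hS b hb (by positivity) (hpath s hs)
      (herr s hs)).trans ?_
    rw [div_mul_eq_mul_div, div_le_iff₀ hc0]
    refine mul_le_mul_of_nonneg_left ?_ hδ.le
    have h1 : √(C s) ≤ ∑ m ∈ Finset.range (K + 1), √(C m) :=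
      Finset.single_le_sum (f := fun m => √(C m)) (fun _ _ => Real.sqrt_nonneg _)
        (Finset.mem_range.2 (by omega))
    have h2 : (s : ℝ) ≤ K := by exact_mod_cast hs
    linarith

end Spectrum

/-! ### Expectations over random subsets -/

section Expectation

variable {ι : Type*} {D : Finset ι} {K : ι → ι → ℂ} {p μ δ : ℝ} {n : ℕ}

/-- A bound for the expectation of the square of the normalized Hilbert-Schmidt norm of the sum
over self-avoiding paths of length `m`. -/
noncomputable def pathBound (μ : ℝ) (m : ℕ) : ℝ := walkConst μ m (Fin m) + 1

theorem pathBound_pos (μ : ℝ) (m : ℕ) : 0 < pathBound μ m :=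
  add_pos (walkConst_pos _ _ _) one_pos

theorem sum_hsSq_pathSum_le
    (hK : IsIncoherentFrame D K p μ) (hμ : 0 ≤ μ) (hn : 1 ≤ n) (hnp : (n : ℝ) ≤ p)
    (hpN : p ≤ D.card) (hδρ : √(n / p) ≤ δ) (hδN : p / D.card ≤ δ) (hδn : (1 : ℝ) / n ≤ δ)
    (hδ1 : δ ≤ 1) (m : ℕ) :
    ∑ S ∈ D.powersetCard n, hsSq S (pathSum (offDiag K √(p / n)) S m)
      ≤ (D.powersetCard n).card * (pathBound μ m * n) := by
  classical
  have hw := walkConst_pos μ m (Fin m)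
  rcases Nat.eq_zero_or_pos m with rfl | hm
  · have h : ∀ S ∈ D.powersetCard n, hsSq S (pathSum (offDiag K √(p / n)) S 0) = n := by
      intro S hS
      have h1 : ∀ a ∈ S, ∑ c ∈ S, ‖pathSum (offDiag K √(p / n)) S 0 a c‖ ^ 2 = 1 := by
        intro a ha
        simp_rw [pathSum_zero _ ha, apply_ite norm, ite_pow]
        simp [ha]
      rw [hsSq, Finset.sum_congr rfl h1, Finset.sum_const, (Finset.mem_powersetCard.1 hS).2]
      simp
    rw [Finset.sum_congr rfl h, Finset.sum_const, nsmul_eq_mul]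
    refine mul_le_mul_of_nonneg_left ?_ (Nat.cast_nonneg _)
    rw [pathBound]
    have : (0 : ℝ) ≤ n := Nat.cast_nonneg n
    nlinarith
  · have : Nonempty (Fin m) := ⟨⟨0, hm⟩⟩
    refine (sum_normSq_walkSum_le hK hμ hn hnp hpN hδρ hδN hδn hδ1 (isWalk_path m)
      (Or.inl rfl)).trans ?_
    rw [mul_one, pathBound]
    gcongr
    linarith

/-- A bound for the expectation of the normalized error terms in the recursion, as a multiple of
the small parameter. -/
noncomputable def recursionBound (μ : ℝ) (m : ℕ) : ℝ :=
  m * (walkConst μ (m + 1) (Option (Fin (m + 1))) + walkConst μ m (Option (Option (Fin m))))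
    + (μ ^ 4 + 4)

theorem sum_recursionError_le
    (hK : IsIncoherentFrame D K p μ) (hμ : 0 ≤ μ) (hn : 1 ≤ n) (hnp : (n : ℝ) ≤ p)
    (hpN : p ≤ D.card) (hδρ : √(n / p) ≤ δ) (hδN : p / D.card ≤ δ) (hδn : (1 : ℝ) / n ≤ δ)
    (hδ1 : δ ≤ 1) (m : ℕ) :
    ∑ S ∈ D.powersetCard n, recursionError (offDiag K √(p / n)) S m
      ≤ (D.powersetCard n).card * (recursionBound μ m * δ * n) := by
  classical
  have hn0 : (0 : ℝ) < n := by exact_mod_cast hn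
  have hp0 : 0 < p := by linarith
  have hnN : n ≤ D.card := by exact_mod_cast hnp.trans hpN
  have hlasso : ∀ k : Fin m, _ := fun k => sum_normSq_walkSum_le hK hμ hn hnp hpN hδρ hδN hδn hδ1
    (isWalk_lasso (j := k.succ.succ) (Fin.succ_ne_zero _)) (Or.inr ⟨rfl, hasCore_lasso (by simp)⟩)
  have hdetour : ∀ k : Fin m, _ := fun k => sum_normSq_walkSum_le hK hμ hn hnp hpN hδρ hδN hδn hδ1
    (isWalk_detour (j := k.succ) (Fin.succ_ne_zero _))
    (Or.inr ⟨rfl, hasCore_detour (Fin.succ_ne_zero _)⟩)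
  have hdiag := sum_sq_sum_sub_one_le (D := D) (c := μ ^ 2)
    (g := fun x u => ‖offDiag K √(p / n) x u‖ ^ 2) hn hp0.le hpN hnN (fun x u => sq_nonneg _)
    (fun x => by simp [offDiag]) (fun x hx => (normSq_offDiag hK hp0 hn hx).1)
    (fun x hx => (normSq_offDiag hK hp0 hn hx).2)
  unfold recursionError
  rw [Finset.sum_add_distrib, Finset.sum_comm]
  simp_rw [Finset.sum_add_distrib (s := D.powersetCard n)]
  have h1δ : 1 ≤ δ * n := by rwa [div_le_iff₀ hn0] at hδn
  set M : ℝ := ((D.powersetCard n).card : ℝ) with hM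
  have hM0 : 0 ≤ M := Nat.cast_nonneg _
  calc _ ≤ ∑ _k : Fin m, (M * (walkConst μ (m + 1) (Option (Fin (m + 1))) * δ * n)
          + M * (walkConst μ m (Option (Option (Fin m))) * δ * n))
        + M * ((μ ^ 2) ^ 2 + 2 + 2 * n * (p / D.card)) :=
        add_le_add (Finset.sum_le_sum fun k _ => add_le_add (hlasso k) (hdetour k)) hdiag
    _ ≤ ∑ _k : Fin m, (M * (walkConst μ (m + 1) (Option (Fin (m + 1))) * δ * n)
          + M * (walkConst μ m (Option (Option (Fin m))) * δ * n))
        + M * (((μ ^ 2) ^ 2 + 2) * (δ * n) + 2 * n * δ) := by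
        gcongr
        exact le_mul_of_one_le_right (by positivity) h1δ
    _ = _ := by
        rw [Finset.sum_const, Finset.card_univ, Fintype.card_fin, nsmul_eq_mul, recursionBound]
        ring

open Classical in
/-- Markov's inequality for a uniformly random element of a finite set. -/
theorem card_filter_lt_le {α : Type*} (s : Finset α) {Y : α → ℝ} (hY : ∀ x ∈ s, 0 ≤ Y x)
    {t B : ℝ} (ht : 0 < t) (hB : ∑ x ∈ s, Y x ≤ s.card * B) :
    ((s.filter fun x => t < Y x).card : ℝ) ≤ s.card * (B / t) := by
  rw [← mul_div_assoc, le_div_iff₀ ht]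
  calc _ = ∑ x ∈ s.filter fun x => t < Y x, t := by rw [Finset.sum_const, nsmul_eq_mul]
    _ ≤ ∑ x ∈ s.filter fun x => t < Y x, Y x :=
      Finset.sum_le_sum fun x hx => (Finset.mem_filter.1 hx).2.le
    _ ≤ ∑ x ∈ s, Y x := Finset.sum_le_sum_of_subset_of_nonneg (Finset.filter_subset _ _)
      fun x hx _ => hY x hx
    _ ≤ _ := hB

end Expectation

section Dictionary

variable {p : ℕ} [Fact p.Prime] {D : Finset (Signal p)}

theorem IsDisjointUnionOfBases.exists_sum_eq (h : IsDisjointUnionOfBases D) :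
    ∃ (m : ℕ) (B : Fin m → OrthonormalBasis (Fin p) ℂ (Signal p)),
      D.card = m * p ∧ (∀ a ∈ D, ‖a‖ = 1) ∧
      ∀ F : Signal p → ℂ, ∑ c ∈ D, F c = ∑ x, ∑ i, F (B x i) := by
  classical
  obtain ⟨m, B, hdisj, hD⟩ := h
  have hinj : Function.Injective fun y : Fin m × Fin p => B y.1 y.2 := by
    rintro ⟨x, i⟩ ⟨y, j⟩ hxy
    have hxy : B x i = B y j := hxy
    have e : x = y := by
      by_contra hne
      exact Set.disjoint_left.1 (hdisj hne) ⟨i, rfl⟩ ⟨j, hxy.symm⟩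
    subst e
    rw [(B x).orthonormal.linearIndependent.injective hxy]
  have hDim : D = Finset.univ.image fun y : Fin m × Fin p => B y.1 y.2 := by
    ext a
    rw [← Finset.mem_coe, hD]
    simp
  refine ⟨m, B, ?_, ?_, fun F => ?_⟩
  · rw [hDim, Finset.card_image_of_injective _ hinj]
    simp
  · intro a ha
    rw [hDim, Finset.mem_image] at ha
    obtain ⟨y, -, rfl⟩ := ha
    exact (B y.1).norm_eq_one y.2
  · rw [hDim, Finset.sum_image hinj.injOn, Fintype.sum_prod_type]

theorem IsDisjointUnionOfBases.norm_eq_one (h : IsDisjointUnionOfBases D) {a : Signal p}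
    (ha : a ∈ D) : ‖a‖ = 1 := by
  obtain ⟨_, _, _, h1, _⟩ := h.exists_sum_eq
  exact h1 a ha

/-- The tight frame identity is the sum of Parseval's identities for the bases. -/
theorem IsDisjointUnionOfBases.isIncoherentFrame {μ : ℝ} (h : IsDisjointUnionOfBases D)
    (hcoh : IsCoherent μ D) : IsIncoherentFrame D (fun a b => inner ℂ a b) p μ where
  self a ha := by rw [inner_self_eq_norm_sq_to_K, h.norm_eq_one ha]; simp
  conj_symm a b := inner_conj_symm b a
  norm_le a ha b hb hab := hcoh a ha b hb hab
  sum_mul a _ b _ := by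
    obtain ⟨m, B, hcard, -, hsum⟩ := h.exists_sum_eq
    have hp : (p : ℝ) ≠ 0 := by exact_mod_cast (Fact.out : p.Prime).ne_zero
    rw [hsum, Finset.sum_congr rfl fun x _ => (B x).sum_inner_mul_inner a b, hcard]
    push_cast
    rw [Finset.sum_const, Finset.card_univ, Fintype.card_fin, nsmul_eq_mul,
      mul_div_cancel_right₀ _ (by exact_mod_cast hp)]

/-- The probability that the spectral distribution is far from the semicircle, by Markov's
inequality for the Hilbert-Schmidt norms in the deterministic criterion. -/
theorem subsetProb_le {μ δ η τ : ℝ} {C : ℕ → ℝ} {K n : ℕ} (f : ℝ →ᵇ ℝ) (hτ : 0 < τ)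
    (hC : ∀ m, 0 < C m)
    (H : ∀ S : Finset (Signal p), 0 < S.card → (∀ a ∈ S, ‖a‖ = 1) →
      (∀ m ≤ K, hsSq S (pathSum (errorKernel p S.card) S m) ≤ C m * S.card) →
      (∀ m ≤ K, recursionError (errorKernel p S.card) S m ≤ τ * S.card) →
      |∫ x, f x ∂(spectralDistribution S) - ∫ x, f x ∂semicircle| < η)
    (h : IsDisjointUnionOfBases D) (hcoh : IsCoherent μ D) (hμ : 0 ≤ μ) (hn : 1 ≤ n)
    (hnp : (n : ℝ) ≤ p) (hpN : (p : ℝ) ≤ D.card) (hδρ : √((n : ℝ) / p) ≤ δ)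
    (hδN : (p : ℝ) / D.card ≤ δ) (hδn : (1 : ℝ) / n ≤ δ) (hδ1 : δ ≤ 1) :
    subsetProb D n (fun S =>
        η ≤ |∫ x, f x ∂(spectralDistribution S) - ∫ x, f x ∂semicircle|)
      ≤ ∑ m ∈ Finset.range (K + 1), pathBound μ m / C m
        + (∑ m ∈ Finset.range (K + 1), recursionBound μ m / τ) * δ := by
  classical
  have hn0 : (0 : ℝ) < n := by exact_mod_cast hn
  have hK := h.isIncoherentFrame hcoh
  have hnN : n ≤ D.card := by exact_mod_cast hnp.trans hpN
  have hM0 : (0 : ℝ) < (D.powersetCard n).card := by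
    rw [Finset.card_powersetCard]
    exact_mod_cast Nat.choose_pos hnN
  set A : Signal p → Signal p → ℂ := errorKernel p n with hA
  set X : ℕ → Finset (Finset (Signal p)) := fun m =>
    (D.powersetCard n).filter fun S => C m * n < hsSq S (pathSum A S m) with hX
  set Y : ℕ → Finset (Finset (Signal p)) := fun m =>
    (D.powersetCard n).filter fun S => τ * n < recursionError A S m with hY
  have hXcard : ∀ m, ((X m).card : ℝ) ≤ (D.powersetCard n).card * (pathBound μ m / C m) := by
    intro m
    have := card_filter_lt_le (D.powersetCard n) (Y := fun S => hsSq S (pathSum A S m))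
      (fun S _ => hsSq_nonneg _ _) (mul_pos (hC m) hn0)
      (sum_hsSq_pathSum_le hK hμ hn hnp hpN hδρ hδN hδn hδ1 m)
    rwa [mul_div_mul_right _ _ hn0.ne'] at this
  have hYcard : ∀ m, ((Y m).card : ℝ) ≤ (D.powersetCard n).card * (recursionBound μ m * δ / τ) := by
    intro m
    have := card_filter_lt_le (D.powersetCard n) (Y := fun S => recursionError A S m)
      (fun S _ => add_nonneg (Finset.sum_nonneg fun k _ =>
        add_nonneg (hsSq_nonneg _ _) (hsSq_nonneg _ _))
        (Finset.sum_nonneg fun a _ => sq_nonneg _)) (mul_pos hτ hn0)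
      (sum_recursionError_le hK hμ hn hnp hpN hδρ hδN hδn hδ1 m)
    rwa [mul_div_mul_right _ _ hn0.ne'] at this
  have hsub : (D.powersetCard n).filter (fun S =>
        η ≤ |∫ x, f x ∂(spectralDistribution S) - ∫ x, f x ∂semicircle|)
      ⊆ (Finset.range (K + 1)).biUnion X ∪ (Finset.range (K + 1)).biUnion Y := by
    intro S hS
    obtain ⟨hSD, hbad⟩ := Finset.mem_filter.1 hS
    obtain ⟨hsubD, hcard⟩ := Finset.mem_powersetCard.1 hSD
    by_contra hnot
    simp only [Finset.mem_union, Finset.mem_biUnion, Finset.mem_range, not_or, not_exists,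
      not_and, hX, hY, Finset.mem_filter, hSD, true_and, not_lt] at hnot
    refine absurd (H S (by omega) (fun a ha => h.norm_eq_one (hsubD ha)) ?_ ?_) (not_lt.2 hbad)
    · intro m hm
      rw [hcard]
      exact hnot.1 m (by omega)
    · intro m hm
      rw [hcard]
      exact hnot.2 m (by omega)
  have hcard : (((D.powersetCard n).filter (fun S =>
        η ≤ |∫ x, f x ∂(spectralDistribution S) - ∫ x, f x ∂semicircle|)).card : ℝ)
      ≤ ∑ m ∈ Finset.range (K + 1), ((X m).card : ℝ)
        + ∑ m ∈ Finset.range (K + 1), ((Y m).card : ℝ) := by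
    have h1 := (Finset.card_le_card hsub).trans (Finset.card_union_le _ _)
    have h2 := h1.trans (add_le_add (Finset.card_biUnion_le) (Finset.card_biUnion_le))
    exact_mod_cast h2
  have e : subsetProb D n (fun S =>
        η ≤ |∫ x, f x ∂(spectralDistribution S) - ∫ x, f x ∂semicircle|)
      = (((D.powersetCard n).filter (fun S =>
        η ≤ |∫ x, f x ∂(spectralDistribution S) - ∫ x, f x ∂semicircle|)).card : ℝ)
        / (D.powersetCard n).card := by
    unfold subsetProb
    congr!
  rw [e, div_le_iff₀ hM0]
  refine hcard.trans ((add_le_add (Finset.sum_le_sum fun m _ => hXcard m)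
    (Finset.sum_le_sum fun m _ => hYcard m)).trans (le_of_eq ?_))
  rw [← Finset.mul_sum, ← Finset.mul_sum, ← mul_add, mul_comm, Finset.sum_mul]
  congr 2
  exact Finset.sum_congr rfl fun m _ => by ring

end Dictionary

/-! ### Asymptotics -/

section Asymptotics

theorem tendsto_coe_subtype_atTop {P : Set ℕ} (hP : P.Infinite) :
    Tendsto (fun p : P => ((p : ℕ) : ℝ)) atTop atTop := by
  refine tendsto_natCast_atTop_atTop.comp
    (tendsto_atTop_atTop_of_monotone (fun _ _ h => h) fun b => ?_)
  obtain ⟨a, ha, hab⟩ := hP.exists_gt b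
  exact ⟨⟨a, ha⟩, hab.le⟩

theorem tendsto_round_rpow {α : Type*} {l : Filter α} {p : α → ℝ} (hp : Tendsto p l atTop) {ε : ℝ}
    (hε0 : 0 < ε) (hε1 : ε < 1) {n : α → ℕ} (hn : ∀ x, |(n x : ℝ) - p x ^ (1 - ε)| < 1) :
    Tendsto (fun x => (n x : ℝ)) l atTop ∧ Tendsto (fun x => (n x : ℝ) / p x) l (𝓝 0) := by
  constructor
  · have h1 : Tendsto (fun x => p x ^ (1 - ε) - 1) l atTop :=
      tendsto_atTop_add_const_right _ (-1) ((tendsto_rpow_atTop (by linarith)).comp hp)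
    exact tendsto_atTop_mono (fun x => by linarith [(abs_lt.1 (hn x)).1]) h1
  · have h1 : Tendsto (fun x => p x ^ (-ε) + (p x)⁻¹) l (𝓝 (0 + 0)) :=
      ((tendsto_rpow_neg_atTop hε0).comp hp).add (tendsto_inv_atTop_zero.comp hp)
    rw [add_zero] at h1
    refine squeeze_zero' ?_ ?_ h1
    · filter_upwards [hp.eventually_gt_atTop 0] with x hx
      positivity
    · filter_upwards [hp.eventually_gt_atTop 0] with x hx
      rw [div_le_iff₀ hx, add_mul, inv_mul_cancel₀ hx.ne', ← Real.rpow_add_one hx.ne']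
      have h2 := (abs_lt.1 (hn x)).2
      rw [neg_add_eq_sub]
      linarith

end Asymptotics

theorem theorem2
    -- an infinite set of primes, through which `p` tends to infinity
    (P : Set ℕ) (hP : P.Infinite) [∀ p : P, Fact (p : ℕ).Prime]
    (ε : ℝ) (hε0 : 0 < ε) (hε1 : ε < 1)
    (μ : ℝ) (hμ : 0 < μ)
    (D : (p : P) → Finset (Signal (p : ℕ)))
    (hcoh : ∀ p : P, IsCoherent μ (D p))
    (hbases : ∀ p : P, IsDisjointUnionOfBases (D p))
    -- `|D| ≫ p`
    (hlarge : Tendsto (fun p : P => ((D p).card : ℝ) / ((p : ℕ) : ℝ)) atTop atTop)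
    -- `n = p^{1-ε}`, rounded to an integer (down or up)
    (n : P → ℕ)
    (hn : ∀ p : P, |(n p : ℝ) - ((p : ℕ) : ℝ) ^ (1 - ε)| < 1) :
    -- weak convergence in probability of the random measures `ρ_{E(S)}` to the semicircle law
    ∀ (f : ℝ →ᵇ ℝ) (η : ℝ), 0 < η →
      Tendsto
        (fun p : P => subsetProb (D p) (n p) fun S =>
          η ≤ |∫ x, f x ∂(spectralDistribution S) - ∫ x, f x ∂semicircle|)
        atTop (𝓝 0) := by
  intro f η hη
  have hp := tendsto_coe_subtype_atTop hP
  obtain ⟨hn1, hn2⟩ := tendsto_round_rpow hp hε0 hε1 hn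
  set δ : P → ℝ := fun p => √((n p : ℝ) / (p : ℕ)) + (((p : ℕ) : ℝ) / (D p).card + 1 / (n p : ℝ))
    with hδ
  have hδ0 : Tendsto δ atTop (𝓝 0) := by
    have h1 : Tendsto (fun p : P => √((n p : ℝ) / (p : ℕ))) atTop (𝓝 0) := by
      simpa using hn2.sqrt
    have h2 : Tendsto (fun p : P => ((p : ℕ) : ℝ) / (D p).card) atTop (𝓝 0) := by
      refine (tendsto_inv_atTop_zero.comp hlarge).congr fun p => ?_
      simp
    have h3 : Tendsto (fun p : P => 1 / (n p : ℝ)) atTop (𝓝 0) := by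
      simpa [Function.comp_def] using tendsto_inv_atTop_zero.comp hn1
    have h := h1.add (h2.add h3)
    rwa [add_zero, add_zero] at h
  refine tendsto_order.2 ⟨fun a ha => Eventually.of_forall fun p => ha.trans_le ?_, fun κ hκ => ?_⟩
  · exact div_nonneg (Nat.cast_nonneg _) (Nat.cast_nonneg _)
  -- the cut-offs for the path sums grow so fast that the total probability of exceeding them is
  -- at most `κ / 2`
  have hC : ∀ m, 0 < pathBound μ m * 2 ^ (m + 1) * (2 / κ) := fun m => by
    have := pathBound_pos μ m
    positivity
  obtain ⟨τ, K, hτ, H⟩ :=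
    exists_forall_abs_integral_sub_lt (fun m => pathBound μ m * 2 ^ (m + 1) * (2 / κ)) f hη
  have hgeom : ∑ m ∈ Finset.range (K + 1),
      pathBound μ m / (pathBound μ m * 2 ^ (m + 1) * (2 / κ)) ≤ κ / 2 := by
    have e : ∀ m, pathBound μ m / (pathBound μ m * 2 ^ (m + 1) * (2 / κ))
        = κ / 4 * (1 / 2) ^ m := fun m => by
      have := (pathBound_pos μ m).ne'
      rw [one_div, inv_pow]
      field_simp
      ring
    simp_rw [e]
    rw [← Finset.mul_sum]
    have := sum_geometric_two_le (K + 1)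
    nlinarith
  have hsmall : Tendsto
      (fun p => (∑ m ∈ Finset.range (K + 1), recursionBound μ m / τ) * δ p) atTop (𝓝 0) := by
    simpa using hδ0.const_mul (∑ m ∈ Finset.range (K + 1), recursionBound μ m / τ)
  filter_upwards [hsmall.eventually_lt_const (half_pos hκ), hδ0.eventually_le_const one_pos,
    hn1.eventually_ge_atTop 1, hn2.eventually_le_const one_pos, hlarge.eventually_ge_atTop 1,
    hp.eventually_gt_atTop 0] with p h1 h2 h3 h4 h5 h6
  have hs := Real.sqrt_nonneg ((n p : ℝ) / (p : ℕ))
  have hr : 0 ≤ ((p : ℕ) : ℝ) / (D p).card := by positivity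
  have hq : 0 ≤ 1 / (n p : ℝ) := by positivity
  have hb := subsetProb_le (δ := δ p) f hτ hC (fun S => H (p : ℕ) S) (hbases p) (hcoh p) hμ.le
    (by exact_mod_cast h3) ((div_le_one h6).1 h4) ((one_le_div h6).1 h5) (by simp only [hδ]; linarith)
    (by simp only [hδ]; linarith) (by simp only [hδ]; linarith) h2
  linarith
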